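/- **Setting.** Let the spatial domain $\Omega$ be either $\mathbb{R}^3$, or a box $\prod_{i=1}^d[0,L_i)$ ($L_i>0$) with periodic boundary conditions. Work in the complex Hilbert space $L^2(\Omega)$ with $\langle g|f\rangle=\int_\Omega g^*f\,dx$; derivatives of $L^2$ functions are weak derivatives. Let real $C^2$ functions $\Psi_{eq},V_{eq}$ and real numbers $E_{eq},\Lambda$ form an equilibrium of the Schrödinger–Poisson equation, $$E_{eq}\Psi_{eq}=\Big(-\tfrac12\nabla^2+V_{eq}\Big)\Psi_{eq},\qquad \nabla^2V_{eq}=|\Psi_{eq}|^2-\Lambda,$$ where $\Lambda$ is the mean of $|\Psi_{eq}|^2$ over $\Omega$ (so $\Lambda=0$ on $\mathbb{R}^3$), with $\Psi_{eq},V_{eq}$ periodic in the case of the box, and $\Psi_{eq}\in L^2$, $\Psi_{eq}\to0$, $V_{eq}\to0$ at infinity in the case of $\mathbb{R}^3$. Put $$\hat H=-\tfrac12\nabla^2+V_{eq}-E_{eq},\qquad \hat G=2\Psi_{eq}\nabla^{-2}\Psi_{eq},\qquad \hat\Theta=\hat H+\hat G,$$ where $\hat H$ has the domain $\{f\in L^2:\hat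 Hf\in L^2\}$, and $\nabla^{-2}f$ is the Newtonian potential $-\int\frac{f(y)}{4\pi|x-y|}dy$ on $\mathbb{R}^3$, and on the box the mean-zero solution $u$ of $\nabla^2u=f-\langle f\rangle$, $\langle f\rangle$ being the mean of $f$. An eigenvalue $\omega^2\in\mathbb{C}$ of $\hat\Theta\hat H$ is a number with $\hat\Theta\hat H\eta=\omega^2\eta$ for some $\eta\neq0$ in the domain of $\hat\Theta\hat H$. **Theorem.** Suppose that $\Psi_{eq}$ is the ground state of $\hat H$, i.e. $\Psi_{eq}\ne0$ is an eigenfunction of $\hat H$ belonging to the lowest eigenvalue of $\hat H$. Then every eigenvalue of $\hat\Theta\hat H$ is real, there is a lowest eigenvalue $\omega^2_{lowest}$ of $\hat\Theta\hat H$, and $$\omega^2_{lowest}\le\frac{\langle\eta|\hat H\hat\Theta\hat H|\eta\rangle}{\langle\eta|\hat H|\eta\rangle}$$ for every trial function $\eta$ with $\langle\eta|\hat H|\eta\rangle>0$. Here $\eta$ may be any function in the domain of $\hat H\hat\Theta\hat H$, or more generally in the domain of $\hat\Theta\hat H$ with the numerator read as $\langle\hat H\eta|\hat\Theta\hat H\eta\rangle$.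 -/

import Mathlib

open MeasureTheory Filter Topology
open scoped Laplacian ContDiff

noncomputable section

namespace SchrodingerPoisson

/-- Euclidean space `ℝ^d`. -/
abbrev Space (d : ℕ) : Type := EuclideanSpace ℝ (Fin d)

/-- The spatial domains: all of `ℝ³` (isolated configurations), and a box of arbitrary dimension
with side lengths `L i > 0` and periodic boundary conditions. -/
inductive Domain : ℕ → Type
  | wholeSpace : Domain 3
  | periodicBox {d : ℕ} (L : Fin d → ℝ) (hL : ∀ i, 0 < L i) : Domain d

/-- The fundamental cell `∏ i, [0, L i)` of the periodic box. -/
def cell {d : ℕ} (L : Fin d → ℝ) : Set (Space d) :=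
  {x | ∀ i, x i ∈ Set.Ico 0 (L i)}

/-- `f` has period `L i` in the `i`-th coordinate direction, for every `i`. -/
def IsPeriodic {d : ℕ} {F : Type*} (L : Fin d → ℝ) (f : Space d → F) : Prop :=
  ∀ (i : Fin d) (x : Space d), f (x + EuclideanSpace.single i (L i)) = f x

namespace Domain

/-- Lebesgue measure on the domain. -/
def measure : {d : ℕ} → Domain d → Measure (Space d)
  | _, wholeSpace => volume
  | _, periodicBox L _ => volume.restrict (cell L)

/-- The Hilbert space of complex square-integrable functions on the domain, with Mathlib's inner
product `inner ℂ g f = ∫ conj (g x) * f x`. -/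
abbrev L2 {d : ℕ} (D : Domain d) : Type := Lp ℂ 2 D.measure

/-- Test functions: smooth and compactly supported on `ℝ³`, smooth and periodic on the box. -/
def IsTest : {d : ℕ} → Domain d → (Space d → ℂ) → Prop
  | _, wholeSpace, φ => ContDiff ℝ ∞ φ ∧ HasCompactSupport φ
  | _, periodicBox L _, φ => ContDiff ℝ ∞ φ ∧ IsPeriodic L φ

/-- Boundary conditions on a background wave function and its potential: square integrability and
decay at infinity on `ℝ³`, periodicity on the box. -/
def BoundaryConditions : {d : ℕ} → Domain d → (Space d → ℝ) → (Space d → ℝ) → Prop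
  | _, wholeSpace, Ψ, V =>
      MemLp Ψ 2 volume ∧ Tendsto Ψ (cocompact _) (𝓝 0) ∧ Tendsto V (cocompact _) (𝓝 0)
  | _, periodicBox L _, Ψ, V => IsPeriodic L Ψ ∧ IsPeriodic L V

/-- `u = ∇⁻² f`. On `ℝ³` this is the Newtonian potential of `f`. On the box `∇⁻²` inverts the
Laplacian on the functions of mean zero and annihilates the constants: `u` is the
square-integrable function of mean zero with `∇² u = f - ⟨f⟩` weakly. -/
def IsInvLaplacian : {d : ℕ} → Domain d → (Space d → ℂ) → (Space d → ℂ) → Prop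
  | _, wholeSpace, f, u =>
      ∀ x, u x = -∫ y, ((1 / (4 * Real.pi * ‖x - y‖) : ℝ) : ℂ) * f y
  | _, periodicBox L hL, f, u =>
      MemLp u 2 (periodicBox L hL).measure ∧
      ∫ x, u x ∂(periodicBox L hL).measure = 0 ∧
      ∀ φ, (periodicBox L hL).IsTest φ →
        ∫ x, u x * (Δ φ) x ∂(periodicBox L hL).measure =
          ∫ x, (f x - ⨍ y, f y ∂(periodicBox L hL).measure) * φ x
            ∂(periodicBox L hL).measure

end Domain

/-- An equilibrium of the Schrödinger–Poisson equation, in units `ħ = 4πG = m = 1`, with real wave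
function `Ψ`, potential `V`, eigenenergy `E` and cosmological constant `Λ`. -/
structure Equilibrium {d : ℕ} (D : Domain d) where
  /-- background wave function -/
  Ψ : Space d → ℝ
  /-- background gravitational potential -/
  V : Space d → ℝ
  /-- background eigenenergy -/
  E : ℝ
  /-- cosmological constant -/
  Λ : ℝ
  contDiff_Ψ : ContDiff ℝ 2 Ψ
  contDiff_V : ContDiff ℝ 2 V
  boundary : D.BoundaryConditions Ψ V
  schrodinger : ∀ x, E * Ψ x = -(1 / 2) * (Δ Ψ) x + V x * Ψ x
  poisson : ∀ x, (Δ V) x = |Ψ x| ^ 2 - Λ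
  /-- `Λ` is the mean mass density; on `ℝ³`, which has infinite volume, the mean is `0`. -/
  mean_density : Λ = ⨍ x, |Ψ x| ^ 2 ∂D.measure

namespace Equilibrium

variable {d : ℕ} {D : Domain d}

/-- `Ĥ f = g`, where `Ĥ = -∇²/2 + V - E` acts in the sense of weak derivatives: its domain
consists of all `f ∈ L²` for which `Ĥ f`, computed weakly, lies in `L²`. -/
def HamiltonianEq (bg : Equilibrium D) (f g : D.L2) : Prop :=
  ∀ φ, D.IsTest φ →
    ∫ x, f x * (-(1 / 2) * (Δ φ) x + ((bg.V x - bg.E : ℝ) : ℂ) * φ x) ∂D.measure =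
      ∫ x, g x * φ x ∂D.measure

/-- `Ĝ f = g`, where `Ĝ = 2 Ψ ∇⁻² Ψ` is the perturbed self-gravity operator. -/
def GravityEq (bg : Equilibrium D) (f g : D.L2) : Prop :=
  ∃ u : Space d → ℂ, D.IsInvLaplacian (fun x => (bg.Ψ x : ℂ) * f x) u ∧
    g =ᵐ[D.measure] fun x => 2 * (bg.Ψ x : ℂ) * u x

/-- `Θ̂ f = g`, where `Θ̂ = Ĥ + Ĝ`. -/
def ThetaEq (bg : Equilibrium D) (f g : D.L2) : Prop :=
  ∃ a b : D.L2, bg.HamiltonianEq f a ∧ bg.GravityEq f b ∧ g = a + b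

/-- `Ψ` is the ground state of `Ĥ`: a (nonzero) eigenfunction of `Ĥ` belonging to the lowest
eigenvalue of `Ĥ`. -/
def IsGroundState (bg : Equilibrium D) : Prop :=
  ∃ ψ : D.L2, ψ ≠ 0 ∧ (ψ =ᵐ[D.measure] fun x => (bg.Ψ x : ℂ)) ∧
    ∃ e : ℝ, bg.HamiltonianEq ψ ((e : ℂ) • ψ) ∧
      ∀ (e' : ℝ) (f : D.L2), f ≠ 0 → bg.HamiltonianEq f ((e' : ℂ) • f) → e ≤ e'

/-- `ω2` is an eigenvalue of `Θ̂Ĥ`: `Θ̂ R = ω2 η` and `R = Ĥ η` for some `η ≠ 0`. -/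
def IsEigenvalue (bg : Equilibrium D) (ω2 : ℂ) : Prop :=
  ∃ η R : D.L2, η ≠ 0 ∧ bg.HamiltonianEq η R ∧ bg.ThetaEq R (ω2 • η)

end Equilibrium

end SchrodingerPoisson

end

open MeasureTheory Filter Topology
open scoped Laplacian ContDiff

noncomputable section

/-! The ground state hypothesis makes `Ĥ` nonnegative. If `Θ̂Ĥη = ω²η` and `R = Ĥη`, pairing with
`R` gives `⟨R|Θ̂R⟩ = ω²⟨η|Ĥη⟩`. Both forms are real, so `ω²` is real; if `⟨η|Ĥη⟩ = 0`, then `Ĥ ≥ 0`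
forces `Ĥη = 0` and `ω² = 0`.

Let `κ₀` be the least `κ ≥ 0` with `⟨R|Θ̂R⟩ + κ⟨η|R⟩ ≥ 0` for all `η`. It exists because `Ĝ` is
bounded and `Ĥ ≥ 0`, and `-κ₀` is a lower bound for every eigenvalue and every trial quotient. The
substance is that `-κ₀` is an eigenvalue. If `κ₀ = 0`, the zero mode `Ψ` is an eigenvector. If `κ₀ >
0`, a Birman–Schwinger argument applies (`exists_eigenvector_or_decrease`): with `S² = Ĥ(Ĥ² + κ₀)⁻¹`
the form becomes that of `1 + SĜS ≥ 0`, a compact perturbation of the identity. Either it has a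
kernel, which yields an eigenvector for `-κ₀`, or it is coercive, and then `κ₀` could be decreased.
`pencil_lowest_eigenvalue` assembles this. Unbounded operators enter only through the bounded
resolvent `B = (Ĥ + c)⁻¹`, by means of `InvEq`.

To see that `Ĥ ≥ 0` (`one_sub_isPositive`), the part of the spectrum below the essential spectrum
must consist of eigenvalues, and the essential spectrum must be nonnegative. On the box the
resolvent is compact and nothing remains to be shown. On `ℝ³` the essential spectrum starts at `-E`,
so `E < 0` is needed. By the maximum principle `V ≤ 0`; a trial function spread over radius `R` has
kinetic energy of order `R` and potential energy below a negative multiple of `R²`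
(`exists_negative_energy`). Hence `-∇²/2 + V` has a negative eigenvalue `e`, and minimality of the
eigenvalue `0` of `Ĥ` gives `E ≤ e < 0`.

Compactness of `Ĝ` and relative compactness of `V` on `ℝ³` come from square-integrable kernels
(`exists_carleman`); on the box, from Fourier coefficients tending to zero. -/

namespace SchrodingerPoisson

/-! ### Bounded positive operators and compact perturbations. -/

section Operators

variable {X : Type*} [NormedAddCommGroup X] [InnerProductSpace ℂ X] [CompleteSpace X]

/-- A bounded positive operator has a positive square root commuting with its commutant. -/
lemma exists_positive_sqrt {T : X →L[ℂ] X} (hT : T.IsPositive) :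
    ∃ S : X →L[ℂ] X, S.IsPositive ∧ S * S = T ∧ ∀ U, Commute U T → Commute U S := by
  have h0 : (0 : X →L[ℂ] X) ≤ T := (ContinuousLinearMap.nonneg_iff_isPositive T).2 hT
  refine ⟨CFC.sqrt T, (ContinuousLinearMap.nonneg_iff_isPositive _).1 (CFC.sqrt_nonneg T),
    CFC.sqrt_mul_sqrt_self T h0, fun U hU => ?_⟩
  exact (Commute.cfcₙ_nnreal hU.symm _).symm

/-- Write `T = S²`: then `⟨Tx, x⟩ = ‖Sx‖²` and, by the C*-identity, `‖T‖ = ‖S‖²`. The bound turns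
lower estimates of `‖Tx‖` into lower estimates of the quadratic form. -/
lemma isPositive_sq_le {T : X →L[ℂ] X} (hT : T.IsPositive) (x : X) :
    ‖T x‖ ^ 2 ≤ ‖T‖ * (inner ℂ (T x) x).re := by
  obtain ⟨S, hS, rfl, -⟩ := exists_positive_sqrt hT
  have h1 : (inner ℂ ((S * S) x) x).re = ‖S x‖ ^ 2 := by
    have : inner ℂ (S (S x)) x = inner ℂ (S x) (S x) := hS.inner_left_eq_inner_right _ _
    rw [mul_apply_eq_comp, this]
    exact inner_self_eq_norm_sq (𝕜 := ℂ) (S x)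
  have h2 : ‖S * S‖ = ‖S‖ * ‖S‖ := by
    have := CStarRing.norm_star_mul_self (x := S)
    rwa [hS.isSelfAdjoint.star_eq] at this
  rw [h1, h2, mul_apply_eq_comp]
  have h3 := S.le_opNorm (S x)
  calc ‖S (S x)‖ ^ 2 ≤ (‖S‖ * ‖S x‖) ^ 2 := by gcongr
    _ = _ := by ring

/-- Lax–Milgram. -/
lemma isUnit_of_coercive {Q : X →L[ℂ] X} {δ : ℝ} (hδ : 0 < δ)
    (hQ : ∀ x, δ * ‖x‖ ^ 2 ≤ (inner ℂ (Q x) x).re) : IsUnit Q := by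
  refine ContinuousLinearMap.isUnit_of_forall_le_norm_inner_map Q (c := ⟨δ, hδ.le⟩) hδ fun x => ?_
  calc ‖x‖ ^ 2 * δ = δ * ‖x‖ ^ 2 := mul_comm _ _
    _ ≤ _ := hQ x
    _ ≤ _ := Complex.re_le_norm _

/-- A positive injective operator which is a compact perturbation of a coercive operator is
coercive. -/
lemma coercive_of_compact_perturbation {P Q : X →L[ℂ] X} (hP : P.IsPositive) {δ : ℝ} (hδ : 0 < δ)
    (hQ : ∀ x, δ * ‖x‖ ^ 2 ≤ (inner ℂ (Q x) x).re) (hC : IsCompactOperator (Q - P))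
    (hinj : ∀ x, P x = 0 → x = 0) :
    ∃ ε > 0, ∀ x, ε * ‖x‖ ^ 2 ≤ (inner ℂ (P x) x).re := by
  obtain ⟨Qu, hQu⟩ := isUnit_of_coercive hδ hQ
  set Qi : X →L[ℂ] X := ↑Qu⁻¹ with hQi
  have hQQi : ∀ x, Q (Qi x) = x := fun x => by
    have : Q * Qi = 1 := by rw [← hQu]; exact Qu.mul_inv
    simpa using congrArg (fun T : X →L[ℂ] X => T x) this
  have hQiQ : ∀ x, Qi (Q x) = x := fun x => by
    have : Qi * Q = 1 := by rw [← hQu]; exact Qu.inv_mul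
    simpa using congrArg (fun T : X →L[ℂ] X => T x) this
  -- `T = 1 - Q⁻¹P` is compact and injectivity of `P` excludes its eigenvalue `1`; the Fredholm
  -- alternative then bounds `1 - T = Q⁻¹P`, and hence `P`, from below.
  set T : X →L[ℂ] X := Qi * (Q - P) with hT
  have hTc : IsCompactOperator T := hC.clm_comp Qi
  have hTx : ∀ x, T x = x - Qi (P x) := fun x => by simp [hT, hQiQ]
  have hne : ¬ Module.End.HasEigenvalue (T : Module.End ℂ X) 1 := by
    intro h
    obtain ⟨v, hv⟩ := h.exists_hasEigenvector
    have h1 : T v = v := by simpa using hv.apply_eq_smul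
    have h2 : Qi (P v) = 0 := by
      have := hTx v
      rw [h1] at this
      exact (sub_eq_self.1 this.symm)
    refine hv.2 (hinj v ?_)
    rw [← hQQi (P v), h2, map_zero]
  obtain ⟨K, hK⟩ := hTc.antilipschitz_of_not_hasEigenvalue one_ne_zero hne
  have hbound : ∀ x, ‖x‖ ≤ (K * ‖Qi‖) * ‖P x‖ := fun x => by
    have h1 := hK.le_mul_dist x 0
    simp only [dist_zero_right, map_zero] at h1
    have h2 : (T - (1 : ℂ) • (1 : X →L[ℂ] X)) x = -Qi (P x) := by simp [hTx]
    rw [h2, norm_neg] at h1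
    calc ‖x‖ ≤ K * ‖Qi (P x)‖ := h1
      _ ≤ K * (‖Qi‖ * ‖P x‖) := by gcongr; exact Qi.le_opNorm _
      _ = _ := by ring
  set k : ℝ := K * ‖Qi‖ with hk
  have hk0 : 0 ≤ k := by positivity
  refine ⟨1 / ((k ^ 2 + 1) * (‖P‖ + 1)), by positivity, fun x => ?_⟩
  have h1 := isPositive_sq_le hP x
  have h2 : 0 ≤ (inner ℂ (P x) x).re := hP.re_inner_nonneg_left x
  have h3 : ‖x‖ ^ 2 ≤ k ^ 2 * ‖P x‖ ^ 2 := by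
    rw [← mul_pow]; exact pow_le_pow_left₀ (norm_nonneg _) (hbound x) 2
  rw [div_mul_eq_mul_div, div_le_iff₀ (by positivity)]
  have hP0 := norm_nonneg P
  calc 1 * ‖x‖ ^ 2 ≤ k ^ 2 * ‖P x‖ ^ 2 := by rw [one_mul]; exact h3
    _ ≤ (k ^ 2 + 1) * ((‖P‖ + 1) * (inner ℂ (P x) x).re) := by
        gcongr
        · linarith
        · nlinarith
    _ = _ := by ring

/-- A self-adjoint operator whose numerical range exceeds the one of a compact perturbation attains
its supremum as an eigenvalue. -/
lemma exists_eigenvalue_gt {B B₀ : X →L[ℂ] X} (hB : IsSelfAdjoint B) {m m' : ℝ} (hm : m ≤ m')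
    (hB₀ : ∀ x, (inner ℂ (B₀ x) x).re ≤ m * ‖x‖ ^ 2) (hC : IsCompactOperator (B - B₀))
    {x₀ : X} (hx₀ : m' * ‖x₀‖ ^ 2 < (inner ℂ (B x₀) x₀).re) :
    ∃ M > m', ∃ f ≠ 0, B f = (M : ℂ) • f := by
  have hx0 : x₀ ≠ 0 := by rintro rfl; simp at hx₀
  have hpos : ∀ {x : X}, x ≠ 0 → 0 < ‖x‖ ^ 2 := fun hx => by have := norm_pos_iff.2 hx; positivity
  set s : Set ℝ := {r | ∃ x ≠ 0, r = (inner ℂ (B x) x).re / ‖x‖ ^ 2} with hs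
  have hbdd : BddAbove s := by
    refine ⟨‖B‖, ?_⟩
    rintro r ⟨x, hx, rfl⟩
    rw [div_le_iff₀ (hpos hx)]
    calc _ ≤ ‖inner ℂ (B x) x‖ := Complex.re_le_norm _
      _ ≤ ‖B x‖ * ‖x‖ := norm_inner_le_norm _ _
      _ ≤ (‖B‖ * ‖x‖) * ‖x‖ := by gcongr; exact B.le_opNorm x
      _ = _ := by ring
  have hmem : (inner ℂ (B x₀) x₀).re / ‖x₀‖ ^ 2 ∈ s := ⟨x₀, hx0, rfl⟩
  set M := sSup s with hM
  have hMm : m' < M := ((lt_div_iff₀ (hpos hx0)).2 hx₀).trans_le (le_csSup hbdd hmem)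
  have hle : ∀ x, (inner ℂ (B x) x).re ≤ M * ‖x‖ ^ 2 := fun x => by
    by_cases hx : x = 0
    · simp [hx]
    · exact (div_le_iff₀ (hpos hx)).1 (le_csSup hbdd ⟨x, hx, rfl⟩)
  have hscal : ∀ (T : X →L[ℂ] X) (x : X), (inner ℂ (((M : ℂ) • (1 : X →L[ℂ] X) - T) x) x).re =
      M * ‖x‖ ^ 2 - (inner ℂ (T x) x).re := fun T x => by
    simp only [sub_apply, smul_apply,
      one_apply_eq_self, inner_sub_left, inner_smul_left, Complex.conj_ofReal,
      Complex.sub_re, Complex.re_ofReal_mul]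
    congr 2
    exact inner_self_eq_norm_sq (𝕜 := ℂ) x
  have hPpos : ((M : ℂ) • (1 : X →L[ℂ] X) - B).IsPositive := by
    rw [ContinuousLinearMap.isPositive_def']
    refine ⟨?_, fun x => ?_⟩
    · refine IsSelfAdjoint.sub ?_ hB
      exact IsSelfAdjoint.smul (by simp [IsSelfAdjoint]) (IsSelfAdjoint.one _)
    · have := hscal B x
      have h2 := hle x
      rw [ContinuousLinearMap.reApplyInnerSelf_apply]
      change 0 ≤ (inner ℂ _ x).re
      rw [this]; linarith
  -- If `M` were not an eigenvalue, `M - B` would be positive, injective and a compact perturbation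
  -- of the coercive `M - B₀`, hence coercive; this would push the numerical range strictly below
  -- its supremum `M`.
  by_contra hcon
  push Not at hcon
  obtain ⟨ε, hε, hcoer⟩ := coercive_of_compact_perturbation (Q := (M : ℂ) • (1 : X →L[ℂ] X) - B₀)
    hPpos (δ := M - m) (by linarith) (fun x => by rw [hscal]; nlinarith [hB₀ x]) (by
      convert hC using 1
      ext x; simp) (fun x hx => by
      by_contra hx0
      refine hcon M hMm x hx0 ?_
      simp only [sub_apply, smul_apply,
        one_apply_eq_self, sub_eq_zero] at hx
      exact hx.symm)
  have : M ≤ M - ε := by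
    refine csSup_le ⟨_, hmem⟩ ?_
    rintro r ⟨x, hx, rfl⟩
    rw [div_le_iff₀ (hpos hx)]
    have := hcoer x
    rw [hscal] at this
    linarith
  linarith

/-- The resolvent of a form sum: `B = (A⁻¹ + M)⁻¹` for positive `A` and `M`. -/
lemma exists_formSum_resolvent {A M : X →L[ℂ] X} (hA : A.IsPositive) (hAinj : ∀ x, A x = 0 → x = 0)
    (hM : M.IsPositive) :
    ∃ B : X →L[ℂ] X, B.IsPositive ∧ (∀ x, B x = 0 → x = 0) ∧
      ∀ x y, y = B x ↔ y = A (x - M y) := by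
  obtain ⟨S, hS, rfl, -⟩ := exists_positive_sqrt hA
  have hSinj : ∀ x, S x = 0 → x = 0 := fun x hx => hAinj x (by simp [hx])
  -- Formally `A⁻¹ + M = S⁻¹(1 + SMS)S⁻¹` with `S² = A`, so the resolvent is `S N⁻¹ S`, and `N ≥ 1`
  -- is invertible.
  set N : X →L[ℂ] X := 1 + S * M * S with hN
  have hSMS : (S * M * S).IsPositive := by
    have := hM.conj_adjoint S
    rw [hS.isSelfAdjoint.adjoint_eq] at this
    exact this
  have hNpos : N.IsPositive := ContinuousLinearMap.isPositive_one.add hSMS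
  have hNcoer : ∀ x, (1 : ℝ) * ‖x‖ ^ 2 ≤ (inner ℂ (N x) x).re := fun x => by
    have h1 := hSMS.re_inner_nonneg_left x
    change 0 ≤ (inner ℂ ((S * M * S) x) x).re at h1
    rw [hN, add_apply, inner_add_left, Complex.add_re,
      one_apply_eq_self]
    have : (inner ℂ x x).re = ‖x‖ ^ 2 := inner_self_eq_norm_sq (𝕜 := ℂ) x
    rw [this]; linarith
  obtain ⟨Nu, hNu⟩ := isUnit_of_coercive one_pos hNcoer
  set Ni : X →L[ℂ] X := ↑Nu⁻¹ with hNi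
  have hNNi : ∀ x, N (Ni x) = x := fun x => by
    have : N * Ni = 1 := by rw [← hNu]; exact Nu.mul_inv
    simpa using congrArg (fun T : X →L[ℂ] X => T x) this
  have hNiN : ∀ x, Ni (N x) = x := fun x => by
    have : Ni * N = 1 := by rw [← hNu]; exact Nu.inv_mul
    simpa using congrArg (fun T : X →L[ℂ] X => T x) this
  have hNipos : Ni.IsPositive := by
    rw [ContinuousLinearMap.isPositive_iff]
    refine ⟨fun x y => ?_, fun x => ?_⟩
    · change inner ℂ (Ni x) y = inner ℂ x (Ni y)
      rw [← hNNi y, hNiN, ← hNpos.inner_left_eq_inner_right, hNNi]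
    · have := hNpos.inner_nonneg_right (Ni x)
      rwa [hNNi] at this
  have hBpos : (S * Ni * S).IsPositive := by
    have := hNipos.conj_adjoint S
    rw [hS.isSelfAdjoint.adjoint_eq] at this
    exact this
  have key : ∀ x y, y = (S * Ni * S) x ↔ y = (S * S) (x - M y) := by
    intro x y
    simp only [mul_apply_eq_comp]
    constructor
    · intro hy
      have h1 : N (Ni (S x)) = S x := hNNi _
      rw [hN] at h1
      simp only [add_apply, one_apply_eq_self,
        mul_apply_eq_comp, ← hy] at h1
      have h2 : Ni (S x) = S (x - M y) := by rw [map_sub]; exact eq_sub_of_add_eq h1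
      rw [← h2]; exact hy
    · intro hy
      have h1 : N (S (x - M y)) = S x := by
        rw [hN]
        simp only [add_apply, one_apply_eq_self,
          mul_apply_eq_comp, ← hy]
        rw [← map_add, sub_add_cancel]
      rw [← h1, hNiN]; exact hy
  refine ⟨S * Ni * S, hBpos, fun x hx => ?_, key⟩
  refine hSinj x ?_
  have h1 := hSinj _ (show S (Ni (S x)) = 0 from hx)
  rw [← hNNi (S x), h1, map_zero]

end Operators

/-! ### Spectral theory of `(H + G)H` for abstract `H = B⁻¹ - c`. -/

section Pencil

variable {X : Type*} [NormedAddCommGroup X] [InnerProductSpace ℂ X]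

/-- `H f = g` for the operator `H = B⁻¹ - c`. -/
def InvEq (B : X →L[ℂ] X) (c : ℝ) (f g : X) : Prop := f = B (g + (c : ℂ) • f)

lemma InvEq.inner_symm {B : X →L[ℂ] X} {c : ℝ} (hB : B.IsPositive) {f g f' g' : X}
    (h : InvEq B c f g) (h' : InvEq B c f' g') : inner ℂ g f' = inner ℂ f g' := by
  have h1 : inner ℂ (g + (c : ℂ) • f) f' = inner ℂ f (g' + (c : ℂ) • f') := by
    conv_lhs => rw [h']
    conv_rhs => rw [h]
    exact (hB.inner_left_eq_inner_right _ _).symm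
  simp only [inner_add_left, inner_add_right, inner_smul_left, inner_smul_right,
    Complex.conj_ofReal] at h1
  exact add_right_cancel h1

/-- Single-valuedness of `H`. It later identifies the ground state eigenvalue with the eigenvalue
`0` of `Ψ`. -/
lemma InvEq.unique {B : X →L[ℂ] X} {c : ℝ} (hBinj : ∀ x, B x = 0 → x = 0) {f g g' : X}
    (h : InvEq B c f g) (h' : InvEq B c f g') : g = g' := by
  have h1 : B ((g + (c : ℂ) • f) - (g' + (c : ℂ) • f)) = 0 := by
    rw [map_sub, ← h, ← h', sub_self]
  have h2 := hBinj _ h1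
  rw [add_sub_add_right_eq_sub] at h2
  exact sub_eq_zero.1 h2

lemma re_inner_comm (x y : X) : (inner ℂ x y).re = (inner ℂ y x).re :=
  inner_re_symm (𝕜 := ℂ) x y

lemma re_inner_self (x : X) : (inner ℂ x x).re = ‖x‖ ^ 2 := inner_self_eq_norm_sq (𝕜 := ℂ) x

/-- The operator `1 - cB` is `HB`: it sends `(H + c)η` to `Hη`. -/
lemma InvEq.eq_one_sub {B : X →L[ℂ] X} {c : ℝ} {η R : X} (h : InvEq B c η R) :
    R = (1 - (c : ℂ) • B) (R + (c : ℂ) • η) := by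
  have h1 : B (R + (c : ℂ) • η) = η := h.symm
  simp only [sub_apply, smul_apply, one_apply_eq_self]
  rw [h1, add_sub_cancel_right]

variable [CompleteSpace X]

/-- If `H = B⁻¹ - c` has essential spectrum above `0` and no negative eigenvalue, then `c B ≤ 1`. -/
lemma one_sub_isPositive {B B₀ : X →L[ℂ] X} {c m : ℝ} (hB : B.IsPositive) (hc : 0 < c)
    (hm : m ≤ 1 / c) (hB₀ : ∀ x, (inner ℂ (B₀ x) x).re ≤ m * ‖x‖ ^ 2)
    (hC : IsCompactOperator (B - B₀))
    (heig : ∀ (e : ℝ) (f : X), f ≠ 0 → InvEq B c f ((e : ℂ) • f) → 0 ≤ e) :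
    (1 - (c : ℂ) • B).IsPositive := by
  have hle : ∀ x, c * (inner ℂ (B x) x).re ≤ ‖x‖ ^ 2 := by
    by_contra! hcon
    obtain ⟨x₀, hx₀⟩ := hcon
    obtain ⟨M, hM, f, hf, hBf⟩ := exists_eigenvalue_gt hB.isSelfAdjoint hm hB₀ hC
      (x₀ := x₀) (by rw [div_mul_eq_mul_div, one_mul, div_lt_iff₀ hc, mul_comm]; exact hx₀)
    have hM0 : 0 < M := lt_trans (by positivity) hM
    -- An eigenvalue `M > 1/c` of `B = (H + c)⁻¹` corresponds to the eigenvalue `1/M - c < 0` of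
    -- `H`.
    have := heig (1 / M - c) f hf (by
      have h1 : ((1 / M - c : ℝ) : ℂ) • f + (c : ℂ) • f = ((1 / M : ℝ) : ℂ) • f := by
        rw [← add_smul]; push_cast; congr 1; ring
      rw [InvEq, h1, map_smul, hBf, smul_smul, ← Complex.ofReal_mul, one_div,
        inv_mul_cancel₀ hM0.ne', Complex.ofReal_one, one_smul])
    have h2 : 1 / M < c := by
      rw [gt_iff_lt, div_lt_iff₀ hc] at hM
      rw [div_lt_iff₀ hM0]; linarith
    linarith
  rw [ContinuousLinearMap.isPositive_def']
  refine ⟨?_, fun x => ?_⟩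
  · exact (IsSelfAdjoint.one _).sub
      (IsSelfAdjoint.smul (by simp [IsSelfAdjoint]) hB.isSelfAdjoint)
  · rw [ContinuousLinearMap.reApplyInnerSelf_apply]
    change 0 ≤ (inner ℂ _ x).re
    simp only [sub_apply, smul_apply, one_apply_eq_self, inner_sub_left, inner_smul_left,
      Complex.conj_ofReal, Complex.sub_re, Complex.re_ofReal_mul, re_inner_self]
    linarith [hle x]

lemma mul_one_sub_isPositive {B : X →L[ℂ] X} {c : ℝ} (hB : B.IsPositive)
    (hD : (1 - (c : ℂ) • B).IsPositive) : (B * (1 - (c : ℂ) • B)).IsPositive := by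
  rw [← ContinuousLinearMap.nonneg_iff_isPositive] at hB hD ⊢
  refine Commute.mul_nonneg hB hD ?_
  exact (Commute.one_right B).sub_right ((Commute.refl B).smul_right _)

/-- `⟨η, Hη⟩` is the form of `B(1 - cB)`, a product of commuting positive operators, at the vector
`(H + c)η`. -/
lemma InvEq.re_inner_nonneg {B : X →L[ℂ] X} {c : ℝ} (hB : B.IsPositive)
    (hD : (1 - (c : ℂ) • B).IsPositive) {η R : X} (h : InvEq B c η R) :
    0 ≤ (inner ℂ η R).re := by
  have h2 := (mul_one_sub_isPositive hB hD).re_inner_nonneg_right (R + (c : ℂ) • η)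
  change 0 ≤ (inner ℂ _ _).re at h2
  rw [mul_apply_eq_comp, ← h.eq_one_sub, ← hB.inner_left_eq_inner_right, ← h] at h2
  exact h2

/-- `B(1 - cB)` maps `(H + c)η` to `BR`, so `isPositive_sq_le` bounds `‖BR‖²` by a multiple of `⟨η,
R⟩`. -/
lemma InvEq.eq_zero_of_re_inner {B : X →L[ℂ] X} {c : ℝ} (hB : B.IsPositive)
    (hBinj : ∀ x, B x = 0 → x = 0)
    (hD : (1 - (c : ℂ) • B).IsPositive) {η R : X} (h : InvEq B c η R)
    (h0 : (inner ℂ η R).re = 0) : R = 0 := by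
  have h2 := isPositive_sq_le (mul_one_sub_isPositive hB hD) (R + (c : ℂ) • η)
  rw [mul_apply_eq_comp, ← h.eq_one_sub, hB.inner_left_eq_inner_right, ← h, re_inner_comm, h0,
    mul_zero] at h2
  refine hBinj R ?_
  have h3 : ‖B R‖ ^ 2 = 0 := le_antisymm h2 (by positivity)
  exact norm_eq_zero.1 (pow_eq_zero_iff (two_ne_zero) |>.1 h3)

/-- The Birman–Schwinger alternative: the form `⟨R, (H + G) R⟩ + κ ⟨η, R⟩`, `R = H η`, being
nonnegative, either `-κ` is an eigenvalue of `(H + G) H` or `κ` can be decreased. -/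
lemma exists_eigenvector_or_decrease {B G : X →L[ℂ] X} {c κ : ℝ} (hB : B.IsPositive)
    (hBinj : ∀ x, B x = 0 → x = 0) (hD : (1 - (c : ℂ) • B).IsPositive)
    (hG : IsSelfAdjoint G) (hGc : IsCompactOperator G) (hκ : 0 < κ)
    (hform : ∀ η R a, InvEq B c η R → InvEq B c R a →
      0 ≤ (inner ℂ R a).re + (inner ℂ R (G R)).re + κ * (inner ℂ η R).re) :
    (∃ η R a, η ≠ 0 ∧ InvEq B c η R ∧ InvEq B c R a ∧ ((-κ : ℝ) : ℂ) • η = a + G R) ∨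
    ∃ κ' ≥ 0, κ' < κ ∧ ∀ η R a, InvEq B c η R → InvEq B c R a →
      0 ≤ (inner ℂ R a).re + (inner ℂ R (G R)).re + κ' * (inner ℂ η R).re := by
  set D : X →L[ℂ] X := 1 - (c : ℂ) • B with hDdef
  have hBD : Commute B D := (Commute.one_right B).sub_right ((Commute.refl B).smul_right _)
  have hDB : ∀ x, D (B x) = B (D x) := fun x =>
    congrArg (fun T : X →L[ℂ] X => T x) hBD.eq.symm
  have hDx : ∀ x, D x = x - (c : ℂ) • B x := fun x => by
    simp [hDdef]
  -- the parametrisation of the domain of `H²`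
  have hpar1 : ∀ y, InvEq B c (B (B y)) (B (D y)) := fun y => by
    rw [InvEq, hDx, map_sub, map_smul, sub_add_cancel]
  have hpar2 : ∀ y, InvEq B c (B (D y)) (D (D y)) := fun y => by
    rw [InvEq]
    congr 1
    rw [hDx (D y), sub_add_cancel]
  have hpar : ∀ η R a, InvEq B c η R → InvEq B c R a → ∃ y, η = B (B y) ∧ R = B (D y) ∧
      a = D (D y) := by
    intro η R a h1 h2
    have hx : R + (c : ℂ) • η = B ((a + (c : ℂ) • R) + (c : ℂ) • (R + (c : ℂ) • η)) := by
      rw [map_add, map_smul, ← h1, ← h2]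
    set x := R + (c : ℂ) • η with hxdef
    -- This witness is `y = (H + c)²η`, since `x = (H + c)η` and `Hx = a + cR`.
    refine ⟨(a + (c : ℂ) • R) + (c : ℂ) • x, ?_, ?_, ?_⟩
    · rw [← hx]; exact h1
    · rw [← hDB, ← hx]; exact h1.eq_one_sub
    · have e1 : D ((a + (c : ℂ) • R) + (c : ℂ) • x) = a + (c : ℂ) • R := by
        rw [hDx, ← hx, add_sub_cancel_right]
      rw [e1]; exact h2.eq_one_sub
  -- the denominator `D² + κ B²`
  set N : X →L[ℂ] X := D * D + (κ : ℂ) • (B * B) with hNdef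
  have hNx : ∀ x, N x = D (D x) + (κ : ℂ) • B (B x) := fun x => by simp [hNdef]
  have hNform : ∀ x, (inner ℂ (N x) x) = ((‖D x‖ ^ 2 + κ * ‖B x‖ ^ 2 : ℝ) : ℂ) := fun x => by
    rw [hNx, inner_add_left, inner_smul_left, hD.inner_left_eq_inner_right,
      hB.inner_left_eq_inner_right, inner_self_eq_norm_sq_to_K, inner_self_eq_norm_sq_to_K,
      Complex.conj_ofReal]
    push_cast; rfl
  have hNsa : IsSelfAdjoint N := by
    have h1 : IsSelfAdjoint (D * D) := (IsSelfAdjoint.commute_iff hD.isSelfAdjoint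
      hD.isSelfAdjoint).1 (Commute.refl D)
    have h2 : IsSelfAdjoint (B * B) := (IsSelfAdjoint.commute_iff hB.isSelfAdjoint
      hB.isSelfAdjoint).1 (Commute.refl B)
    exact h1.add (IsSelfAdjoint.smul (by simp [IsSelfAdjoint]) h2)
  -- From `x = Dx + cBx` follows `‖x‖² ≤ 2‖Dx‖² + 2c²‖Bx‖²`; the factor `2 + 2c²/κ` dominates both
  -- coefficients relative to the form `‖Dx‖² + κ‖Bx‖²`.
  set δ : ℝ := 1 / (2 + 2 * c ^ 2 / κ) with hδ
  have hδ0 : 0 < δ := by positivity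
  have hNcoer : ∀ x, δ * ‖x‖ ^ 2 ≤ (inner ℂ (N x) x).re := fun x => by
    rw [hNform, Complex.ofReal_re, hδ, div_mul_eq_mul_div, one_mul, div_le_iff₀ (by positivity)]
    have h1 : ‖x‖ ≤ ‖D x‖ + |c| * ‖B x‖ := by
      calc ‖x‖ = ‖D x + (c : ℂ) • B x‖ := by rw [hDx, sub_add_cancel]
        _ ≤ ‖D x‖ + ‖(c : ℂ) • B x‖ := norm_add_le _ _
        _ = _ := by rw [norm_smul, Complex.norm_real, Real.norm_eq_abs]
    have h2 : ‖x‖ ^ 2 ≤ 2 * ‖D x‖ ^ 2 + 2 * c ^ 2 * ‖B x‖ ^ 2 := by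
      have h3 : ‖x‖ ^ 2 ≤ (‖D x‖ + |c| * ‖B x‖) ^ 2 := by gcongr
      have h4 : |c| ^ 2 = c ^ 2 := sq_abs c
      nlinarith [sq_nonneg (‖D x‖ - |c| * ‖B x‖)]
    refine h2.trans ?_
    have h5 : (‖D x‖ ^ 2 + κ * ‖B x‖ ^ 2) * (2 + 2 * c ^ 2 / κ) =
        2 * ‖D x‖ ^ 2 + 2 * c ^ 2 * ‖B x‖ ^ 2 + (2 * c ^ 2 / κ * ‖D x‖ ^ 2 +
          2 * κ * ‖B x‖ ^ 2) := by
      field_simp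
      ring
    rw [h5]
    have : 0 ≤ 2 * c ^ 2 / κ * ‖D x‖ ^ 2 + 2 * κ * ‖B x‖ ^ 2 := by positivity
    linarith
  obtain ⟨Nu, hNu⟩ := isUnit_of_coercive hδ0 hNcoer
  set Ni : X →L[ℂ] X := ↑Nu⁻¹ with hNi
  have hNNi' : N * Ni = 1 := by rw [← hNu]; exact Nu.mul_inv
  have hNiN' : Ni * N = 1 := by rw [← hNu]; exact Nu.inv_mul
  have hNNi : ∀ x, N (Ni x) = x := fun x => by
    simpa using congrArg (fun T : X →L[ℂ] X => T x) hNNi'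
  have hNiN : ∀ x, Ni (N x) = x := fun x => by
    simpa using congrArg (fun T : X →L[ℂ] X => T x) hNiN'
  have hNsym : ∀ x y, inner ℂ (N x) y = inner ℂ x (N y) := fun x y =>
    hNsa.isSymmetric x y
  have hNipos : Ni.IsPositive := by
    rw [ContinuousLinearMap.isPositive_iff]
    refine ⟨fun x y => ?_, fun x => ?_⟩
    · change inner ℂ (Ni x) y = inner ℂ x (Ni y)
      rw [← hNNi y, hNiN, ← hNsym, hNNi]
    · have h1 : inner ℂ (Ni x) x = inner ℂ (N (Ni x)) (Ni x) := by rw [hNsym, hNNi]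
      rw [h1, hNform]
      rw [Complex.zero_le_real]
      positivity
  have hBN : Commute B N := (hBD.mul_right hBD).add_right
    (((Commute.refl B).mul_right (Commute.refl B)).smul_right _)
  have hDN : Commute D N := ((Commute.refl D).mul_right (Commute.refl D)).add_right
    ((hBD.symm.mul_right hBD.symm).smul_right _)
  have hXN : Commute (B * D) N := hBN.mul_left hDN
  have hXNi : Commute (B * D) Ni := by
    have := hXN
    rw [← hNu] at this
    exact this.units_inv_right
  have hNNiC : Commute N Ni := by rw [Commute, SemiconjBy, hNNi', hNiN']
  -- As `N = (H² + κ)B²`, this operator is `H(H² + κ)⁻¹`. Its square root `S` symmetrises the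
  -- perturbation `G`.
  have hPpos : (B * D * Ni).IsPositive := by
    have hX := mul_one_sub_isPositive hB hD
    rw [← ContinuousLinearMap.nonneg_iff_isPositive] at hX hNipos ⊢
    exact Commute.mul_nonneg hX hNipos hXNi
  obtain ⟨S, hS, hSS, hScomm⟩ := exists_positive_sqrt hPpos
  have hSSx : ∀ x, S (S x) = B (D (Ni x)) := fun x =>
    congrArg (fun T : X →L[ℂ] X => T x) hSS
  have hSSN : ∀ y, S (S (N y)) = B (D y) := fun y => by rw [hSSx, hNiN]
  -- For `z = SNy` one has `Sz = R`, and `‖z‖²` is the unperturbed form `⟨R, HR⟩ + κ⟨η, R⟩`; the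
  -- full form is therefore that of `1 + SGS` at `z`.
  have hnorm : ∀ y, ‖S (N y)‖ ^ 2 =
      (inner ℂ (B (D y)) (D (D y))).re + κ * (inner ℂ (B (B y)) (B (D y))).re := fun y => by
    rw [← re_inner_self, hS.inner_left_eq_inner_right, ← hS.inner_left_eq_inner_right,
      ← hS.inner_left_eq_inner_right, hSSN, hNx, inner_add_right, inner_smul_right, Complex.add_re,
      Complex.re_ofReal_mul, re_inner_comm (B (B y))]
  set P : X →L[ℂ] X := 1 + S * G * S with hPdef
  have hPx : ∀ x, (inner ℂ (P x) x).re = ‖x‖ ^ 2 + (inner ℂ (S x) (G (S x))).re := fun x => by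
    simp only [hPdef, add_apply, one_apply_eq_self, mul_apply_eq_comp, inner_add_left,
      Complex.add_re, re_inner_self]
    rw [hS.inner_left_eq_inner_right, re_inner_comm (S x)]
  have hrange : ∀ y, 0 ≤ (inner ℂ (P (S (N y))) (S (N y))).re := fun y => by
    rw [hPx, hnorm, hSSN]
    have := hform _ _ _ (hpar1 y) (hpar2 y)
    linarith
  have hPpos : P.IsPositive := by
    rw [ContinuousLinearMap.isPositive_def']
    refine ⟨?_, fun x => ?_⟩
    · refine (IsSelfAdjoint.one _).add ?_
      have := hG.conjugate S
      rwa [hS.isSelfAdjoint.star_eq] at this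
    · rw [ContinuousLinearMap.reApplyInnerSelf_apply]
      change 0 ≤ (inner ℂ _ x).re
      -- Nonnegativity passes from the range of `SN` to its closure. On the orthogonal complement
      -- `S` vanishes, because `N` is invertible, and there `P` is the identity.
      set U : Submodule ℂ X := (S * N).range.topologicalClosure with hU
      have hUx : ∀ z ∈ U, 0 ≤ (inner ℂ (P z) z).re := by
        intro z hz
        have hcl : IsClosed {z : X | 0 ≤ (inner ℂ (P z) z).re} := by
          refine isClosed_le continuous_const ?_
          exact Complex.continuous_re.comp (P.continuous.inner continuous_id)
        refine (closure_minimal ?_ hcl) hz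
        rintro _ ⟨y, rfl⟩
        exact hrange y
      have : CompleteSpace U := (Submodule.isClosed_topologicalClosure _).completeSpace_coe
      obtain ⟨u, hu, v, hv, rfl⟩ := U.exists_add_mem_mem_orthogonal x
      have hSv : S v = 0 := by
        have h1 : ∀ y, inner ℂ ((S * N) y) v = 0 := fun y =>
          hv _ (Submodule.le_topologicalClosure _ ⟨y, rfl⟩)
        have h2 : N (S v) = 0 := by
          refine ext_inner_left ℂ fun y => ?_
          rw [inner_zero_right, ← hNsym, ← hS.inner_left_eq_inner_right]
          exact h1 y
        rw [← hNiN (S v), h2, map_zero]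
      have huv : inner ℂ u v = 0 := hv u hu
      have hn : ‖u + v‖ ^ 2 = ‖u‖ ^ 2 + ‖v‖ ^ 2 := by
        have := norm_add_sq_eq_norm_sq_add_norm_sq_of_inner_eq_zero u v huv
        nlinarith
      have h3 := hUx u hu
      rw [hPx] at h3
      rw [hPx, hn, map_add, hSv, add_zero]
      have : 0 ≤ ‖v‖ ^ 2 := by positivity
      linarith
  by_cases hinj : ∀ x, P x = 0 → x = 0
  · right
    obtain ⟨ε, hε, hcoer⟩ := coercive_of_compact_perturbation (Q := 1) hPpos one_pos
      (fun x => by rw [one_apply_eq_self, re_inner_self, one_mul]) (by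
        have e : (1 : X →L[ℂ] X) - P = -(S * G * S) := by rw [hPdef]; abel
        rw [e]
        exact ((hGc.comp_clm S).clm_comp S).neg) hinj
    -- Coercivity bounds the full form below by `t(⟨R, HR⟩ + κ⟨η, R⟩)`. Since `⟨R, HR⟩ ≥ 0`, the
    -- term `tκ⟨η, R⟩` may be subtracted, leaving `κ' = κ(1 - t)`; `t ≤ 1` keeps it nonnegative.
    set t := min ε 1 with ht
    have ht0 : 0 < t := lt_min hε one_pos
    have ht1 : t ≤ 1 := min_le_right _ _
    refine ⟨κ * (1 - t), by apply mul_nonneg hκ.le; linarith, by nlinarith, ?_⟩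
    intro η R a h1 h2
    obtain ⟨y, rfl, rfl, rfl⟩ := hpar η R a h1 h2
    have h3 := hcoer (S (N y))
    rw [hPx, hSSN] at h3
    have h4 : t * ‖S (N y)‖ ^ 2 ≤ ε * ‖S (N y)‖ ^ 2 := by
      gcongr; exact min_le_left _ _
    have h5 := hnorm y
    have h6 : 0 ≤ (inner ℂ (B (D y)) (D (D y))).re := h2.re_inner_nonneg hB hD
    have h7 : 0 ≤ t * (inner ℂ (B (D y)) (D (D y))).re := by positivity
    rw [h5] at h3 h4
    nlinarith
  · left
    push Not at hinj
    obtain ⟨x, hx, hx0⟩ := hinj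
    have hx' : x = -S (G (S x)) := by
      simp only [hPdef, add_apply, one_apply_eq_self, mul_apply_eq_comp] at hx
      exact eq_neg_of_add_eq_zero_left hx
    -- The kernel equation `x = -SGSx` gives `Sx = BDy = R` and `Ny = -GR`. The latter is the
    -- eigenvalue equation `D²y + κB²y = -GR`.
    set y := -Ni (G (S x)) with hy
    have hR : S x = B (D y) := by
      conv_lhs => rw [hx']
      rw [map_neg, hSSx, hy, map_neg, map_neg]
    refine ⟨B (B y), B (D y), D (D y), fun h0 => ?_, hpar1 y, hpar2 y, ?_⟩
    · have hy0 : y = 0 := hBinj _ (hBinj _ h0)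
      rw [hy0, map_zero, map_zero] at hR
      rw [hR, map_zero, map_zero, neg_zero] at hx'
      exact hx0 hx'
    · have h1 : N y = -G (S x) := by rw [hy, map_neg, hNNi]
      rw [hNx] at h1
      rw [← hR, eq_neg_of_add_eq_zero_left (a := G (S x)) (b := D (D y) + (κ : ℂ) • B (B y))
        (by rw [h1, add_neg_cancel])]
      push_cast
      module

/-- The spectral theory of `(H + G) H` for a nonnegative `H = B⁻¹ - c` with a zero mode and a
compact self-adjoint perturbation `G`. -/
theorem pencil_lowest_eigenvalue {B B₀ G : X →L[ℂ] X} {c m : ℝ} (hB : B.IsPositive)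
    (hBinj : ∀ x, B x = 0 → x = 0) (hc : 0 < c) (hm : m ≤ 1 / c)
    (hB₀ : ∀ x, (inner ℂ (B₀ x) x).re ≤ m * ‖x‖ ^ 2) (hC : IsCompactOperator (B - B₀))
    (hG : IsSelfAdjoint G) (hGc : IsCompactOperator G)
    (heig : ∀ (e : ℝ) (f : X), f ≠ 0 → InvEq B c f ((e : ℂ) • f) → 0 ≤ e)
    {ψ : X} (hψ : ψ ≠ 0) (hψ0 : InvEq B c ψ 0) :
    (∀ (z : ℂ) (η R a : X), η ≠ 0 → InvEq B c η R → InvEq B c R a → z • η = a + G R →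
      z.im = 0) ∧
    ∃ w : ℝ, (∃ η R a : X, η ≠ 0 ∧ InvEq B c η R ∧ InvEq B c R a ∧ (w : ℂ) • η = a + G R) ∧
      (∀ (z : ℝ) (η R a : X), η ≠ 0 → InvEq B c η R → InvEq B c R a →
        (z : ℂ) • η = a + G R → w ≤ z) ∧
      (∀ η R a : X, InvEq B c η R → InvEq B c R a → 0 < (inner ℂ η R).re →
        w ≤ (inner ℂ R (a + G R)).re / (inner ℂ η R).re) := by
  have hD := one_sub_isPositive hB hc hm hB₀ hC heig
  have hGim : ∀ R, (inner ℂ R (G R)).im = 0 := fun R => by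
    have h1 : inner ℂ (G R) R = inner ℂ R (G R) := hG.isSymmetric R R
    have h2 := inner_conj_symm (𝕜 := ℂ) R (G R)
    rw [h1] at h2
    exact Complex.conj_eq_iff_im.1 h2
  have hHim : ∀ f g, InvEq B c f g → (inner ℂ f g).im = 0 := fun f g h => by
    have h1 : inner ℂ g f = inner ℂ f g := h.inner_symm hB h
    have h2 := inner_conj_symm (𝕜 := ℂ) f g
    rw [h1] at h2
    exact Complex.conj_eq_iff_im.1 h2
  have hzero : ∀ a, InvEq B c 0 a → a = 0 := fun a h => by
    refine hBinj a ?_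
    rw [InvEq, smul_zero, add_zero] at h
    exact h.symm
  have hdeg : ∀ (z : ℂ) (η R a : X), η ≠ 0 → InvEq B c η R → InvEq B c R a → z • η = a + G R →
      (inner ℂ η R).re = 0 → z = 0 := by
    intro z η R a hη h1 h2 h3 h4
    have hR := h1.eq_zero_of_re_inner hB hBinj hD h4
    subst hR
    rw [hzero a h2, map_zero, add_zero] at h3
    exact (smul_eq_zero.1 h3).resolve_right hη
  refine ⟨fun z η R a hη h1 h2 h3 => ?_, ?_⟩
  · by_cases h4 : (inner ℂ η R).re = 0
    · rw [hdeg z η R a hη h1 h2 h3 h4, Complex.zero_im]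
    · have h5 := congrArg (fun v => (inner ℂ R v).im) h3
      simp only [inner_smul_right, inner_add_right, Complex.add_im, hGim, hHim R a h2,
        Complex.mul_im] at h5
      have h6 : (inner ℂ R η).im = 0 := by
        rw [← inner_conj_symm, Complex.conj_im, hHim η R h1, neg_zero]
      rw [h6, re_inner_comm R η] at h5
      simpa [h4] using h5
  -- The lowest eigenvalue will be `-inf K`. The constraint `κ ≥ 0` reflects the zero mode, which
  -- always contributes the eigenvalue `0`.
  · set K : Set ℝ := {κ | 0 ≤ κ ∧ ∀ η R a, InvEq B c η R → InvEq B c R a →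
      0 ≤ (inner ℂ R a).re + (inner ℂ R (G R)).re + κ * (inner ℂ η R).re} with hK
    have hKne : K.Nonempty := by
      -- The form of `H` at `R - sη` is `⟨R, HR⟩ - 2s‖R‖² + s²⟨η, R⟩ ≥ 0`. With `2s = ‖G‖` the
      -- middle term absorbs the form of `G`.
      refine ⟨(‖G‖ / 2) ^ 2, by positivity, fun η R a h1 h2 => ?_⟩
      set s : ℝ := ‖G‖ / 2 with hs
      have h3 : InvEq B c (R - (s : ℂ) • η) (a - (s : ℂ) • R) := by
        have e : a - (s : ℂ) • R + (c : ℂ) • (R - (s : ℂ) • η) =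
            (a + (c : ℂ) • R) - (s : ℂ) • (R + (c : ℂ) • η) := by module
        rw [InvEq, e, map_sub, map_smul, ← h1, ← h2]
      have h4 := h3.re_inner_nonneg hB hD
      have h5 : -(‖G‖ * ‖R‖ ^ 2) ≤ (inner ℂ R (G R)).re := by
        have : |(inner ℂ R (G R)).re| ≤ ‖R‖ * (‖G‖ * ‖R‖) :=
          (Complex.abs_re_le_norm _).trans ((norm_inner_le_norm _ _).trans
            (by gcongr; exact G.le_opNorm R))
        have := (abs_le.1 this).1
        nlinarith
      have h6 : inner ℂ R R = inner ℂ η a := h1.inner_symm hB h2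
      simp only [inner_sub_left, inner_sub_right, inner_smul_left, inner_smul_right,
        Complex.conj_ofReal, Complex.sub_re, Complex.re_ofReal_mul, ← h6, re_inner_self] at h4
      nlinarith
    have hKbdd : BddBelow K := ⟨0, fun κ hκ => hκ.1⟩
    set κ₀ := sInf K with hκ₀
    have hκ₀0 : 0 ≤ κ₀ := le_csInf hKne fun κ hκ => hκ.1
    have hκ₀K : ∀ η R a, InvEq B c η R → InvEq B c R a →
        0 ≤ (inner ℂ R a).re + (inner ℂ R (G R)).re + κ₀ * (inner ℂ η R).re := by
      have hcl : IsClosed K := by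
        have : K = Set.Ici 0 ∩ ⋂ (η : X) (R : X) (a : X) (_ : InvEq B c η R)
            (_ : InvEq B c R a), {κ : ℝ | 0 ≤ (inner ℂ R a).re + (inner ℂ R (G R)).re +
              κ * (inner ℂ η R).re} := by
          ext κ; simp [hK]
        rw [this]
        refine isClosed_Ici.inter ?_
        refine isClosed_iInter fun η => isClosed_iInter fun R => isClosed_iInter fun a =>
          isClosed_iInter fun _ => isClosed_iInter fun _ => ?_
        exact isClosed_le continuous_const (by fun_prop)
      exact (hcl.csInf_mem hKne hKbdd).2
    refine ⟨-κ₀, ?_, ?_, ?_⟩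
    · rcases hκ₀0.eq_or_lt with h0 | h0
      · refine ⟨ψ, 0, 0, hψ, hψ0, by simp [InvEq], by simp [← h0]⟩
      · rcases exists_eigenvector_or_decrease hB hBinj hD hG hGc h0 hκ₀K with h | ⟨κ', h1, h2, h3⟩
        · exact h
        · exact absurd (csInf_le hKbdd ⟨h1, h3⟩) (not_le.2 h2)
    · intro z η R a hη h1 h2 h3
      rcases (h1.re_inner_nonneg hB hD).eq_or_lt with h4 | h4
      · have := hdeg z η R a hη h1 h2 h3 h4.symm
        rw [Complex.ofReal_eq_zero] at this
        linarith
      · have h5 := congrArg (fun v => (inner ℂ R v).re) h3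
        simp only [inner_smul_right, inner_add_right, Complex.add_re,
          Complex.re_ofReal_mul] at h5
        rw [re_inner_comm R η] at h5
        have h6 := hκ₀K η R a h1 h2
        rw [← h5, ← add_mul] at h6
        have := nonneg_of_mul_nonneg_left h6 h4
        linarith
    · intro η R a h1 h2 h3
      rw [le_div_iff₀ h3, inner_add_right, Complex.add_re]
      linarith [hκ₀K η R a h1 h2]

end Pencil

/-! ### Resolvents of `A⁻¹ - 1 + W` and stability of the essential spectrum. -/

section Resolvents

variable {X : Type*} [NormedAddCommGroup X] [InnerProductSpace ℂ X]

lemma re_inner_real_smul_one_add (r : ℝ) (W : X →L[ℂ] X) (x : X) :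
    (inner ℂ (((r : ℂ) • (1 : X →L[ℂ] X) + W) x) x).re = r * ‖x‖ ^ 2 + (inner ℂ (W x) x).re := by
  simp only [add_apply, smul_apply, one_apply_eq_self, inner_add_left, inner_smul_left,
    Complex.conj_ofReal, Complex.add_re, Complex.re_ofReal_mul, re_inner_self]

variable [CompleteSpace X]

lemma isSelfAdjoint_real_smul_one (r : ℝ) : IsSelfAdjoint ((r : ℂ) • (1 : X →L[ℂ] X)) :=
  IsSelfAdjoint.smul (by simp [IsSelfAdjoint]) (IsSelfAdjoint.one _)

lemma isPositive_real_smul_one_add {W : X →L[ℂ] X} (hW : IsSelfAdjoint W) {r : ℝ} (hr : ‖W‖ ≤ r) :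
    ((r : ℂ) • (1 : X →L[ℂ] X) + W).IsPositive := by
  rw [ContinuousLinearMap.isPositive_def']
  refine ⟨(isSelfAdjoint_real_smul_one r).add hW, fun x => ?_⟩
  rw [ContinuousLinearMap.reApplyInnerSelf_apply]
  change 0 ≤ (inner ℂ _ x).re
  rw [re_inner_real_smul_one_add]
  have h1 : |(inner ℂ (W x) x).re| ≤ (‖W‖ * ‖x‖) * ‖x‖ :=
    (Complex.abs_re_le_norm _).trans ((norm_inner_le_norm _ _).trans
      (by gcongr; exact W.le_opNorm x))
  have h2 := (abs_le.1 h1).1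
  have h3 : ‖W‖ * ‖x‖ ^ 2 ≤ r * ‖x‖ ^ 2 := by gcongr
  nlinarith

/-- The operator `A⁻¹ - 1 + W` has a resolvent. -/
lemma exists_resolvent {A W : X →L[ℂ] X} (hA : A.IsPositive) (hAinj : ∀ x, A x = 0 → x = 0)
    (hW : IsSelfAdjoint W) {c : ℝ} (hc : 1 + ‖W‖ ≤ c) :
    ∃ B : X →L[ℂ] X, B.IsPositive ∧ (∀ x, B x = 0 → x = 0) ∧
      (∀ f g, InvEq B c f g ↔ f = A (g + f - W f)) ∧
      B = A * (1 - (((c - 1 : ℝ) : ℂ) • 1 + W) * B) := by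
  obtain ⟨B, hB, hBinj, hBA⟩ := exists_formSum_resolvent hA hAinj
    (isPositive_real_smul_one_add hW (r := c - 1) (by linarith))
  refine ⟨B, hB, hBinj, fun f g => ?_, ?_⟩
  · rw [InvEq, hBA]
    have : g + (c : ℂ) • f - (((c - 1 : ℝ) : ℂ) • (1 : X →L[ℂ] X) + W) f = g + f - W f := by
      simp only [add_apply, smul_apply, one_apply_eq_self]
      push_cast
      module
    rw [this]
  · ext x
    exact (hBA x (B x)).1 rfl

/-- The resolvent of `A⁻¹ - 1 + V - E`, for `V A` compact, as a compact perturbation of the one of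
`A⁻¹ - 1 - E`. -/
lemma exists_resolvent_of_relativelyCompact {A V : X →L[ℂ] X} (hA : A.IsPositive)
    (hAinj : ∀ x, A x = 0 → x = 0) (hA1 : (1 - A).IsPositive) (hV : IsSelfAdjoint V)
    (hVA : IsCompactOperator (V * A)) (E : ℝ) :
    ∃ c > 0, 0 < c - E ∧ ∃ B B₀ : X →L[ℂ] X, B.IsPositive ∧ (∀ x, B x = 0 → x = 0) ∧
      (∀ f g, InvEq B c f g ↔ f = A (g + f - (V f - (E : ℂ) • f))) ∧
      (∀ x, (inner ℂ (B₀ x) x).re ≤ 1 / (c - E) * ‖x‖ ^ 2) ∧ IsCompactOperator (B - B₀) := by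
  set W : X →L[ℂ] X := V - (E : ℂ) • 1 with hWdef
  have hW : IsSelfAdjoint W := hV.sub (isSelfAdjoint_real_smul_one E)
  have hWx : ∀ f, W f = V f - (E : ℂ) • f := fun f => by simp [hWdef]
  -- Large enough for `c - 1 + W ≥ 0` and for `r = c - 1 - E ≥ 0`, so that both form sums have
  -- positive perturbations.
  set c : ℝ := 2 + ‖W‖ + |E| with hcdef
  have hW0 := norm_nonneg W
  have hE := abs_nonneg E
  have hE' := le_abs_self E
  obtain ⟨B, hB, hBinj, hBiff, hBeq⟩ := exists_resolvent hA hAinj hW (c := c) (by linarith)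
  set r : ℝ := c - 1 - E with hr
  have hr0 : 0 ≤ r := by linarith
  obtain ⟨B₀, hB₀, -, hB₀A⟩ := exists_formSum_resolvent hA hAinj (M := (r : ℂ) • 1 + 0)
    (isPositive_real_smul_one_add (IsSelfAdjoint.zero _) (by simpa using hr0))
  have hB₀A' : ∀ x y, y = B₀ x ↔ y = A (x - (r : ℂ) • y) := fun x y => by
    rw [hB₀A]; simp
  refine ⟨c, by linarith, by linarith, B, B₀, hB, hBinj, fun f g => ?_, fun x => ?_, ?_⟩
  · rw [hBiff, hWx]
  · rw [div_mul_eq_mul_div, one_mul, le_div_iff₀ (by linarith)]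
    set y := B₀ x with hy
    set z := x - (r : ℂ) • y with hz
    have hyz : y = A z := (hB₀A' x y).1 hy
    -- For `B₀ = (A⁻¹ + r)⁻¹` and `x = (1 + rA)z`, the defect `‖x‖² - (1 + r)⟨B₀x, x⟩` has real part
    -- `⟨(1 - A)z, z⟩ + r⟨A(1 - A)z, z⟩`; both summands are nonnegative.
    have hx : x = z + (r : ℂ) • A z := by rw [← hyz, hz, sub_add_cancel]
    have hAA : (A * (1 - A)).IsPositive := by
      have := mul_one_sub_isPositive (c := 1) hA (by simpa using hA1)
      simpa using this
    have h1 := hA1.re_inner_nonneg_left z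
    have h2 := hAA.re_inner_nonneg_left z
    change 0 ≤ (inner ℂ _ z).re at h1 h2
    simp only [mul_apply_eq_comp, sub_apply, one_apply_eq_self, map_sub, inner_sub_left,
      Complex.sub_re, re_inner_self, hA.inner_left_eq_inner_right (A z) z] at h1 h2
    rw [hyz, hx, ← re_inner_self (z + (r : ℂ) • A z)]
    have h3 : c - E = 1 + r := by rw [hr]; ring
    rw [h3]
    simp only [inner_add_left, inner_add_right, inner_smul_left, inner_smul_right,
      Complex.conj_ofReal, Complex.add_re, Complex.re_ofReal_mul, re_inner_self,
      re_inner_comm z (A z)] at h1 h2 ⊢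
    nlinarith [mul_nonneg hr0 h2]
  -- Second resolvent identity `B - B₀ = -B₀VB`. Here `VB = (VA)(A⁻¹B)` is compact because `A⁻¹B = 1
  -- - (c - 1 + W)B` is bounded.
  · have key : B - B₀ = -(B₀ * ((V * A) * (1 - (((c - 1 : ℝ) : ℂ) • 1 + W) * B))) := by
      have h1 : (V * A) * (1 - (((c - 1 : ℝ) : ℂ) • 1 + W) * B) = V * B := by
        rw [mul_assoc, ← hBeq]
      rw [h1]
      ext x
      have h2 : B x = B₀ (x - V (B x)) := by
        rw [hB₀A']
        have := congrArg (fun T : X →L[ℂ] X => T x) hBeq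
        simp only [mul_apply_eq_comp, sub_apply, one_apply_eq_self, add_apply, smul_apply,
          hWx] at this
        conv_lhs => rw [this]
        congr 1
        rw [hr]; push_cast
        module
      simp only [sub_apply, neg_apply, mul_apply_eq_comp]
      conv_lhs => rw [h2]
      rw [map_sub]; abel
    rw [key]
    exact ((hVA.comp_clm _).clm_comp B₀).neg

/-- A trial function of negative energy produces a negative eigenvalue of `A⁻¹ - 1 + V`. -/
lemma exists_negative_eigenvalue {A V : X →L[ℂ] X} (hA : A.IsPositive)
    (hAinj : ∀ x, A x = 0 → x = 0) (hA1 : (1 - A).IsPositive) (hV : IsSelfAdjoint V)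
    (hVA : IsCompactOperator (V * A)) {f₀ g₀ : X} (h₀ : f₀ = A (g₀ + f₀ - V f₀))
    (hneg : (inner ℂ f₀ g₀).re < 0) :
    ∃ e < (0 : ℝ), ∃ f ≠ 0, f = A ((e : ℂ) • f + f - V f) := by
  obtain ⟨c, hc, hc', B, B₀, hB, hBinj, hBiff, hB₀, hC⟩ :=
    exists_resolvent_of_relativelyCompact hA hAinj hA1 hV hVA 0
  simp only [Complex.ofReal_zero, zero_smul, sub_zero] at hBiff hB₀
  by_contra! hcon
  have hD := one_sub_isPositive hB hc le_rfl hB₀ hC fun e f hf h => by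
    by_contra! he
    exact hcon e he f hf ((hBiff _ _).1 h)
  exact absurd (((hBiff _ _).2 h₀).re_inner_nonneg hB hD) (not_le.2 hneg)

end Resolvents

/-! ### Hilbert–Schmidt operators. -/

section Compactness

variable {Y Z : Type*} [NormedAddCommGroup Y] [InnerProductSpace ℂ Y]
  [NormedAddCommGroup Z] [InnerProductSpace ℂ Z]

lemma isCompactOperator_rankOne (z : Z) (y : Y) :
    IsCompactOperator (InnerProductSpace.rankOne ℂ z y) := by
  have h : IsCompactOperator (ContinuousLinearMap.toSpanSingleton ℂ z) :=
    isCompactOperator_of_locallyCompactSpace_rng _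
  exact h.comp_clm (innerSL ℂ y)

lemma isCompactOperator_sum {ι : Type*} (s : Finset ι) {T : ι → Y →L[ℂ] Z}
    (hT : ∀ i ∈ s, IsCompactOperator (T i)) :
    IsCompactOperator (∑ i ∈ s, T i : Y →L[ℂ] Z) :=
  sum_mem (S := compactOperator (RingHom.id ℂ) Y Z) hT

variable [CompleteSpace Z]

/-- A Hilbert–Schmidt operator is compact. -/
lemma isCompactOperator_of_summable_sq {ι : Type*} (b : HilbertBasis ι ℂ Y) {T : Y →L[ℂ] Z}
    (hT : Summable fun i => ‖T (b i)‖ ^ 2) : IsCompactOperator T := by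
  classical
  set F : Finset ι → Y →L[ℂ] Z := fun s => ∑ i ∈ s, InnerProductSpace.rankOne ℂ (T (b i)) (b i)
    with hF
  have hFx : ∀ s x, F s x = T (∑ i ∈ s, inner ℂ (b i) x • b i) := fun s x => by
    simp [hF, sum_apply, map_sum, InnerProductSpace.rankOne_apply]
  have hlim : ∀ x, Tendsto (fun s => F s x) atTop (𝓝 (T x)) := fun x => by
    simp_rw [hFx]
    refine (T.continuous.tendsto _).comp ?_
    have := b.hasSum_repr x
    simp only [b.repr_apply_apply] at this
    exact this
  refine isCompactOperator_of_tendsto (l := atTop) (F := F) ?_ (Eventually.of_forall fun s =>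
    isCompactOperator_sum s fun i _ => isCompactOperator_rankOne _ _)
  rw [Metric.tendsto_atTop]
  intro ε hε
  -- By Cauchy–Schwarz and Bessel, the tail of the Hilbert–Schmidt sum bounds the squared operator
  -- norm of the remainder after truncation.
  obtain ⟨s, hs⟩ := summable_iff_vanishing_norm.1 hT ((ε / 2) ^ 2) (by positivity)
  refine ⟨s, fun t ht => ?_⟩
  rw [dist_eq_norm, ← norm_neg, neg_sub]
  refine lt_of_le_of_lt (ContinuousLinearMap.opNorm_le_bound _ (M := ε / 2) (by positivity)
    fun x => ?_) (by linarith)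
  have h1 : Tendsto (fun u => ‖F u x - F t x‖) atTop (𝓝 ‖(T - F t) x‖) :=
    ((hlim x).sub_const _).norm
  refine le_of_tendsto h1 (eventually_atTop.2 ⟨t, fun u hu => ?_⟩)
  have h2 : F u x - F t x = ∑ i ∈ u \ t, inner ℂ (b i) x • T (b i) := by
    rw [hFx, hFx, ← map_sub, ← Finset.sum_sdiff hu, add_sub_cancel_right, map_sum]
    simp
  have h3 : ∑ i ∈ u \ t, ‖T (b i)‖ ^ 2 < (ε / 2) ^ 2 := by
    have := hs (u \ t) (Finset.disjoint_left.2 fun i hi hi' =>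
      (Finset.mem_sdiff.1 hi).2 (ht hi'))
    exact (le_abs_self _).trans_lt this
  have h4 : ∑ i ∈ u \ t, ‖inner ℂ (b i) x‖ ^ 2 ≤ ‖x‖ ^ 2 := b.orthonormal.sum_inner_products_le x
  rw [h2]
  have h5 : ‖∑ i ∈ u \ t, inner ℂ (b i) x • T (b i)‖ ^ 2 ≤ (ε / 2 * ‖x‖) ^ 2 := by
    calc _ ≤ (∑ i ∈ u \ t, ‖inner ℂ (b i) x‖ * ‖T (b i)‖) ^ 2 := by
          gcongr
          refine (norm_sum_le _ _).trans (Finset.sum_le_sum fun i _ => ?_)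
          rw [norm_smul]
      _ ≤ (∑ i ∈ u \ t, ‖inner ℂ (b i) x‖ ^ 2) * ∑ i ∈ u \ t, ‖T (b i)‖ ^ 2 :=
          Finset.sum_mul_sq_le_sq_mul_sq _ _ _
      _ ≤ ‖x‖ ^ 2 * (ε / 2) ^ 2 := by gcongr
      _ = _ := by ring
  exact le_of_sq_le_sq h5 (by positivity)

end Compactness

/-! ### Operators diagonal in a Hilbert basis. -/

section Diagonal

variable {Y : Type*} [NormedAddCommGroup Y] [InnerProductSpace ℂ Y]

lemma hilbertBasis_ext {ι : Type*} (b : HilbertBasis ι ℂ Y) {x y : Y}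
    (h : ∀ i, inner ℂ (b i) x = inner ℂ (b i) y) : x = y := by
  refine b.repr.injective ?_
  ext i
  rw [b.repr_apply_apply, b.repr_apply_apply, h]

lemma hilbertBasis_hasSum_norm_sq {ι : Type*} (b : HilbertBasis ι ℂ Y) (x : Y) :
    HasSum (fun i => ‖inner ℂ (b i) x‖ ^ 2) (‖x‖ ^ 2) := by
  have h := b.hasSum_inner_mul_inner x x
  have h2 := Complex.hasSum_re h
  rw [re_inner_self] at h2
  refine (congrArg (fun F => HasSum F _) (funext fun i => ?_)).mp h2
  rw [← inner_conj_symm x, Complex.conj_mul']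
  norm_cast

/-- The operator which is diagonal in a Hilbert basis, with given bounded real eigenvalues. -/
lemma exists_diagonal {ι : Type*} (b : HilbertBasis ι ℂ Y) {a : ι → ℝ} {C : ℝ} (hC0 : 0 ≤ C)
    (hC : ∀ i, |a i| ≤ C) :
    ∃ T : Y →L[ℂ] Y, (∀ f i, inner ℂ (b i) (T f) = a i * inner ℂ (b i) f) ∧ ‖T‖ ≤ C := by
  have hmem : ∀ f : Y, Memℓp (fun i => (a i : ℂ) * inner ℂ (b i) f) 2 := fun f => by
    refine memℓp_gen ?_
    have h := (hilbertBasis_hasSum_norm_sq b f).summable.mul_left (C ^ 2)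
    refine Summable.of_nonneg_of_le (fun i => by positivity) (fun i => ?_) h
    simp only [ENNReal.toReal_ofNat, Real.rpow_ofNat, norm_mul, mul_pow, Complex.norm_real,
      Real.norm_eq_abs]
    gcongr
    exact hC i
  have hco : ∀ f i, inner ℂ (b i) (b.repr.symm ⟨_, hmem f⟩) = a i * inner ℂ (b i) f := fun f i => by
    rw [← b.repr_apply_apply, LinearIsometryEquiv.apply_symm_apply]
  let L : Y →ₗ[ℂ] Y :=
    { toFun := fun f => b.repr.symm ⟨_, hmem f⟩
      map_add' := fun f g => hilbertBasis_ext b fun i => by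
        rw [inner_add_right, hco, hco, hco, inner_add_right, mul_add]
      map_smul' := fun c f => hilbertBasis_ext b fun i => by
        rw [RingHom.id_apply, inner_smul_right, hco, hco, inner_smul_right]; ring }
  have hL : ∀ f i, inner ℂ (b i) (L f) = a i * inner ℂ (b i) f := hco
  have hbound : ∀ f, ‖L f‖ ≤ C * ‖f‖ := fun f => by
    refine le_of_sq_le_sq ?_ (by positivity)
    rw [mul_pow]
    refine hasSum_le (fun i => ?_) (hilbertBasis_hasSum_norm_sq b (L f))
      ((hilbertBasis_hasSum_norm_sq b f).mul_left (C ^ 2))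
    rw [hL, norm_mul, mul_pow, Complex.norm_real, Real.norm_eq_abs]
    gcongr
    exact hC i
  exact ⟨L.mkContinuous C hbound, hL, L.mkContinuous_norm_le hC0 hbound⟩

lemma diagonal_inner {ι : Type*} (b : HilbertBasis ι ℂ Y) {a : ι → ℝ} {T : Y →L[ℂ] Y}
    (hT : ∀ f i, inner ℂ (b i) (T f) = a i * inner ℂ (b i) f) (f g : Y) :
    HasSum (fun i => (a i : ℂ) * (inner ℂ f (b i) * inner ℂ (b i) g)) (inner ℂ f (T g)) := by
  have h := b.hasSum_inner_mul_inner f (T g)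
  simp only [hT] at h
  refine (congrArg (fun F => HasSum F _) (funext fun i => ?_)).mp h
  ring

variable [CompleteSpace Y]

lemma diagonal_isSelfAdjoint {ι : Type*} (b : HilbertBasis ι ℂ Y) {a : ι → ℝ} {T : Y →L[ℂ] Y}
    (hT : ∀ f i, inner ℂ (b i) (T f) = a i * inner ℂ (b i) f) : IsSelfAdjoint T := by
  rw [ContinuousLinearMap.isSelfAdjoint_iff_isSymmetric]
  intro f g
  change inner ℂ (T f) g = inner ℂ f (T g)
  refine HasSum.unique ?_ (diagonal_inner b hT f g)
  have h := b.hasSum_inner_mul_inner (T f) g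
  refine (congrArg (fun F => HasSum F _) (funext fun i => ?_)).mp h
  rw [← inner_conj_symm (T f), hT, map_mul, Complex.conj_ofReal, inner_conj_symm]
  ring

lemma diagonal_isPositive {ι : Type*} (b : HilbertBasis ι ℂ Y) {a : ι → ℝ} {T : Y →L[ℂ] Y}
    (hT : ∀ f i, inner ℂ (b i) (T f) = a i * inner ℂ (b i) f) (ha : ∀ i, 0 ≤ a i) :
    T.IsPositive := by
  rw [ContinuousLinearMap.isPositive_def']
  refine ⟨diagonal_isSelfAdjoint b hT, fun f => ?_⟩
  rw [ContinuousLinearMap.reApplyInnerSelf_apply]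
  change 0 ≤ (inner ℂ _ f).re
  rw [re_inner_comm]
  refine (Complex.hasSum_re (diagonal_inner b hT f f)).nonneg fun i => ?_
  rw [← inner_conj_symm f, Complex.conj_mul', Complex.re_ofReal_mul]
  have := ha i
  norm_cast
  positivity

/-- Truncation to finitely many indices converges in operator norm: the remainder is diagonal with
uniformly small entries. -/
lemma diagonal_isCompactOperator {ι : Type*} (b : HilbertBasis ι ℂ Y) {a : ι → ℝ}
    {T : Y →L[ℂ] Y} (hT : ∀ f i, inner ℂ (b i) (T f) = a i * inner ℂ (b i) f)
    (ha : Tendsto a cofinite (𝓝 0)) : IsCompactOperator T := by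
  classical
  set F : Finset ι → Y →L[ℂ] Y := fun s =>
    ∑ i ∈ s, InnerProductSpace.rankOne ℂ ((a i : ℂ) • b i) (b i) with hF
  have hFx : ∀ s f i, inner ℂ (b i) (F s f) = if i ∈ s then a i * inner ℂ (b i) f else 0 := by
    intro s f i
    simp only [hF, sum_apply, InnerProductSpace.rankOne_apply, inner_sum, inner_smul_right,
      orthonormal_iff_ite.1 b.orthonormal]
    simp [mul_comm]
  refine isCompactOperator_of_tendsto (l := atTop) (F := F) ?_ (Eventually.of_forall fun s =>
    isCompactOperator_sum s fun i _ => isCompactOperator_rankOne _ _)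
  rw [Metric.tendsto_atTop]
  intro ε hε
  have hfin : {i | ¬ |a i| < ε / 2}.Finite := by
    have := (Metric.tendsto_nhds.1 ha) (ε / 2) (by positivity)
    simpa [dist_zero_right, Filter.eventually_cofinite] using this
  refine ⟨hfin.toFinset, fun s hs => ?_⟩
  have hsmall : ∀ i ∉ s, |a i| < ε / 2 := fun i hi => by
    by_contra hcon
    exact hi (hs (hfin.mem_toFinset.2 hcon))
  obtain ⟨R, hR, hRn⟩ := exists_diagonal b (a := fun i => if i ∈ s then 0 else a i) (C := ε / 2)
    (by positivity) (fun i => by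
      by_cases hi : i ∈ s
      · simp [hi]; positivity
      · simp [hi, (hsmall i hi).le])
  have : T - F s = R := by
    ext f
    refine hilbertBasis_ext b fun i => ?_
    rw [sub_apply, inner_sub_right, hT, hFx, hR]
    by_cases hi : i ∈ s <;> simp [hi]
  rw [dist_eq_norm, ← norm_neg, neg_sub, this]
  linarith

end Diagonal

/-! ### Multiplication and Carleman operators on `L²`. -/

section LTwo

variable {α : Type*} [MeasurableSpace α] {μ : Measure α}

/-- Multiplication by a bounded function on `L²`. -/
lemma exists_mulL2 {w : α → ℂ} (hw : AEStronglyMeasurable w μ) {C : ℝ} (hC0 : 0 ≤ C)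
    (hC : ∀ x, ‖w x‖ ≤ C) :
    ∃ T : Lp ℂ 2 μ →L[ℂ] Lp ℂ 2 μ, (∀ f, T f =ᵐ[μ] fun x => w x * f x) ∧ ‖T‖ ≤ C := by
  have hmem : ∀ f : Lp ℂ 2 μ, MemLp (fun x => w x * f x) 2 μ := fun f =>
    MemLp.of_le_mul (c := C) (Lp.memLp f) (hw.mul (Lp.aestronglyMeasurable f))
      (Eventually.of_forall fun x => by rw [norm_mul]; gcongr; exact hC x)
  let L : Lp ℂ 2 μ →ₗ[ℂ] Lp ℂ 2 μ :=
    { toFun := fun f => (hmem f).toLp _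
      map_add' := fun f g => by
        refine Lp.ext ?_
        filter_upwards [(hmem (f + g)).coeFn_toLp, Lp.coeFn_add ((hmem f).toLp _)
          ((hmem g).toLp _), (hmem f).coeFn_toLp, (hmem g).coeFn_toLp, Lp.coeFn_add f g]
          with x h1 h2 h3 h4 h5
        rw [h1, h2, Pi.add_apply, h3, h4, h5, Pi.add_apply, mul_add]
      map_smul' := fun c f => by
        refine Lp.ext ?_
        filter_upwards [(hmem (c • f)).coeFn_toLp, Lp.coeFn_smul c ((hmem f).toLp _),
          (hmem f).coeFn_toLp, Lp.coeFn_smul c f] with x h1 h2 h3 h4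
        rw [h1, RingHom.id_apply, h2, Pi.smul_apply, h3, h4, Pi.smul_apply, smul_eq_mul,
          smul_eq_mul]
        ring }
  have hL : ∀ f, L f =ᵐ[μ] fun x => w x * f x := fun f => (hmem f).coeFn_toLp
  have hbound : ∀ f, ‖L f‖ ≤ C * ‖f‖ := fun f => by
    refine Lp.norm_le_mul_norm_of_ae_le_mul ?_
    filter_upwards [hL f] with x hx
    rw [hx, norm_mul]
    gcongr
    exact hC x
  exact ⟨L.mkContinuous C hbound, hL, L.mkContinuous_norm_le hC0 hbound⟩

lemma mulL2_isSelfAdjoint {w : α → ℝ} {T : Lp ℂ 2 μ →L[ℂ] Lp ℂ 2 μ}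
    (hT : ∀ f, T f =ᵐ[μ] fun x => (w x : ℂ) * f x) : IsSelfAdjoint T := by
  rw [ContinuousLinearMap.isSelfAdjoint_iff_isSymmetric]
  intro f g
  change inner ℂ (T f) g = inner ℂ f (T g)
  rw [L2.inner_def, L2.inner_def]
  refine integral_congr_ae ?_
  filter_upwards [hT f, hT g] with x h1 h2
  rw [h1, h2]
  simp only [RCLike.inner_apply, map_mul, Complex.conj_ofReal]
  ring

/-- A Carleman operator with square-integrable kernel is compact. -/
lemma exists_carleman {Y : Type*} [NormedAddCommGroup Y] [InnerProductSpace ℂ Y] [CompleteSpace Y]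
    {κ : α → Y} {N : α → ℝ} (hN : MemLp N 2 μ) (hκN : ∀ x, ‖κ x‖ ≤ N x)
    (hmeas : ∀ f : Y, AEStronglyMeasurable (fun x => inner ℂ (κ x) f) μ) :
    ∃ T : Y →L[ℂ] Lp ℂ 2 μ, (∀ f, T f =ᵐ[μ] fun x => inner ℂ (κ x) f) ∧ IsCompactOperator T := by
  have hptw : ∀ f x, ‖inner ℂ (κ x) f‖ ≤ ‖f‖ * ‖N x‖ := fun f x => by
    calc _ ≤ ‖κ x‖ * ‖f‖ := norm_inner_le_norm _ _
      _ ≤ ‖N x‖ * ‖f‖ := by gcongr; exact (hκN x).trans (le_abs_self _)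
      _ = _ := mul_comm _ _
  have hmem : ∀ f : Y, MemLp (fun x => inner ℂ (κ x) f) 2 μ := fun f =>
    MemLp.of_le_mul (c := ‖f‖) hN (hmeas f) (Eventually.of_forall (hptw f))
  let L : Y →ₗ[ℂ] Lp ℂ 2 μ :=
    { toFun := fun f => (hmem f).toLp _
      map_add' := fun f g => by
        refine Lp.ext ?_
        filter_upwards [(hmem (f + g)).coeFn_toLp, Lp.coeFn_add ((hmem f).toLp _)
          ((hmem g).toLp _), (hmem f).coeFn_toLp, (hmem g).coeFn_toLp] with x h1 h2 h3 h4
        rw [h1, h2, Pi.add_apply, h3, h4, inner_add_right]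
      map_smul' := fun c f => by
        refine Lp.ext ?_
        filter_upwards [(hmem (c • f)).coeFn_toLp, Lp.coeFn_smul c ((hmem f).toLp _),
          (hmem f).coeFn_toLp] with x h1 h2 h3
        rw [h1, RingHom.id_apply, h2, Pi.smul_apply, h3, inner_smul_right, smul_eq_mul] }
  have hL : ∀ f, L f =ᵐ[μ] fun x => inner ℂ (κ x) f := fun f => (hmem f).coeFn_toLp
  set n : Lp ℝ 2 μ := hN.toLp N with hn
  have hbound : ∀ f, ‖L f‖ ≤ ‖n‖ * ‖f‖ := fun f => by
    rw [mul_comm]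
    refine Lp.norm_le_mul_norm_of_ae_le_mul ?_
    filter_upwards [hL f, hN.coeFn_toLp] with x hx hx'
    rw [hx, hn, hx']
    exact hptw f x
  set T := L.mkContinuous ‖n‖ hbound with hT
  have hTf : ∀ f, T f =ᵐ[μ] fun x => inner ℂ (κ x) f := hL
  refine ⟨T, hTf, ?_⟩
  obtain ⟨w, b, -⟩ := exists_hilbertBasis ℂ Y
  refine isCompactOperator_of_summable_sq b ?_
  have hNi : Integrable (fun x => N x ^ 2) μ := hN.integrable_sq
  have hsq : ∀ f, ‖T f‖ ^ 2 = ∫ x, ‖inner ℂ (κ x) f‖ ^ 2 ∂μ := fun f => by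
    rw [← re_inner_self, L2.inner_def, ← RCLike.re_eq_complex_re, ← integral_re]
    · refine integral_congr_ae ?_
      filter_upwards [hTf f] with x hx
      rw [hx]
      exact re_inner_self (X := ℂ) _
    · exact L2.integrable_inner _ _
  have hInt : ∀ f, Integrable (fun x => ‖inner ℂ (κ x) f‖ ^ 2) μ := fun f =>
    (hmem f).norm.integrable_sq
  -- Bessel's inequality at each `x` bounds `∑ |⟨κ x, bᵢ⟩|²` by `N x ^ 2`, so the Hilbert–Schmidt
  -- sum is at most `∫ N²`.
  refine summable_of_sum_le (c := ∫ x, N x ^ 2 ∂μ) (fun i => by positivity) fun s => ?_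
  simp_rw [hsq]
  rw [← integral_finsetSum _ fun i _ => hInt _]
  refine integral_mono (integrable_finsetSum _ fun i _ => hInt _) hNi fun x => ?_
  calc ∑ i ∈ s, ‖inner ℂ (κ x) (b i)‖ ^ 2 = ∑ i ∈ s, ‖inner ℂ (b i) (κ x)‖ ^ 2 := by
        simp_rw [norm_inner_symm]
    _ ≤ ‖κ x‖ ^ 2 := b.orthonormal.sum_inner_products_le _
    _ ≤ N x ^ 2 := by gcongr; exact hκN x

end LTwo

/-! ### The Laplacian and Green's second identity. -/

section Calculus

variable {d : ℕ}

/-- The `i`-th coordinate vector. -/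
abbrev coordVec (i : Fin d) : Space d := EuclideanSpace.single i 1

lemma laplacian_eq_sum_iteratedFDeriv {F : Type*} [NormedAddCommGroup F] [NormedSpace ℝ F]
    (f : Space d → F) (x : Space d) :
    (Δ f) x = ∑ i, iteratedFDeriv ℝ 2 f x ![coordVec i, coordVec i] := by
  rw [InnerProductSpace.laplacian_eq_iteratedFDeriv_orthonormalBasis f
    (EuclideanSpace.basisFun (Fin d) ℝ)]
  simp [coordVec]

lemma laplacian_eq_sum_fderiv {F : Type*} [NormedAddCommGroup F] [NormedSpace ℝ F]
    {f : Space d → F} (hf : ContDiff ℝ 2 f) (x : Space d) :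
    (Δ f) x = ∑ i, fderiv ℝ (fun y => fderiv ℝ f y (coordVec i)) x (coordVec i) := by
  rw [laplacian_eq_sum_iteratedFDeriv]
  refine Finset.sum_congr rfl fun i _ => ?_
  rw [iteratedFDeriv_two_apply]
  have h1 : DifferentiableAt ℝ (fderiv ℝ f) x :=
    (hf.fderiv_right (m := 1) (by norm_num)).differentiable (by norm_num) x
  rw [fderiv_clm_apply h1 (differentiableAt_const _)]
  simp

lemma continuous_laplacian {F : Type*} [NormedAddCommGroup F] [NormedSpace ℝ F]
    {f : Space d → F} (hf : ContDiff ℝ 2 f) : Continuous (Δ f) := by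
  have : Δ f = fun x => ∑ i, iteratedFDeriv ℝ 2 f x ![coordVec i, coordVec i] :=
    funext (laplacian_eq_sum_iteratedFDeriv f)
  rw [this]
  refine continuous_finsetSum _ fun i _ => ?_
  have h1 : Continuous (iteratedFDeriv ℝ 2 f) := hf.continuous_iteratedFDeriv (by norm_num)
  fun_prop

/-- The components of the vector field `u ∇v - v ∇u`. -/
def greenField (u v : Space d → ℂ) (i : Fin d) (x : Space d) : ℂ :=
  u x * fderiv ℝ v x (coordVec i) - v x * fderiv ℝ u x (coordVec i)

lemma contDiff_greenField {u v : Space d → ℂ} (hu : ContDiff ℝ 2 u) (hv : ContDiff ℝ 2 v)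
    (i : Fin d) : ContDiff ℝ 1 (greenField u v i) := by
  have hu' : ContDiff ℝ 1 fun x => fderiv ℝ u x (coordVec i) :=
    (hu.fderiv_right (m := 1) (by norm_num)).clm_apply contDiff_const
  have hv' : ContDiff ℝ 1 fun x => fderiv ℝ v x (coordVec i) :=
    (hv.fderiv_right (m := 1) (by norm_num)).clm_apply contDiff_const
  exact ((hu.of_le (by norm_num)).mul hv').sub ((hv.of_le (by norm_num)).mul hu')

/-- In the divergence of `u∇v - v∇u` the products of gradients cancel. Both versions of Green's
identity follow by integrating this. -/
lemma sum_fderiv_greenField {u v : Space d → ℂ} (hu : ContDiff ℝ 2 u) (hv : ContDiff ℝ 2 v)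
    (x : Space d) :
    ∑ i, fderiv ℝ (greenField u v i) x (coordVec i) = u x * (Δ v) x - v x * (Δ u) x := by
  rw [laplacian_eq_sum_fderiv hu, laplacian_eq_sum_fderiv hv, Finset.mul_sum, Finset.mul_sum,
    ← Finset.sum_sub_distrib]
  refine Finset.sum_congr rfl fun i _ => ?_
  have hu1 : DifferentiableAt ℝ u x := hu.differentiable (by norm_num) x
  have hv1 : DifferentiableAt ℝ v x := hv.differentiable (by norm_num) x
  have hu' : DifferentiableAt ℝ (fun x => fderiv ℝ u x (coordVec i)) x :=
    ((hu.fderiv_right (m := 1) (by norm_num)).clm_apply contDiff_const).differentiable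
      (by norm_num) x
  have hv' : DifferentiableAt ℝ (fun x => fderiv ℝ v x (coordVec i)) x :=
    ((hv.fderiv_right (m := 1) (by norm_num)).clm_apply contDiff_const).differentiable
      (by norm_num) x
  have := ((hu1.hasFDerivAt.mul hv'.hasFDerivAt).sub (hv1.hasFDerivAt.mul hu'.hasFDerivAt)).fderiv
  have e : greenField u v i = (fun y => u y * fderiv ℝ v y (coordVec i)) -
      fun y => v y * fderiv ℝ u y (coordVec i) := rfl
  rw [e]
  erw [this]
  simp only [sub_apply, add_apply, smul_apply, smul_eq_mul]
  ring

/-- Integration by parts against the constant function `1`. -/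
lemma integral_fderiv_eq_zero {g : Space d → ℂ} (hg : ContDiff ℝ 1 g) (hs : HasCompactSupport g)
    (v : Space d) : ∫ x, fderiv ℝ g x v = 0 := by
  have hi : Integrable (fun x => fderiv ℝ g x v) :=
    Continuous.integrable_of_hasCompactSupport
      ((hg.continuous_fderiv (by norm_num)).clm_apply continuous_const)
      (hs.fderiv_apply (𝕜 := ℝ) v)
  have h := integral_mul_fderiv_eq_neg_fderiv_mul_of_integrable (μ := volume)
    (f := fun _ : Space d => (1 : ℂ)) (g := g) (v := v) (by simp) (by simpa using hi)
    (by simpa using hg.continuous.integrable_of_hasCompactSupport hs)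
    (fun x _ => differentiableAt_const _) (fun x _ => hg.differentiable (by norm_num) x)
  simpa using h

/-- Green's second identity on `ℝ^d`. -/
lemma integral_mul_laplacian_wholeSpace {u v : Space d → ℂ} (hu : ContDiff ℝ 2 u)
    (hv : ContDiff ℝ 2 v) (hs : HasCompactSupport v) :
    ∫ x, u x * (Δ v) x = ∫ x, (Δ u) x * v x := by
  have hgs : ∀ i, HasCompactSupport (greenField u v i) := fun i => by
    have h1 : HasCompactSupport fun x => u x * fderiv ℝ v x (coordVec i) :=
      (hs.fderiv_apply (𝕜 := ℝ) (coordVec i)).mul_left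
    exact h1.sub hs.mul_right
  have hInt : ∀ i, Integrable fun x => fderiv ℝ (greenField u v i) x (coordVec i) := fun i =>
    (((contDiff_greenField hu hv i).continuous_fderiv (by norm_num)).clm_apply
      continuous_const).integrable_of_hasCompactSupport ((hgs i).fderiv_apply (𝕜 := ℝ) _)
  have h0 : ∫ x, (u x * (Δ v) x - v x * (Δ u) x) = 0 := by
    simp_rw [← sum_fderiv_greenField hu hv]
    rw [integral_finsetSum _ fun i _ => hInt i]
    exact Finset.sum_eq_zero fun i _ =>
      integral_fderiv_eq_zero (contDiff_greenField hu hv i) (hgs i) _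
  have hΔs : HasCompactSupport (Δ v) := by
    refine hs.mono' ?_
    intro x hx
    by_contra hcon
    refine hx ?_
    rw [notMem_tsupport_iff_eventuallyEq] at hcon
    have := (InnerProductSpace.laplacian_congr_nhds hcon).self_of_nhds
    rw [this]
    have h0 : (0 : Space d → ℂ) = fun _ => 0 := rfl
    rw [h0, InnerProductSpace.laplacian_const]
    rfl
  rw [integral_sub, sub_eq_zero] at h0
  · rw [h0]; simp_rw [mul_comm]
  · exact (hu.continuous.mul (continuous_laplacian hv)).integrable_of_hasCompactSupport
      hΔs.mul_left
  · exact (hv.continuous.mul (continuous_laplacian hu)).integrable_of_hasCompactSupport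
      hs.mul_right

lemma IsPeriodic.fderiv {F : Type*} [NormedAddCommGroup F] [NormedSpace ℝ F] {L : Fin d → ℝ}
    {f : Space d → F} (hf : IsPeriodic L f) : IsPeriodic L (fderiv ℝ f) := by
  intro i x
  rw [← fderiv_comp_add_right]
  congr 1
  funext y
  exact hf i y

lemma cell_ae_eq (L : Fin d → ℝ) :
    cell L =ᵐ[volume] (WithLp.ofLp : Space d → Fin d → ℝ) ⁻¹' Set.Icc 0 L := by
  have h1 : cell L = (WithLp.ofLp : Space d → Fin d → ℝ) ⁻¹'
      (Set.pi Set.univ fun i => Set.Ico (0 : ℝ) (L i)) := by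
    ext x; simp [cell, Set.mem_pi]
  have h2 : (Set.pi Set.univ fun i => Set.Ico ((0 : Fin d → ℝ) i) (L i)) =ᵐ[volume]
      Set.Icc 0 L := Measure.univ_pi_Ico_ae_eq_Icc
  rw [h1]
  exact (PiLp.volume_preserving_ofLp (Fin d)).quasiMeasurePreserving.preimage_ae_eq h2

lemma setIntegral_cell (L : Fin d → ℝ) (g : Space d → ℂ) :
    ∫ x in cell L, g x = ∫ x in Set.Icc 0 L, g (WithLp.toLp 2 x) := by
  rw [setIntegral_congr_set (cell_ae_eq L),
    ← (PiLp.volume_preserving_ofLp (Fin d)).setIntegral_preimage_emb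
    (MeasurableEquiv.toLp 2 (Fin d → ℝ)).symm.measurableEmbedding]

/-- Green's second identity on the periodic box. -/
lemma integral_mul_laplacian_cell {L : Fin d → ℝ} (hL : ∀ i, 0 < L i) {u v : Space d → ℂ}
    (hu : ContDiff ℝ 2 u) (hv : ContDiff ℝ 2 v) (hup : IsPeriodic L u) (hvp : IsPeriodic L v) :
    ∫ x in cell L, (u x * (Δ v) x - v x * (Δ u) x) = 0 := by
  -- In dimension zero there are no faces and the integrand is an empty sum; the divergence theorem
  -- serves positive dimensions.
  cases d with
  | zero =>
    have : ∀ x : Space 0, u x * (Δ v) x - v x * (Δ u) x = 0 := fun x => by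
      rw [← sum_fderiv_greenField hu hv]; simp
    simp [this]
  | succ n =>
    rw [setIntegral_cell]
    let J : (Fin (n + 1) → ℝ) →L[ℝ] Space (n + 1) :=
      (PiLp.continuousLinearEquiv 2 ℝ (fun _ : Fin (n + 1) => ℝ)).symm
    have hJ : ∀ x, J x = WithLp.toLp 2 x := fun x => rfl
    have hg := fun i => contDiff_greenField hu hv i
    have hgp : ∀ i, IsPeriodic L (greenField u v i) := fun i j x => by
      simp only [greenField]
      rw [hup, hvp, hup.fderiv j x, hvp.fderiv j x]
    have hJe : ∀ i : Fin (n + 1), J (Pi.single i 1) = coordVec i := fun i => rfl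
    have key := integral_divergence_of_hasFDerivAt_off_countable' (0 : Fin (n + 1) → ℝ) L
      (fun i => (hL i).le) (fun i x => greenField u v i (J x))
      (fun i x => (fderiv ℝ (greenField u v i) (J x)).comp J) ∅ Set.countable_empty
      (fun i => ((hg i).continuous.comp J.continuous).continuousOn)
      (fun x _ i => ((hg i).differentiable (by norm_num) (J x)).hasFDerivAt.comp x J.hasFDerivAt)
      (by
        refine ContinuousOn.integrableOn_compact isCompact_Icc (Continuous.continuousOn ?_)
        refine continuous_finsetSum _ fun i _ => ?_
        exact (((hg i).continuous_fderiv (by norm_num)).comp J.continuous).clm_apply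
          continuous_const)
    have e1 : (fun x : Fin (n + 1) → ℝ => u (WithLp.toLp 2 x) * (Δ v) (WithLp.toLp 2 x) -
        v (WithLp.toLp 2 x) * (Δ u) (WithLp.toLp 2 x)) = fun x => ∑ i,
        (fderiv ℝ (greenField u v i) (J x)).comp J (Pi.single i 1) := by
      funext x
      rw [← sum_fderiv_greenField hu hv]
      rfl
    rw [e1, key]
    refine Finset.sum_eq_zero fun i _ => ?_
    rw [sub_eq_zero]
    refine setIntegral_congr_fun measurableSet_Icc fun x _ => ?_
    -- Opposite faces differ by a period, so their fluxes cancel.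
    have e2 : J (i.insertNth (L i) x) = J (i.insertNth ((0 : Fin (n + 1) → ℝ) i) x) +
        EuclideanSpace.single i (L i) := by
      ext j
      rcases Fin.eq_self_or_eq_succAbove i j with rfl | ⟨k, rfl⟩
      · simp [hJ]
      · simp [hJ, Fin.succAbove_ne]
    change greenField u v i (J (i.insertNth (L i) x)) = _
    rw [e2, hgp i i]

end Calculus

/-! ### The free resolvent on `ℝ^d` as a Fourier multiplier. -/

section KineticResolvent

open scoped SchwartzMap FourierTransform ComplexOrder

variable {d : ℕ}

/-- The Fourier symbol of `(1 - ∇²/2)⁻¹`. -/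
def kineticSymbol (ξ : Space d) : ℝ := (1 + 2 * Real.pi ^ 2 * ‖ξ‖ ^ 2)⁻¹

lemma kineticSymbol_pos (ξ : Space d) : 0 < kineticSymbol ξ := by
  unfold kineticSymbol; positivity

lemma kineticSymbol_le_one (ξ : Space d) : kineticSymbol ξ ≤ 1 :=
  inv_le_one_of_one_le₀ (by have : 0 ≤ 2 * Real.pi ^ 2 * ‖ξ‖ ^ 2 := by positivity
                            linarith)

lemma continuous_kineticSymbol : Continuous (kineticSymbol (d := d)) := by
  unfold kineticSymbol
  refine Continuous.inv₀ (by fun_prop) fun x => by positivity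

/-- The symbol is `(1 + ‖x‖²)⁻¹` evaluated at `x = √2 π ξ`. -/
lemma hasTemperateGrowth_kineticSymbol :
    (fun ξ : Space d => (kineticSymbol ξ : ℂ)).HasTemperateGrowth := by
  have h1 := Function.hasTemperateGrowth_one_add_norm_sq_rpow (Space d) (-1)
  have h2 : (fun ξ : Space d => (Real.sqrt 2 * Real.pi) • ξ).HasTemperateGrowth :=
    ((Real.sqrt 2 * Real.pi) • ContinuousLinearMap.id ℝ (Space d)).hasTemperateGrowth
  have h3 := Complex.ofRealCLM.hasTemperateGrowth.comp (h1.comp h2)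
  convert h3 using 1
  funext ξ
  simp only [Function.comp_apply, Complex.ofRealCLM_apply, kineticSymbol, norm_smul, mul_pow,
    Real.norm_eq_abs, sq_abs,
    Real.sq_sqrt zero_le_two, Real.rpow_neg_one]

/-- With characters `e^{-2πi⟨ξ, x⟩}` the operator `-∇²/2` has symbol `2π²‖ξ‖²`. -/
lemma fourier_one_sub_laplacian (φ : 𝓢(Space d, ℂ)) (ξ : Space d) :
    𝓕 (φ - (1 / 2 : ℂ) • Δ φ) ξ = ((kineticSymbol ξ)⁻¹ : ℂ) * 𝓕 φ ξ := by
  rw [sub_eq_add_neg, FourierTransform.fourier_add, ← neg_smul, FourierTransform.fourier_smul,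
    SchwartzMap.laplacian_eq_fourierMultiplierCLM, SchwartzMap.fourierMultiplierCLM_apply]
  have h : 𝓕 (-(2 * Real.pi) ^ 2 • 𝓕⁻ (SchwartzMap.smulLeftCLM ℂ
      (fun x : Space d => ‖x‖ ^ 2) (𝓕 φ))) =
      ((-(2 * Real.pi) ^ 2 : ℝ) : ℂ) • SchwartzMap.smulLeftCLM ℂ (fun x : Space d => ‖x‖ ^ 2) (𝓕 φ)
      := by
    rw [← Complex.coe_smul, FourierTransform.fourier_smul, FourierTransform.fourier_fourierInv_eq]
  erw [h]
  simp only [add_apply, smul_apply, smul_eq_mul,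
    SchwartzMap.smulLeftCLM_apply_apply (Function.hasTemperateGrowth_norm_sq (H := Space d)),
    Complex.real_smul, kineticSymbol]
  push_cast
  rw [inv_inv]
  ring

/-- Division by the symbol preserves the Schwartz class. This surjectivity is what yields uniqueness
of weak `L²` solutions. -/
lemma exists_one_sub_laplacian_eq (ψ : 𝓢(Space d, ℂ)) :
    ∃ φ : 𝓢(Space d, ℂ), φ - (1 / 2 : ℂ) • Δ φ = ψ := by
  refine ⟨𝓕⁻ (SchwartzMap.smulLeftCLM ℂ (fun ξ : Space d => (kineticSymbol ξ : ℂ)) (𝓕 ψ)), ?_⟩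
  have hinj : Function.Injective (fun φ : 𝓢(Space d, ℂ) => (𝓕 φ : 𝓢(Space d, ℂ))) := fun a b h => by
    have := congrArg (fun φ : 𝓢(Space d, ℂ) => (𝓕⁻ φ : 𝓢(Space d, ℂ))) h
    simpa using this
  refine hinj ?_
  ext ξ
  simp only
  rw [fourier_one_sub_laplacian, FourierTransform.fourier_fourierInv_eq,
    SchwartzMap.smulLeftCLM_apply_apply hasTemperateGrowth_kineticSymbol, smul_eq_mul,
    inv_mul_cancel_left₀]
  exact_mod_cast (kineticSymbol_pos ξ).ne'

lemma mulL2_isPositive {α : Type*} [MeasurableSpace α] {μ : Measure α} {w : α → ℝ}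
    {T : Lp ℂ 2 μ →L[ℂ] Lp ℂ 2 μ}
    (hT : ∀ f, T f =ᵐ[μ] fun x => (w x : ℂ) * f x) (hw : ∀ x, 0 ≤ w x) : T.IsPositive := by
  rw [ContinuousLinearMap.isPositive_def']
  refine ⟨mulL2_isSelfAdjoint hT, fun f => ?_⟩
  rw [ContinuousLinearMap.reApplyInnerSelf_apply, L2.inner_def, ← integral_re
    (L2.integrable_inner _ _)]
  refine integral_nonneg_of_ae ?_
  filter_upwards [hT f] with x hx
  rw [hx]
  simp only [RCLike.inner_apply, map_mul, Pi.zero_apply]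
  have : f x * ((starRingEnd ℂ) (w x : ℂ) * (starRingEnd ℂ) (f x)) =
      ((w x * ‖f x‖ ^ 2 : ℝ) : ℂ) := by
    rw [Complex.conj_ofReal, mul_left_comm, Complex.mul_conj']
    push_cast; ring
  rw [this]
  exact (mul_nonneg (hw x) (sq_nonneg ‖f x‖)).trans_eq (Complex.ofReal_re _).symm

/-- The free resolvent `(1 - ∇²/2)⁻¹` on `L²(ℝ^d)`. -/
lemma exists_kineticResolvent (d : ℕ) :
    ∃ A M : Lp ℂ 2 (volume : Measure (Space d)) →L[ℂ] Lp ℂ 2 (volume : Measure (Space d)),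
      (∀ f, M f =ᵐ[volume] fun ξ => (kineticSymbol ξ : ℂ) * f ξ) ∧ (∀ f, A f = 𝓕⁻ (M (𝓕 f))) ∧
      A.IsPositive ∧ (1 - A).IsPositive ∧ (∀ f, A f = 0 → f = 0) ∧
      ∀ φ : 𝓢(Space d, ℂ), A ((φ - (1 / 2 : ℂ) • Δ φ).toLp 2) = φ.toLp 2 := by
  obtain ⟨M, hM, -⟩ := exists_mulL2 (μ := (volume : Measure (Space d)))
    (w := fun ξ => (kineticSymbol ξ : ℂ))
    (Complex.continuous_ofReal.comp continuous_kineticSymbol).aestronglyMeasurable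
    (C := 1) zero_le_one (fun ξ => by
      rw [Complex.norm_real, Real.norm_eq_abs, abs_of_pos (kineticSymbol_pos ξ)]
      exact kineticSymbol_le_one ξ)
  set U := Lp.fourierTransformₗᵢ (Space d) ℂ with hU
  -- Unitary conjugation preserves positivity, so positivity of `A` and `1 - A` reduces to the
  -- bounds `0 < kineticSymbol ≤ 1`.
  have hconj : ∀ T : Lp ℂ 2 (volume : Measure (Space d)) →L[ℂ] Lp ℂ 2 (volume : Measure (Space d)),
      T.IsPositive → ((U.symm : Lp ℂ 2 (volume : Measure (Space d)) →L[ℂ]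
        Lp ℂ 2 (volume : Measure (Space d))) ∘L T ∘L
        (U : Lp ℂ 2 (volume : Measure (Space d)) →L[ℂ]
          Lp ℂ 2 (volume : Measure (Space d)))).IsPositive := by
    intro T hT
    have hi : ∀ f g, inner ℂ (U.symm f) g = inner ℂ f (U g) := fun f g => by
      rw [← U.inner_map_map (U.symm f) g, U.apply_symm_apply]
    rw [ContinuousLinearMap.isPositive_iff]
    refine ⟨fun f g => ?_, fun f => ?_⟩
    · change inner ℂ (U.symm (T (U f))) g = inner ℂ f (U.symm (T (U g)))
      rw [hi, ← inner_conj_symm f, hi, inner_conj_symm]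
      exact hT.inner_left_eq_inner_right _ _
    · change 0 ≤ inner ℂ (U.symm (T (U f))) f
      rw [hi]
      exact hT.inner_nonneg_left _
  refine ⟨(U.symm : Lp ℂ 2 (volume : Measure (Space d)) →L[ℂ] Lp ℂ 2 (volume : Measure (Space d)))
    ∘L M ∘L (U : Lp ℂ 2 (volume : Measure (Space d)) →L[ℂ] Lp ℂ 2 (volume : Measure (Space d))),
    M, hM, fun f => rfl, ?_, ?_, ?_, ?_⟩
  · exact hconj M (mulL2_isPositive hM fun ξ => (kineticSymbol_pos ξ).le)
  · have h1 : (1 - M).IsPositive := by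
      refine mulL2_isPositive (w := fun ξ => 1 - kineticSymbol ξ) (fun f => ?_) fun ξ => ?_
      · filter_upwards [hM f, Lp.coeFn_sub f (M f)] with ξ h1 h2
        rw [sub_apply, one_apply_eq_self, h2, Pi.sub_apply, h1]
        push_cast; ring
      · linarith [kineticSymbol_le_one ξ]
    convert hconj _ h1 using 1
    ext f : 1
    change f - U.symm (M (U f)) = U.symm (U f - M (U f))
    rw [map_sub, U.symm_apply_apply]
  · intro f hf
    have h1 : M (U f) = 0 := by
      have : U.symm (M (U f)) = 0 := hf
      simpa using this
    have h2 : U f = 0 := by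
      refine Lp.ext ?_
      have h3 := hM (U f)
      rw [h1] at h3
      filter_upwards [h3, Lp.coeFn_zero ℂ 2 (volume : Measure (Space d))] with ξ h4 h5
      rw [h5] at h4 ⊢
      have : (kineticSymbol ξ : ℂ) ≠ 0 := by exact_mod_cast (kineticSymbol_pos ξ).ne'
      exact (mul_eq_zero.1 h4.symm).resolve_left this
    simpa using h2
  · intro φ
    change 𝓕⁻ (M (𝓕 ((φ - (1 / 2 : ℂ) • Δ φ).toLp 2))) = φ.toLp 2
    have h1 : M (𝓕 ((φ - (1 / 2 : ℂ) • Δ φ).toLp 2)) = (𝓕 φ).toLp 2 := by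
      rw [SchwartzMap.toLp_fourier_eq]
      refine Lp.ext ?_
      filter_upwards [hM ((𝓕 (φ - (1 / 2 : ℂ) • Δ φ)).toLp 2),
        (𝓕 (φ - (1 / 2 : ℂ) • Δ φ)).coeFn_toLp 2 volume, (𝓕 φ).coeFn_toLp 2 volume] with ξ h1 h2 h3
      rw [h1, h2, h3, fourier_one_sub_laplacian, mul_inv_cancel_left₀]
      exact_mod_cast (kineticSymbol_pos ξ).ne'
    rw [h1, SchwartzMap.toLp_fourierInv_eq, FourierTransform.fourierInv_fourier_eq]

end KineticResolvent

/-! ### Weak solutions of `(1 - ∇²/2) f = h` on `ℝ^d`. -/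

section WeakEquation

open scoped SchwartzMap FourierTransform

variable {d : ℕ}

lemma two_le_infty : (2 : WithTop ℕ∞) ≤ ∞ := WithTop.coe_le_coe.2 le_top

lemma memLp_of_continuous_hasCompactSupport {g : Space d → ℂ} (hg : Continuous g)
    (hs : HasCompactSupport g) : MemLp g 2 (volume : Measure (Space d)) :=
  hg.memLp_of_hasCompactSupport hs

lemma hasCompactSupport_laplacian {F : Type*} [NormedAddCommGroup F] [NormedSpace ℝ F]
    {v : Space d → F} (hs : HasCompactSupport v) : HasCompactSupport (Δ v) := by
  refine hs.mono' ?_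
  intro x hx
  by_contra hcon
  refine hx ?_
  rw [notMem_tsupport_iff_eventuallyEq] at hcon
  have := (InnerProductSpace.laplacian_congr_nhds hcon).self_of_nhds
  rw [this]
  have h0 : (0 : Space d → F) = fun _ => 0 := rfl
  rw [h0, InnerProductSpace.laplacian_const]
  rfl

lemma memLp_kinetic {φ : Space d → ℂ} (hφ : ContDiff ℝ ∞ φ) (hs : HasCompactSupport φ) :
    MemLp (fun x => -(1 / 2) * (Δ φ) x + φ x) 2 (volume : Measure (Space d)) := by
  have hφ2 : ContDiff ℝ 2 φ := hφ.of_le two_le_infty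
  refine memLp_of_continuous_hasCompactSupport
    ((continuous_const.mul (continuous_laplacian hφ2)).add hφ.continuous) ?_
  exact (hasCompactSupport_laplacian hs).mul_left.add hs

lemma norm_laplacian_le {f : Space d → ℂ} (x : Space d) :
    ‖(Δ f) x‖ ≤ d * ‖iteratedFDeriv ℝ 2 f x‖ := by
  rw [laplacian_eq_sum_iteratedFDeriv]
  refine (norm_sum_le _ _).trans ?_
  calc ∑ i : Fin d, ‖iteratedFDeriv ℝ 2 f x ![coordVec i, coordVec i]‖
      ≤ ∑ _i : Fin d, ‖iteratedFDeriv ℝ 2 f x‖ := by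
        refine Finset.sum_le_sum fun i _ => ?_
        refine ((iteratedFDeriv ℝ 2 f x).le_opNorm _).trans ?_
        simp [Fin.prod_univ_two, coordVec]
    _ = _ := by simp

lemma conj_laplacian (f : Space d → ℂ) (x : Space d) :
    (Δ fun y => (starRingEnd ℂ) (f y)) x = (starRingEnd ℂ) ((Δ f) x) := by
  have := congrFun (InnerProductSpace.laplacian_CLE_comp_left (f := f)
    (l := Complex.conjCLE)) x
  exact this

/-- A cutoff argument: weak solutions may be tested against Schwartz functions. -/
lemma integral_schwartz_eq_zero {D : Lp ℂ 2 (volume : Measure (Space d))}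
    (hD : ∀ φ : Space d → ℂ, ContDiff ℝ ∞ φ → HasCompactSupport φ →
      ∫ x, D x * (-(1 / 2) * (Δ φ) x + φ x) = 0) (φ : 𝓢(Space d, ℂ)) :
    ∫ x, D x * (-(1 / 2) * (Δ (φ : Space d → ℂ)) x + φ x) = 0 := by
  let b : ContDiffBump (0 : Space d) := ⟨1, 2, one_pos, one_lt_two⟩
  have hbs : ContDiff ℝ ∞ (b : Space d → ℝ) := b.contDiff
  have hbc : HasCompactSupport (b : Space d → ℝ) := b.hasCompactSupport
  let χ : ℕ → Space d → ℝ := fun n x => b (((n : ℝ) + 1)⁻¹ • x)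
  have hχs : ∀ n, ContDiff ℝ ∞ (χ n) := fun n => hbs.comp (contDiff_const_smul _)
  have hχc : ∀ n, HasCompactSupport (χ n) := fun n =>
    hbc.comp_smul (inv_ne_zero (by positivity))
  have hφs : ContDiff ℝ ∞ (φ : Space d → ℂ) := φ.smooth ⊤
  let ψ : ℕ → Space d → ℂ := fun n x => χ n x • φ x
  have hψs : ∀ n, ContDiff ℝ ∞ (ψ n) := fun n => (hχs n).smul hφs
  have hψc : ∀ n, HasCompactSupport (ψ n) := fun n => (hχc n).smul_right
  -- uniform bounds for the derivatives of the cutoffs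
  have hbd : ∀ k : ℕ, ∃ C, ∀ n x, ‖iteratedFDeriv ℝ k (χ n) x‖ ≤ C := fun k => by
    have hc : Continuous (iteratedFDeriv ℝ k (b : Space d → ℝ)) :=
      hbs.continuous_iteratedFDeriv (by exact_mod_cast le_top)
    obtain ⟨C, hC⟩ := (hc.norm).bddAbove_range_of_hasCompactSupport (hbc.iteratedFDeriv k).norm
    refine ⟨C, fun n x => ?_⟩
    have : iteratedFDeriv ℝ k (χ n) = fun x => (((n : ℝ) + 1)⁻¹) ^ k •
        iteratedFDeriv ℝ k (b : Space d → ℝ) (((n : ℝ) + 1)⁻¹ • x) :=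
      iteratedFDeriv_comp_const_smul _ (hbs.of_le (by exact_mod_cast le_top))
    rw [this, norm_smul]
    have h1 : ‖(((n : ℝ) + 1)⁻¹) ^ k‖ ≤ 1 := by
      rw [norm_pow]
      refine pow_le_one₀ (norm_nonneg _) ?_
      rw [norm_inv, Real.norm_eq_abs, abs_of_pos (by positivity)]
      exact inv_le_one_of_one_le₀ (by linarith [n.cast_nonneg (α := ℝ)])
    have h2 : ‖iteratedFDeriv ℝ k (b : Space d → ℝ) (((n : ℝ) + 1)⁻¹ • x)‖ ≤ C :=
      hC ⟨_, rfl⟩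
    calc _ ≤ 1 * ‖iteratedFDeriv ℝ k (b : Space d → ℝ) (((n : ℝ) + 1)⁻¹ • x)‖ := by gcongr
      _ ≤ C := by rw [one_mul]; exact h2
  choose Cb hCb using hbd
  -- decay of the Schwartz function
  set r : ℕ := d + 1 with hr
  have hdec : ∀ k : ℕ, ∃ C, ∀ x, ‖iteratedFDeriv ℝ k (φ : Space d → ℂ) x‖ ≤
      C * ((1 + ‖x‖) ^ r)⁻¹ := fun k => by
    refine ⟨2 ^ r * (Finset.Iic (r, k)).sup (fun m => SchwartzMap.seminorm ℝ m.1 m.2) φ,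
      fun x => ?_⟩
    rw [← div_eq_mul_inv, le_div_iff₀ (by positivity), mul_comm]
    exact SchwartzMap.one_add_le_sup_seminorm_apply (𝕜 := ℝ) (m := (r, k)) le_rfl le_rfl φ x
  choose Cφ hCφ using hdec
  have hCb0 : ∀ k, 0 ≤ Cb k := fun k => (norm_nonneg _).trans (hCb k 0 0)
  set g : Space d → ℝ := fun x => ((1 + ‖x‖) ^ r)⁻¹ with hg
  have hg0 : ∀ x, 0 < g x := fun x => by simp only [hg]; positivity
  obtain ⟨C, hC⟩ : ∃ C, ∀ n x, ‖-(1 / 2) * (Δ (ψ n)) x + ψ n x‖ ≤ C * g x := by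
    refine ⟨1 / 2 * (d * ∑ i ∈ Finset.range (2 + 1), ((2 : ℕ).choose i : ℝ) * Cb i * Cφ (2 - i)) +
      Cb 0 * Cφ 0, fun n x => ?_⟩
    have h1 : ‖iteratedFDeriv ℝ 2 (ψ n) x‖ ≤
        (∑ i ∈ Finset.range (2 + 1), ((2 : ℕ).choose i : ℝ) * Cb i * Cφ (2 - i)) * g x := by
      refine (norm_iteratedFDeriv_smul_le (hχs n) hφs x two_le_infty).trans ?_
      rw [Finset.sum_mul]
      refine Finset.sum_le_sum fun i _ => ?_
      rw [mul_assoc _ (Cφ (2 - i))]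
      have := hCb0 i
      gcongr
      · exact hCb i n x
      · exact hCφ (2 - i) x
    have h2 : ‖ψ n x‖ ≤ Cb 0 * Cφ 0 * g x := by
      have e1 := hCb 0 n x
      have e2 := hCφ 0 x
      rw [norm_iteratedFDeriv_zero] at e1 e2
      change ‖χ n x • φ x‖ ≤ _
      rw [norm_smul, mul_assoc]
      have := hCb0 0
      gcongr
    refine (norm_add_le _ _).trans ?_
    rw [add_mul, norm_mul]
    have h3 : ‖(-(1 / 2) : ℂ)‖ = 1 / 2 := by norm_num
    rw [h3, mul_assoc (1 / 2 : ℝ), mul_assoc (d : ℝ)]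
    gcongr
    exact (norm_laplacian_le x).trans (by gcongr)
  have hgc : Continuous g := by
    simp only [hg]
    exact Continuous.inv₀ (by fun_prop) fun x => by positivity
  have hgL : MemLp g 2 (volume : Measure (Space d)) := by
    rw [memLp_two_iff_integrable_sq hgc.aestronglyMeasurable]
    -- The exponent `r = d + 1` exceeds the dimension, so `g` is integrable; `g ≤ 1` then makes `g²`
    -- integrable too.
    have h1 : Integrable (fun x : Space d => (1 + ‖x‖) ^ (-((r : ℕ) : ℝ))) volume := by
      refine integrable_one_add_norm ?_
      rw [hr]; simp
    refine h1.mono' (hgc.pow 2).aestronglyMeasurable (Eventually.of_forall fun x => ?_)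
    have h2 : (1 + ‖x‖) ^ (-((r : ℕ) : ℝ)) = g x := by
      rw [Real.rpow_neg (by positivity), Real.rpow_natCast]
    rw [h2, Real.norm_eq_abs, abs_of_nonneg (sq_nonneg _), sq]
    have h3 : g x ≤ 1 := by
      simp only [hg]
      refine inv_le_one_of_one_le₀ (one_le_pow₀ ?_)
      linarith [norm_nonneg x]
    nlinarith [hg0 x]
  have hDg : Integrable (fun x => C * (‖D x‖ * g x)) volume :=
    ((Lp.memLp D).norm.integrable_mul hgL).const_mul C
  have hlim : Tendsto (fun n => ∫ x, D x * (-(1 / 2) * (Δ (ψ n)) x + ψ n x)) atTop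
      (𝓝 (∫ x, D x * (-(1 / 2) * (Δ (φ : Space d → ℂ)) x + φ x))) := by
    refine tendsto_integral_of_dominated_convergence _ (fun n => ?_) hDg (fun n => ?_) ?_
    · exact (Lp.aestronglyMeasurable D).mul (memLp_kinetic (hψs n) (hψc n)).1
    · refine Eventually.of_forall fun x => ?_
      rw [norm_mul]
      calc _ ≤ ‖D x‖ * (C * g x) := by gcongr; exact hC n x
        _ = _ := by ring
    · refine Eventually.of_forall fun x => ?_
      -- Once `n` is large the cutoff equals `1` in a neighbourhood of `x`, so the sequence of
      -- integrands is eventually constant at `x`.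
      refine tendsto_const_nhds.congr' ?_
      obtain ⟨N, hN⟩ := exists_nat_gt ‖x‖
      filter_upwards [eventually_ge_atTop N] with n hn
      have hev : ψ n =ᶠ[𝓝 x] φ := by
        have hopen : IsOpen {y : Space d | ‖y‖ < (n : ℝ) + 1} :=
          isOpen_lt continuous_norm continuous_const
        have hmem : x ∈ {y : Space d | ‖y‖ < (n : ℝ) + 1} := by
          have : (N : ℝ) ≤ n := by exact_mod_cast hn
          rw [Set.mem_ofPred_eq]; linarith
        filter_upwards [hopen.mem_nhds hmem] with y hy
        have : χ n y = 1 := by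
          refine b.one_of_mem_closedBall ?_
          rw [mem_closedBall_zero_iff, norm_smul, norm_inv, Real.norm_eq_abs,
            abs_of_pos (by positivity : (0 : ℝ) < (n : ℝ) + 1), inv_mul_le_iff₀ (by positivity)]
          change ‖y‖ ≤ ((n : ℝ) + 1) * 1
          linarith
        change χ n y • φ y = φ y
        rw [this, one_smul]
      rw [(InnerProductSpace.laplacian_congr_nhds hev).self_of_nhds, hev.self_of_nhds]
  have hzero : ∀ n, ∫ x, D x * (-(1 / 2) * (Δ (ψ n)) x + ψ n x) = 0 := fun n =>
    hD (ψ n) (hψs n) (hψc n)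
  simp_rw [hzero] at hlim
  exact (tendsto_nhds_unique hlim tendsto_const_nhds)

/-- Symmetry of `A` moves it onto the test function. The weak equation pairs bilinearly, the inner
product sesquilinearly, hence the passage to the conjugate of `φ`. -/
lemma integral_kineticResolvent_mul
    {A : Lp ℂ 2 (volume : Measure (Space d)) →L[ℂ] Lp ℂ 2 (volume : Measure (Space d))}
    (hA : A.IsPositive)
    (hAS : ∀ φ : 𝓢(Space d, ℂ), A ((φ - (1 / 2 : ℂ) • Δ φ).toLp 2) = φ.toLp 2)
    (h : Lp ℂ 2 (volume : Measure (Space d))) {φ : Space d → ℂ}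
    (hφ : ContDiff ℝ ∞ φ) (hs : HasCompactSupport φ) :
    ∫ x, (A h) x * (-(1 / 2) * (Δ φ) x + φ x) = ∫ x, h x * φ x := by
  set χf : Space d → ℂ := fun y => (starRingEnd ℂ) (φ y) with hχf
  have hχs : HasCompactSupport χf := hs.comp_left (map_zero _)
  have hχd : ContDiff ℝ ∞ χf := Complex.conjCLE.contDiff.comp hφ
  set χ : 𝓢(Space d, ℂ) := hχs.toSchwartzMap hχd with hχ
  have hχx : ∀ x, χ x = (starRingEnd ℂ) (φ x) := fun x => rfl
  have hLx : ∀ x, (χ - (1 / 2 : ℂ) • Δ χ) x =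
      (starRingEnd ℂ) (-(1 / 2) * (Δ φ) x + φ x) := fun x => by
    have h1 : (Δ χ) x = (starRingEnd ℂ) ((Δ φ) x) := by
      rw [SchwartzMap.laplacian_apply, ← conj_laplacian]
      rfl
    rw [sub_apply, smul_apply, h1, hχx]
    simp only [smul_eq_mul, map_add, map_mul, map_neg, map_div₀, map_one, map_ofNat]
    ring
  have h1 : inner ℂ ((χ - (1 / 2 : ℂ) • Δ χ).toLp 2) (A h) = inner ℂ (χ.toLp 2) h := by
    rw [← hA.inner_left_eq_inner_right, hAS]
  rw [L2.inner_def, L2.inner_def] at h1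
  convert h1 using 1
  · refine integral_congr_ae ?_
    filter_upwards [(χ - (1 / 2 : ℂ) • Δ χ).coeFn_toLp 2 volume] with x hx
    rw [hx, hLx]
    simp [RCLike.inner_apply]
  · refine integral_congr_ae ?_
    filter_upwards [χ.coeFn_toLp 2 volume] with x hx
    rw [hx, hχx]
    simp [RCLike.inner_apply]

/-- After extension to Schwartz functions by cutoff, `exists_one_sub_laplacian_eq` shows that `D`
annihilates every smooth compactly supported function. -/
lemma eq_zero_of_integral_kinetic_eq_zero {D : Lp ℂ 2 (volume : Measure (Space d))}
    (hD : ∀ φ : Space d → ℂ, ContDiff ℝ ∞ φ → HasCompactSupport φ →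
      ∫ x, D x * (-(1 / 2) * (Δ φ) x + φ x) = 0) : D = 0 := by
  have hS := integral_schwartz_eq_zero hD
  have hD0 : ∀ᵐ x ∂(volume : Measure (Space d)), D x = 0 := by
    refine ae_eq_zero_of_integral_contDiff_smul_eq_zero
      ((Lp.memLp D).locallyIntegrable (by norm_num)) fun g hg hgs => ?_
    have hgs' : HasCompactSupport fun x => (g x : ℂ) := hgs.comp_left Complex.ofReal_zero
    have hg' : ContDiff ℝ ∞ fun x => (g x : ℂ) := Complex.ofRealCLM.contDiff.comp hg
    obtain ⟨φ, hφ⟩ := exists_one_sub_laplacian_eq (hgs'.toSchwartzMap hg')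
    rw [← hS φ]
    congr 1
    funext x
    have h2 : (φ - (1 / 2 : ℂ) • Δ φ) x = (g x : ℂ) := by rw [hφ]; rfl
    rw [sub_apply, smul_apply, SchwartzMap.laplacian_apply] at h2
    rw [Complex.real_smul, ← h2, smul_eq_mul]
    ring
  refine Lp.ext ?_
  filter_upwards [hD0, Lp.coeFn_zero ℂ 2 (volume : Measure (Space d))] with x h1 h2
  rw [h1, h2]; rfl

lemma integral_sub_mul {α : Type*} [MeasurableSpace α] {μ : Measure α} (f g : Lp ℂ 2 μ)
    {k : α → ℂ} (hk : MemLp k 2 μ) :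
    ∫ x, (f - g : Lp ℂ 2 μ) x * k x ∂μ = ∫ x, f x * k x ∂μ - ∫ x, g x * k x ∂μ := by
  have hf : Integrable (fun x => f x * k x) μ := (Lp.memLp f).integrable_mul hk
  have hg : Integrable (fun x => g x * k x) μ := (Lp.memLp g).integrable_mul hk
  rw [← integral_sub hf hg]
  refine integral_congr_ae ?_
  filter_upwards [Lp.coeFn_sub f g] with x hx
  rw [hx, Pi.sub_apply, sub_mul]

/-- The weak form of `(1 - ∇²/2) f = h` on `ℝ^d`. -/
lemma weak_iff_eq_kineticResolvent
    {A : Lp ℂ 2 (volume : Measure (Space d)) →L[ℂ] Lp ℂ 2 (volume : Measure (Space d))}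
    (hA : A.IsPositive)
    (hAS : ∀ φ : 𝓢(Space d, ℂ), A ((φ - (1 / 2 : ℂ) • Δ φ).toLp 2) = φ.toLp 2)
    (f h : Lp ℂ 2 (volume : Measure (Space d))) :
    (∀ φ : Space d → ℂ, ContDiff ℝ ∞ φ → HasCompactSupport φ →
      ∫ x, f x * (-(1 / 2) * (Δ φ) x + φ x) = ∫ x, h x * φ x) ↔ f = A h := by
  constructor
  · intro hf
    refine sub_eq_zero.1 (eq_zero_of_integral_kinetic_eq_zero fun φ hφ hs => ?_)
    rw [integral_sub_mul f (A h) (memLp_kinetic hφ hs), hf φ hφ hs,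
      integral_kineticResolvent_mul hA hAS h hφ hs, sub_self]
  · rintro rfl
    exact fun φ hφ hs => integral_kineticResolvent_mul hA hAS h hφ hs

end WeakEquation

/-! ### Potentials vanishing at infinity are relatively compact in dimension three. -/

section RelativeCompactness

open scoped SchwartzMap FourierTransform InnerProductSpace

/-- The square of the symbol decays like `‖ξ‖⁻⁴`, and `4` exceeds the dimension `3`. -/
lemma memLp_kineticSymbol : MemLp (fun ξ : Space 3 => (kineticSymbol ξ : ℂ)) 2 volume := by
  refine ((memLp_two_iff_integrable_sq_norm
    (Complex.continuous_ofReal.comp continuous_kineticSymbol).aestronglyMeasurable).2 ?_)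
  have h := integrable_rpow_neg_one_add_norm_sq (E := Space 3) (μ := volume) (r := 4)
    (by simp; norm_num)
  refine h.mono' (((Complex.continuous_ofReal.comp
    continuous_kineticSymbol).norm.pow 2).aestronglyMeasurable) (Eventually.of_forall fun ξ => ?_)
  simp only [Function.comp_apply]
  rw [Complex.norm_real, Real.norm_eq_abs, Real.norm_eq_abs, sq_abs, abs_of_nonneg (sq_nonneg _),
    kineticSymbol, show (-4 / 2 : ℝ) = -(2 : ℕ) by norm_num,
    Real.rpow_neg (by positivity), Real.rpow_natCast, ← inv_pow]
  gcongr
  nlinarith [Real.pi_gt_three, sq_nonneg ‖ξ‖, mul_nonneg (sq_nonneg ‖ξ‖)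
    (show 0 ≤ 2 * Real.pi ^ 2 - 1 by nlinarith [Real.pi_gt_three])]

/-- The kernel vectors `ξ ↦ e^{-2πi⟨ξ, x⟩} m(ξ)`, `m` being the symbol of the free resolvent. -/
lemma exists_kineticKernel :
    ∃ (K : Space 3 → Lp ℂ 2 (volume : Measure (Space 3))) (n : ℝ), (∀ x, ‖K x‖ ≤ n) ∧
      (∀ x g, inner ℂ (K x) g =
        ∫ ξ, Real.fourierChar ⟪ξ, x⟫_ℝ • ((kineticSymbol ξ : ℂ) * g ξ)) ∧
      ∀ g, Continuous fun x => inner ℂ (K x) g := by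
  have hnorm : ∀ x ξ : Space 3, ‖(starRingEnd ℂ) (Real.fourierChar ⟪ξ, x⟫_ℝ : ℂ) *
      (kineticSymbol ξ : ℂ)‖ = ‖(kineticSymbol ξ : ℂ)‖ := fun x ξ => by
    rw [norm_mul, RCLike.norm_conj, Circle.norm_coe, one_mul]
  have hK : ∀ x : Space 3, MemLp (fun ξ => (starRingEnd ℂ) (Real.fourierChar ⟪ξ, x⟫_ℝ : ℂ) *
      (kineticSymbol ξ : ℂ)) 2 volume := fun x => by
    refine memLp_kineticSymbol.mono ?_ (Eventually.of_forall fun ξ => (hnorm x ξ).le)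
    refine Continuous.aestronglyMeasurable ?_
    have := continuous_kineticSymbol (d := 3)
    fun_prop
  have hinner : ∀ x g, inner ℂ ((hK x).toLp _) g =
      ∫ ξ, Real.fourierChar ⟪ξ, x⟫_ℝ • ((kineticSymbol ξ : ℂ) * g ξ) := fun x g => by
    rw [L2.inner_def]
    refine integral_congr_ae ?_
    filter_upwards [(hK x).coeFn_toLp] with ξ h1
    rw [h1]
    simp only [RCLike.inner_apply, map_mul, Complex.conj_conj, Complex.conj_ofReal,
      Circle.smul_def, smul_eq_mul]
    ring
  refine ⟨fun x => (hK x).toLp _, ‖memLp_kineticSymbol.toLp _‖, fun x => ?_, hinner, fun g => ?_⟩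
  · refine Lp.norm_le_norm_of_ae_le ?_
    filter_upwards [(hK x).coeFn_toLp, memLp_kineticSymbol.coeFn_toLp] with ξ h1 h2
    rw [h1, h2, hnorm]
  · simp_rw [hinner]
    have hi : Integrable (fun ξ => (kineticSymbol ξ : ℂ) * g ξ) volume :=
      memLp_kineticSymbol.integrable_mul (Lp.memLp g)
    refine continuous_of_dominated (bound := fun ξ => ‖(kineticSymbol ξ : ℂ) * g ξ‖) ?_ ?_
      hi.norm ?_
    · intro x
      refine AEStronglyMeasurable.fun_smul (Continuous.aestronglyMeasurable ?_) hi.1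
      fun_prop
    · exact fun x => Eventually.of_forall fun ξ => (Circle.norm_smul _ _).le
    · refine Eventually.of_forall fun ξ => ?_
      fun_prop

/-- For Schwartz functions the inverse Fourier transform is a pointwise integral. This identifies `T
𝓕⁻¹ M` with a Carleman operator on a dense subspace, which suffices by continuity. -/
lemma mul_fourierInv_toLp
    {M T : Lp ℂ 2 (volume : Measure (Space 3)) →L[ℂ] Lp ℂ 2 (volume : Measure (Space 3))}
    (hM : ∀ f, M f =ᵐ[volume] fun ξ => (kineticSymbol ξ : ℂ) * f ξ) {w : Space 3 → ℝ}
    (hT : ∀ f, T f =ᵐ[volume] fun x => (w x : ℂ) * f x) (φ : 𝓢(Space 3, ℂ)) :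
    T (𝓕⁻ (M (φ.toLp 2))) =ᵐ[volume] fun x => (w x : ℂ) *
      ∫ ξ, Real.fourierChar ⟪ξ, x⟫_ℝ • ((kineticSymbol ξ : ℂ) * φ.toLp 2 volume ξ) := by
  obtain ⟨ψ, hψ⟩ : ∃ ψ : 𝓢(Space 3, ℂ), ψ = SchwartzMap.smulLeftCLM ℂ
    (fun ξ : Space 3 => (kineticSymbol ξ : ℂ)) φ := ⟨_, rfl⟩
  have hψx : ∀ ξ, ψ ξ = (kineticSymbol ξ : ℂ) * φ ξ := fun ξ => by
    rw [hψ, SchwartzMap.smulLeftCLM_apply_apply hasTemperateGrowth_kineticSymbol, smul_eq_mul]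
  have h1 : M (φ.toLp 2) = ψ.toLp 2 := by
    refine Lp.ext ?_
    filter_upwards [hM (φ.toLp 2), φ.coeFn_toLp 2 volume, ψ.coeFn_toLp 2 volume] with ξ h1 h2 h3
    rw [h1, h2, h3, hψx]
  rw [h1, SchwartzMap.toLp_fourierInv_eq]
  filter_upwards [hT ((𝓕⁻ ψ).toLp 2), (𝓕⁻ ψ).coeFn_toLp 2 volume] with x h2 h4
  rw [h2, h4, SchwartzMap.fourierInv_coe, Real.fourierInv_eq]
  congr 1
  refine integral_congr_ae ?_
  filter_upwards [φ.coeFn_toLp 2 volume] with ξ h5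
  rw [h5, hψx]

/-- A square-integrable bounded potential is relatively compact with respect to the kinetic
energy. -/
lemma isCompactOperator_mul_kineticResolvent_of_memLp
    {A M T : Lp ℂ 2 (volume : Measure (Space 3)) →L[ℂ] Lp ℂ 2 (volume : Measure (Space 3))}
    (hM : ∀ f, M f =ᵐ[volume] fun ξ => (kineticSymbol ξ : ℂ) * f ξ)
    (hA : ∀ f, A f = 𝓕⁻ (M (𝓕 f))) {w : Space 3 → ℝ} (hw : MemLp w 2 volume)
    (hT : ∀ f, T f =ᵐ[volume] fun x => (w x : ℂ) * f x) : IsCompactOperator (T * A) := by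
  obtain ⟨K, n, hKn, hinner, hcont⟩ := exists_kineticKernel
  obtain ⟨C, hC, hCc⟩ := exists_carleman (μ := (volume : Measure (Space 3)))
    (κ := fun x => (w x : ℂ) • K x) (N := fun x => n * ‖w x‖) (hw.norm.const_mul _)
    (fun x => by
      rw [norm_smul, mul_comm, Complex.norm_real]
      gcongr
      exact hKn x)
    (fun f => by
      simp_rw [inner_smul_left, Complex.conj_ofReal]
      exact (Complex.continuous_ofReal.comp_aestronglyMeasurable hw.1).mul
        (hcont f).aestronglyMeasurable)
  obtain ⟨U, hU⟩ : ∃ U, U = Lp.fourierTransformₗᵢ (Space 3) ℂ := ⟨_, rfl⟩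
  have hdense : DenseRange (fun φ : 𝓢(Space 3, ℂ) => φ.toLp 2 (volume : Measure (Space 3))) :=
    SchwartzMap.denseRange_toLpCLM (F := ℂ) (E := Space 3) ENNReal.ofNat_ne_top
  have hTC : ∀ g, T (U.symm (M g)) = C g := by
    refine fun g => congrFun (hdense.equalizer (g := fun g => T (U.symm (M g))) (h := fun g => C g)
      (T.continuous.comp (U.symm.continuous.comp M.continuous)) C.continuous ?_) g
    funext φ
    refine Lp.ext ?_
    have h1 := mul_fourierInv_toLp hM hT φ
    have h2 : U.symm (M (φ.toLp 2)) = 𝓕⁻ (M (φ.toLp 2)) := by rw [hU]; rfl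
    rw [← h2] at h1
    filter_upwards [h1, hC (φ.toLp 2)] with x h3 h4
    simp only [Function.comp_apply]
    rw [h3, h4, inner_smul_left, Complex.conj_ofReal, hinner]
  have hfin : T * A = C ∘L (U : Lp ℂ 2 (volume : Measure (Space 3)) →L[ℂ]
      Lp ℂ 2 (volume : Measure (Space 3))) := by
    ext1 f
    rw [mul_apply_eq_comp, hA]
    have h2 : U.symm (M (U f)) = 𝓕⁻ (M (𝓕 f)) := by rw [hU]; rfl
    rw [← h2]
    exact hTC (U f)
  rw [hfin]
  exact hCc.comp_clm _

/-- A bounded potential vanishing at infinity is relatively compact with respect to the kinetic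
energy. -/
lemma isCompactOperator_mul_kineticResolvent
    {A M T : Lp ℂ 2 (volume : Measure (Space 3)) →L[ℂ] Lp ℂ 2 (volume : Measure (Space 3))}
    (hM : ∀ f, M f =ᵐ[volume] fun ξ => (kineticSymbol ξ : ℂ) * f ξ)
    (hA : ∀ f, A f = 𝓕⁻ (M (𝓕 f))) {V : Space 3 → ℝ} (hV : Continuous V)
    (hV0 : Tendsto V (cocompact _) (𝓝 0))
    (hT : ∀ f, T f =ᵐ[volume] fun x => (V x : ℂ) * f x) : IsCompactOperator (T * A) := by
  have key : ∀ n : ℕ, ∃ S : Lp ℂ 2 (volume : Measure (Space 3)) →L[ℂ]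
      Lp ℂ 2 (volume : Measure (Space 3)), IsCompactOperator (S * A) ∧
      ‖T - S‖ ≤ 1 / ((n : ℝ) + 1) := fun n => by
    have hpos : (0 : ℝ) < 1 / ((n : ℝ) + 1) := by positivity
    have hev : ∀ᶠ x in cocompact (Space 3), |V x| < 1 / ((n : ℝ) + 1) := by
      have := hV0.norm
      rw [norm_zero] at this
      exact this.eventually_lt_const hpos
    -- Outside the compact set `s` the potential is below `1/(n + 1)`. Truncating it to `s` costs at
    -- most that in operator norm and makes it square integrable.
    obtain ⟨s, hs, hsc⟩ := mem_cocompact.1 hev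
    have hsm : MeasurableSet s := hs.isClosed.measurableSet
    have hwm : Measurable (s.indicator V) := hV.measurable.indicator hsm
    obtain ⟨C, hC⟩ := hs.exists_bound_of_continuousOn hV.continuousOn
    have hCb : ∀ x, ‖s.indicator V x‖ ≤ |C| := fun x => by
      by_cases hx : x ∈ s
      · rw [Set.indicator_of_mem hx]
        exact (hC x hx).trans (le_abs_self _)
      · rw [Set.indicator_of_notMem hx, norm_zero]
        exact abs_nonneg _
    obtain ⟨S, hS, -⟩ := exists_mulL2 (μ := (volume : Measure (Space 3)))
      (w := fun x => ((s.indicator V x : ℝ) : ℂ))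
      (Complex.measurable_ofReal.comp hwm).aestronglyMeasurable (abs_nonneg C)
      (fun x => by rw [Complex.norm_real]; exact hCb x)
    have hw : MemLp (s.indicator V) 2 (volume : Measure (Space 3)) := by
      rw [memLp_indicator_iff_restrict hsm]
      have : IsFiniteMeasure ((volume : Measure (Space 3)).restrict s) :=
        ⟨by simpa using hs.measure_lt_top⟩
      refine MemLp.of_bound hV.aestronglyMeasurable C ?_
      filter_upwards [ae_restrict_mem hsm] with x hx using hC x hx
    refine ⟨S, isCompactOperator_mul_kineticResolvent_of_memLp hM hA hw hS, ?_⟩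
    refine ContinuousLinearMap.opNorm_le_bound _ hpos.le fun f => ?_
    refine Lp.norm_le_mul_norm_of_ae_le_mul ?_
    filter_upwards [hT f, hS f, Lp.coeFn_sub (T f) (S f)] with x h1 h2 h3
    rw [sub_apply, h3, Pi.sub_apply, h1, h2, ← sub_mul, norm_mul, ← Complex.ofReal_sub,
      Complex.norm_real]
    gcongr
    by_cases hx : x ∈ s
    · rw [Set.indicator_of_mem hx, sub_self, norm_zero]
      exact hpos.le
    · rw [Set.indicator_of_notMem hx, sub_zero]
      exact (hsc hx).le
  choose S hSc hSn using key
  have hlim : Tendsto S atTop (𝓝 T) := by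
    rw [tendsto_iff_norm_sub_tendsto_zero]
    refine squeeze_zero (fun _ => norm_nonneg _) (fun n => ?_)
      tendsto_one_div_add_atTop_nhds_zero_nat
    rw [norm_sub_rev]
    exact hSn n
  exact isCompactOperator_of_tendsto (hlim.mul_const A) (Eventually.of_forall hSc)

end RelativeCompactness

/-! ### Symmetric integral operators and the self-gravity operator on `ℝ³`. -/

section IntegralOperator

variable {α : Type*} [MeasurableSpace α] {μ : Measure α} [SFinite μ]

/-- The operator `p K p` with `K` a symmetric integral operator is compact and self-adjoint as soon
as `p` is square integrable and the kernel of `K p` is square integrable in its second variable,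
uniformly in the first. -/
lemma exists_symmetric_integralOperator {k : α → α → ℝ} {p : α → ℝ} {n : ℝ}
    (hk : Measurable (Function.uncurry k)) (hsymm : ∀ x y, k x y = k y x) (hpm : Measurable p)
    (hp : MemLp p 2 μ) (hq : ∀ x, Integrable (fun y => (k x y * p y) ^ 2) μ)
    (hqn : ∀ x, ∫ y, (k x y * p y) ^ 2 ∂μ ≤ n) :
    ∃ G : Lp ℂ 2 μ →L[ℂ] Lp ℂ 2 μ, IsSelfAdjoint G ∧ IsCompactOperator G ∧
      ∀ f, G f =ᵐ[μ] fun x => (p x : ℂ) * ∫ y, (k x y : ℂ) * ((p y : ℂ) * f y) ∂μ := by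
  have hqm : Measurable fun z : α × α => k z.1 z.2 * p z.2 :=
    hk.mul (hpm.comp measurable_snd)
  have hqL : ∀ x, MemLp (fun y => ((k x y * p y : ℝ) : ℂ)) 2 μ := fun x => by
    have h1 : Measurable fun y => k x y * p y := hqm.comp measurable_prodMk_left
    exact ((memLp_two_iff_integrable_sq h1.aestronglyMeasurable).2 (hq x)).ofReal
  have hnorm : ∀ x, ‖(hqL x).toLp _‖ ^ 2 ≤ n := fun x => by
    refine le_of_eq_of_le ?_ (hqn x)
    rw [← re_inner_self, L2.inner_def, ← RCLike.re_eq_complex_re, ← integral_re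
      (L2.integrable_inner _ _)]
    refine integral_congr_ae ?_
    filter_upwards [(hqL x).coeFn_toLp] with y hy
    rw [hy, RCLike.re_eq_complex_re, re_inner_self (X := ℂ), Complex.norm_real, Real.norm_eq_abs,
      sq_abs]
  have hinner : ∀ x f, inner ℂ ((hqL x).toLp _) f =
      ∫ y, (k x y : ℂ) * ((p y : ℂ) * f y) ∂μ := fun x f => by
    rw [L2.inner_def]
    refine integral_congr_ae ?_
    filter_upwards [(hqL x).coeFn_toLp] with y hy
    rw [hy]
    simp only [RCLike.inner_apply, Complex.conj_ofReal]
    push_cast; ring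
  have hFm : ∀ f : Lp ℂ 2 μ, StronglyMeasurable fun z : α × α =>
      (k z.1 z.2 : ℂ) * ((p z.2 : ℂ) * f z.2) := fun f =>
    (Complex.measurable_ofReal.comp hk).stronglyMeasurable.mul
      ((Complex.measurable_ofReal.comp (hpm.comp measurable_snd)).stronglyMeasurable.mul
        ((Lp.stronglyMeasurable f).comp_measurable measurable_snd))
  obtain ⟨G, hG, hGc⟩ := exists_carleman (μ := μ)
    (κ := fun x => (p x : ℂ) • (hqL x).toLp _) (N := fun x => Real.sqrt n * ‖p x‖)
    (hp.norm.const_mul _)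
    (fun x => by
      rw [norm_smul, mul_comm, Complex.norm_real]
      gcongr
      exact Real.le_sqrt_of_sq_le (hnorm x))
    (fun f => by
      simp_rw [inner_smul_left, Complex.conj_ofReal, hinner]
      exact (Complex.measurable_ofReal.comp hpm).aestronglyMeasurable.mul
        (hFm f).integral_prod_right'.aestronglyMeasurable)
  have hG' : ∀ f, G f =ᵐ[μ] fun x => (p x : ℂ) * ∫ y, (k x y : ℂ) * ((p y : ℂ) * f y) ∂μ :=
    fun f => by
      filter_upwards [hG f] with x hx
      rw [hx, inner_smul_left, Complex.conj_ofReal, hinner]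
  refine ⟨G, ?_, hGc, hG'⟩
  rw [ContinuousLinearMap.isSelfAdjoint_iff_isSymmetric]
  intro f g
  change inner ℂ (G f) g = inner ℂ f (G g)
  have hInt : ∀ (x : α) (f : Lp ℂ 2 μ),
      Integrable (fun y => (k x y : ℂ) * ((p y : ℂ) * f y)) μ := fun x f => by
    have : Integrable (fun y => ((k x y * p y : ℝ) : ℂ) * f y) μ :=
      (hqL x).integrable_mul (Lp.memLp f)
    refine this.congr (Eventually.of_forall fun y => ?_)
    simp only
    push_cast; ring
  have hbound : ∀ x, ∫ y, ‖(k x y : ℂ) * ((p y : ℂ) * f y)‖ ∂μ ≤ n + ∫ y, ‖f y‖ ^ 2 ∂μ :=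
    fun x => by
      have hf2 : Integrable (fun y => ‖f y‖ ^ 2) μ := (Lp.memLp f).norm.integrable_sq
      refine (integral_mono (hInt x f).norm ((hq x).add hf2) fun y => ?_).trans ?_
      · simp only [Pi.add_apply]
        rw [← mul_assoc, norm_mul, ← Complex.ofReal_mul, Complex.norm_real, Real.norm_eq_abs,
          ← sq_abs (k x y * p y)]
        nlinarith [sq_nonneg (|k x y * p y| - ‖f y‖), sq_nonneg (|k x y * p y|),
          sq_nonneg (‖f y‖)]
      · simp only [Pi.add_apply]
        rw [integral_add (hq x) hf2]
        linarith [hqn x]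
  have hgp : Integrable (fun x => (p x : ℂ) * g x) μ := hp.ofReal.integrable_mul (Lp.memLp g)
  -- Fubini applies: the inner integral of the modulus is bounded uniformly in `x` by `hbound`, and
  -- `p g` is integrable as a product of square-integrable functions.
  have hprod : Integrable (Function.uncurry fun x y =>
      ((p x : ℂ) * g x) * (starRingEnd ℂ) ((k x y : ℂ) * ((p y : ℂ) * f y))) (μ.prod μ) := by
    have hm : StronglyMeasurable (Function.uncurry fun x y =>
        ((p x : ℂ) * g x) * (starRingEnd ℂ) ((k x y : ℂ) * ((p y : ℂ) * f y))) := by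
      refine StronglyMeasurable.mul ?_ (Complex.continuous_conj.comp_stronglyMeasurable (hFm f))
      exact ((Complex.measurable_ofReal.comp (hpm.comp measurable_fst)).stronglyMeasurable.mul
        ((Lp.stronglyMeasurable g).comp_measurable measurable_fst))
    rw [integrable_prod_iff hm.aestronglyMeasurable]
    refine ⟨Eventually.of_forall fun x => ?_, ?_⟩
    · simp only [Function.uncurry_apply_pair]
      refine Integrable.const_mul ?_ _
      exact (Complex.conjCLE.toContinuousLinearMap.integrable_comp (hInt x f))
    · simp only [Function.uncurry_apply_pair, norm_mul ((p _ : ℂ) * g _), RCLike.norm_conj]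
      simp_rw [integral_const_mul]
      refine (hgp.norm.mul_const (n + ∫ y, ‖f y‖ ^ 2 ∂μ)).mono' ?_
        (Eventually.of_forall fun x => ?_)
      · exact hgp.norm.1.mul (hFm f).norm.integral_prod_right'.aestronglyMeasurable
      · rw [Real.norm_of_nonneg (mul_nonneg (norm_nonneg _)
          (integral_nonneg fun y => norm_nonneg _))]
        gcongr
        exact hbound x
  have h1 : inner ℂ (G f) g = ∫ x, ∫ y,
      ((p x : ℂ) * g x) * (starRingEnd ℂ) ((k x y : ℂ) * ((p y : ℂ) * f y)) ∂μ ∂μ := by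
    rw [L2.inner_def]
    refine integral_congr_ae ?_
    filter_upwards [hG' f] with x hx
    rw [hx, integral_const_mul, integral_conj]
    simp only [RCLike.inner_apply, map_mul, Complex.conj_ofReal]
    ring
  have h2 : inner ℂ f (G g) = ∫ y, ∫ x,
      ((p x : ℂ) * g x) * (starRingEnd ℂ) ((k x y : ℂ) * ((p y : ℂ) * f y)) ∂μ ∂μ := by
    rw [L2.inner_def]
    refine integral_congr_ae ?_
    filter_upwards [hG' g] with y hy
    rw [hy]
    simp only [RCLike.inner_apply, map_mul, Complex.conj_ofReal]
    rw [mul_right_comm, ← integral_const_mul]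
    refine integral_congr_ae (Eventually.of_forall fun x => ?_)
    simp only [hsymm y x]
    ring
  rw [h1, h2]
  exact integral_integral_swap hprod

end IntegralOperator

/-- The self-gravity operator `2 Ψ ∇⁻² Ψ` on `ℝ³`. -/
lemma exists_gravity_wholeSpace {Ψ : Space 3 → ℝ} (hΨ : Continuous Ψ)
    (hΨ2 : MemLp Ψ 2 volume) {C : ℝ} (hC : ∀ x, |Ψ x| ≤ C) :
    ∃ G : Lp ℂ 2 (volume : Measure (Space 3)) →L[ℂ] Lp ℂ 2 (volume : Measure (Space 3)),
      IsSelfAdjoint G ∧ IsCompactOperator G ∧ ∀ f, G f =ᵐ[volume] fun x =>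
        2 * (Ψ x : ℂ) * -∫ y, ((1 / (4 * Real.pi * ‖x - y‖) : ℝ) : ℂ) * ((Ψ y : ℂ) * f y) := by
  -- Majorant for the squared kernel: near the diagonal `‖z‖⁻²` is integrable in dimension three and
  -- `Ψ` is bounded; at distance at least `1` the Newtonian kernel is at most `1` and `Ψ²` is
  -- integrable.
  set h : Space 3 → ℝ := (Metric.ball (0 : Space 3) 1).indicator fun z => C ^ 2 * ‖z‖ ^ (-2 : ℝ)
    with hh
  have hhi : Integrable h volume := by
    rw [hh, integrable_indicator_iff Metric.isOpen_ball.measurableSet]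
    have h1 : LocallyIntegrable (fun z : Space 3 => C ^ 2 * ‖z‖ ^ (-2 : ℝ)) volume := by
      refine locallyIntegrable_of_norm_le_rpow (C := C ^ 2) (α := 2) (by simp) (by simp; norm_num)
        (Eventually.of_forall fun z => ?_) ?_
      · rw [Real.norm_of_nonneg (by positivity)]
      · exact Measurable.aestronglyMeasurable (by fun_prop)
    exact (h1.integrableOn_isCompact (isCompact_closedBall 0 1)).mono_set
      Metric.ball_subset_closedBall
  have hΨi : Integrable (fun y => Ψ y ^ 2) volume := hΨ2.integrable_sq
  have hdom : ∀ x y, (1 / (4 * Real.pi * ‖x - y‖) * Ψ y) ^ 2 ≤ h (y - x) + Ψ y ^ 2 := fun x y => by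
    have hpi : (1 : ℝ) ≤ 4 * Real.pi := by nlinarith [Real.pi_gt_three]
    by_cases hz : y - x ∈ Metric.ball (0 : Space 3) 1
    · rw [hh, Set.indicator_of_mem hz, mul_pow, norm_sub_rev, div_pow, one_pow, mul_pow,
        Real.rpow_neg (norm_nonneg _), show (2 : ℝ) = ((2 : ℕ) : ℝ) by norm_num, Real.rpow_natCast]
      have h1 : Ψ y ^ 2 ≤ C ^ 2 := sq_le_sq' (by linarith [neg_le_of_abs_le (hC y)])
        ((le_abs_self _).trans (hC y))
      have h2 : 1 / (((4 : ℝ) * Real.pi) ^ 2 * ‖y - x‖ ^ 2) ≤ (‖y - x‖ ^ 2)⁻¹ := by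
        rw [one_div, mul_inv]
        refine mul_le_of_le_one_left (by positivity) (inv_le_one_of_one_le₀ ?_)
        nlinarith
      calc _ ≤ (‖y - x‖ ^ 2)⁻¹ * C ^ 2 := by gcongr
        _ ≤ _ := by nlinarith [sq_nonneg (Ψ y)]
    · rw [hh, Set.indicator_of_notMem hz, zero_add, mul_pow]
      rw [mem_ball_zero_iff, not_lt, norm_sub_rev] at hz
      refine mul_le_of_le_one_left (by positivity) ?_
      rw [div_pow, one_pow]
      refine div_le_one_of_le₀ (one_le_pow₀ ?_) (by positivity)
      nlinarith
  have hdomi : ∀ x, Integrable (fun y => h (y - x) + Ψ y ^ 2) volume := fun x =>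
    (hhi.comp_sub_right x).add hΨi
  have hkm : Measurable (Function.uncurry fun x y : Space 3 => 1 / (4 * Real.pi * ‖x - y‖)) := by
    unfold Function.uncurry
    fun_prop
  have hq : ∀ x, Integrable (fun y => (1 / (4 * Real.pi * ‖x - y‖) * Ψ y) ^ 2) volume := fun x => by
    refine (hdomi x).mono' ?_ (Eventually.of_forall fun y => ?_)
    · have := hΨ.measurable
      exact Measurable.aestronglyMeasurable (by fun_prop)
    · rw [Real.norm_of_nonneg (sq_nonneg _)]
      exact hdom x y
  obtain ⟨G, hGs, hGc, hG⟩ := exists_symmetric_integralOperator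
    (k := fun x y : Space 3 => 1 / (4 * Real.pi * ‖x - y‖)) (p := Ψ)
    (n := (∫ z, h z) + ∫ y, Ψ y ^ 2) hkm (fun x y => by rw [norm_sub_rev]) hΨ.measurable hΨ2 hq
    (fun x => by
      refine (integral_mono (hq x) (hdomi x) (hdom x)).trans_eq ?_
      rw [integral_add (hhi.comp_sub_right x) hΨi, integral_sub_right_eq_self])
  refine ⟨((-2 : ℝ) : ℂ) • G, ?_, hGc.smul ((-2 : ℝ) : ℂ), fun f => ?_⟩
  · rw [isSelfAdjoint_iff, star_smul, hGs.star_eq]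
    simp
  · filter_upwards [hG f, Lp.coeFn_smul ((-2 : ℝ) : ℂ) (G f)] with x h1 h2
    rw [smul_apply, h2, Pi.smul_apply, h1, smul_eq_mul]
    push_cast; ring

/-! ### The maximum principle and trial functions of negative energy. -/

section NegativeEnergy

open scoped InnerProductSpace

variable {d : ℕ}

lemma laplacian_ofReal {f : Space d → ℝ} (hf : ContDiff ℝ 2 f) (x : Space d) :
    (Δ fun y => (f y : ℂ)) x = (((Δ f) x : ℝ) : ℂ) :=
  hf.contDiffAt.laplacian_CLM_comp_left (l := Complex.ofRealCLM)

lemma integral_mul_laplacian_real {u v : Space d → ℝ} (hu : ContDiff ℝ 2 u)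
    (hv : ContDiff ℝ 2 v) (hs : HasCompactSupport v) :
    ∫ x, u x * (Δ v) x = ∫ x, (Δ u) x * v x := by
  have h := integral_mul_laplacian_wholeSpace (Complex.ofRealCLM.contDiff.comp hu)
    (Complex.ofRealCLM.contDiff.comp hv) (hs.comp_left (g := Complex.ofRealCLM) (map_zero _))
  have hu' := laplacian_ofReal hu
  have hv' := laplacian_ofReal hv
  have e1 : (Δ (Complex.ofRealCLM ∘ u)) = fun x => (((Δ u) x : ℝ) : ℂ) := funext hu'
  have e2 : (Δ (Complex.ofRealCLM ∘ v)) = fun x => (((Δ v) x : ℝ) : ℂ) := funext hv'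
  rw [e1, e2] at h
  simp only [Function.comp_apply, Complex.ofRealCLM_apply, ← Complex.ofReal_mul] at h
  rw [integral_complex_ofReal, integral_complex_ofReal] at h
  exact_mod_cast h

lemma laplacian_comp_const_smul {F : Type*} [NormedAddCommGroup F] [NormedSpace ℝ F]
    {f : Space d → F} (hf : ContDiff ℝ 2 f) (a : ℝ) (x : Space d) :
    (Δ fun y => f (a • y)) x = a ^ 2 • (Δ f) (a • x) := by
  rw [laplacian_eq_sum_iteratedFDeriv, laplacian_eq_sum_iteratedFDeriv,
    iteratedFDeriv_comp_const_smul a hf, Finset.smul_sum]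
  simp

/-- At a maximum of `V + δ |x|²`, all unmixed second derivatives of `V` are at most `-2δ`. -/
lemma fderiv_fderiv_le_of_isLocalMax {V : Space d → ℝ} (hV : ContDiff ℝ 2 V) {δ : ℝ} {x : Space d}
    (hx : IsLocalMax (fun y => V y + δ * ‖y‖ ^ 2) x) (i : Fin d) :
    fderiv ℝ (fun y => fderiv ℝ V y (coordVec i)) x (coordVec i) ≤ -2 * δ := by
  set e : Space d := coordVec i with he
  have he1 : ‖e‖ = 1 := by simp [he, coordVec]
  set g : ℝ → ℝ := fun t => V (x + t • e) + δ * ‖x + t • e‖ ^ 2 with hg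
  have hline : ∀ t : ℝ, HasDerivAt (fun s : ℝ => x + s • e) e t := fun t => by
    simpa using ((hasDerivAt_id t).smul_const e).const_add x
  have hV1 : ContDiff ℝ 1 fun y => fderiv ℝ V y e :=
    (hV.fderiv_right (m := 1) (by norm_num)).clm_apply contDiff_const
  have hg1 : ∀ t, HasDerivAt g (fderiv ℝ V (x + t • e) e + δ * (2 * ⟪x, e⟫_ℝ + 2 * t)) t :=
    fun t => by
      have h1 : HasDerivAt (fun s : ℝ => V (x + s • e)) (fderiv ℝ V (x + t • e) e) t :=
        ((hV.differentiable (by norm_num) _).hasFDerivAt).comp_hasDerivAt t (hline t)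
      have h2 : ∀ s : ℝ, ‖x + s • e‖ ^ 2 = ‖x‖ ^ 2 + 2 * ⟪x, e⟫_ℝ * s + s ^ 2 := fun s => by
        rw [norm_add_sq_real, inner_smul_right, norm_smul, he1, mul_one, Real.norm_eq_abs, sq_abs]
        ring
      have h3 : HasDerivAt (fun s : ℝ => ‖x + s • e‖ ^ 2) (2 * ⟪x, e⟫_ℝ + 2 * t) t := by
        simp_rw [h2]
        have := (((hasDerivAt_id t).const_mul (2 * ⟪x, e⟫_ℝ)).const_add (‖x‖ ^ 2)).add
          ((hasDerivAt_id t).pow 2)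
        refine HasDerivAt.congr_deriv this ?_
        simp
      exact h1.add (h3.const_mul δ)
  have hdg : deriv g = fun t => fderiv ℝ V (x + t • e) e + δ * (2 * ⟪x, e⟫_ℝ + 2 * t) :=
    funext fun t => (hg1 t).deriv
  have hg2 : HasDerivAt (deriv g) (fderiv ℝ (fun y => fderiv ℝ V y e) x e + 2 * δ) 0 := by
    rw [hdg]
    have h0 : x + (0 : ℝ) • e = x := by simp
    have h1 : HasDerivAt (fun s : ℝ => fderiv ℝ V (x + s • e) e)
        (fderiv ℝ (fun y => fderiv ℝ V y e) x e) 0 := by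
      have hd : HasFDerivAt (fun y => fderiv ℝ V y e) (fderiv ℝ (fun y => fderiv ℝ V y e) x)
          (x + (0 : ℝ) • e) := by
        rw [h0]
        exact (hV1.differentiable (by norm_num) x).hasFDerivAt
      exact hd.comp_hasDerivAt (0 : ℝ) (hline 0)
    have h2 : HasDerivAt (fun s : ℝ => δ * (2 * ⟪x, e⟫_ℝ + 2 * s)) (2 * δ) 0 := by
      have := ((((hasDerivAt_id (0 : ℝ)).const_mul 2).const_add (2 * ⟪x, e⟫_ℝ)).const_mul δ)
      refine HasDerivAt.congr_deriv this ?_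
      ring
    exact h1.add h2
  have hmax : IsLocalMax g 0 := by
    have h0 : x + (0 : ℝ) • e = x := by simp
    have hx' : IsLocalMax (fun y => V y + δ * ‖y‖ ^ 2) (x + (0 : ℝ) • e) := by rwa [h0]
    exact hx'.comp_continuous (g := fun t : ℝ => x + t • e) (hline 0).continuousAt
  by_contra hcon
  push Not at hcon
  have hpos : 0 < deriv (deriv g) 0 := by rw [hg2.deriv]; linarith
  -- With a positive second derivative the local maximum is also a local minimum, so `g` is locally
  -- constant and its second derivative vanishes.
  have hmin := isLocalMin_of_deriv_deriv_pos hpos hmax.deriv_eq_zero (hg1 0).continuousAt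
  have hconst : g =ᶠ[𝓝 0] fun _ => g 0 := by
    filter_upwards [hmin, hmax] with t h1 h2 using le_antisymm h2 h1
  have hd0 : deriv (deriv g) 0 = 0 := by
    rw [hconst.deriv.deriv_eq]
    simp
  exact hpos.ne' hd0

/-- A subharmonic function vanishing at infinity is nonpositive. -/
lemma nonpos_of_laplacian_nonneg {V : Space 3 → ℝ} (hV : ContDiff ℝ 2 V)
    (hΔ : ∀ x, 0 ≤ (Δ V) x) (hV0 : Tendsto V (cocompact _) (𝓝 0)) (x : Space 3) : V x ≤ 0 := by
  by_contra hcon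
  push Not at hcon
  obtain ⟨s, hs, hsc⟩ := mem_cocompact.1 (hV0.eventually_lt_const (half_pos hcon))
  obtain ⟨r, hr⟩ := hs.isBounded.subset_closedBall (0 : Space 3)
  set ρ : ℝ := max r ‖x‖ + 1 with hρ
  have hρr : r < ρ := by rw [hρ]; linarith [le_max_left r ‖x‖]
  have hρx : ‖x‖ < ρ := by rw [hρ]; linarith [le_max_right r ‖x‖]
  have hρ0 : 0 < ρ := (norm_nonneg x).trans_lt hρx
  -- On the sphere of radius `ρ` the perturbation equals `V x / 2` and `V < V x / 2`, so the maximum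
  -- of `V + δ‖·‖²` over the ball is interior. There `ΔV ≤ -6δ < 0`, a contradiction.
  set δ : ℝ := V x / (2 * ρ ^ 2) with hδ
  have hδ0 : 0 < δ := by positivity
  have hδρ : δ * ρ ^ 2 = V x / 2 := by rw [hδ]; field_simp
  obtain ⟨y, hy, hymax⟩ := (isCompact_closedBall (0 : Space 3) ρ).exists_isMaxOn
    ⟨x, by simpa using hρx.le⟩ (f := fun y => V y + δ * ‖y‖ ^ 2)
    (hV.continuous.add (continuous_const.mul (continuous_norm.pow 2))).continuousOn
  have hyx : V x ≤ V y + δ * ‖y‖ ^ 2 := by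
    have : V x + δ * ‖x‖ ^ 2 ≤ V y + δ * ‖y‖ ^ 2 :=
      hymax (show x ∈ Metric.closedBall (0 : Space 3) ρ by simpa using hρx.le)
    nlinarith [sq_nonneg ‖x‖]
  rw [mem_closedBall_zero_iff] at hy
  have hyρ : ‖y‖ < ρ := by
    refine lt_of_le_of_ne hy fun heq => ?_
    have hys : y ∉ s := fun hys => by
      have := hr hys
      rw [mem_closedBall_zero_iff] at this
      linarith
    have h1 : V y < V x / 2 := hsc hys
    rw [heq, hδρ] at hyx
    linarith
  have hloc : IsLocalMax (fun y => V y + δ * ‖y‖ ^ 2) y :=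
    hymax.isLocalMax (Metric.closedBall_mem_nhds_of_mem (by simpa using hyρ))
  have h2 := hΔ y
  rw [laplacian_eq_sum_fderiv hV, Fin.sum_univ_three] at h2
  linarith [fderiv_fderiv_le_of_isLocalMax hV hloc 0, fderiv_fderiv_le_of_isLocalMax hV hloc 1,
    fderiv_fderiv_le_of_isLocalMax hV hloc 2]

/-- A nontrivial self-gravitating density on `ℝ³` binds: the potential well it creates supports
trial functions of negative energy. -/
lemma exists_negative_energy {V Ψ : Space 3 → ℝ} (hV : ContDiff ℝ 2 V) (hΨ : Continuous Ψ)
    (hP : ∀ x, (Δ V) x = Ψ x ^ 2) (hV0 : Tendsto V (cocompact _) (𝓝 0)) {x₀ : Space 3}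
    (hx₀ : Ψ x₀ ≠ 0) :
    ∃ φ : Space 3 → ℝ, ContDiff ℝ ∞ φ ∧ HasCompactSupport φ ∧
      ∫ x, φ x * (-(1 / 2) * (Δ φ) x + V x * φ x) < 0 := by
  have hVneg := nonpos_of_laplacian_nonneg hV (fun x => by rw [hP]; positivity) hV0
  let b : ContDiffBump (0 : Space 3) := ⟨1, 2, one_pos, one_lt_two⟩
  let b₂ : ContDiffBump (0 : Space 3) := ⟨2, 3, two_pos, by norm_num⟩
  have hb : ContDiff ℝ ∞ (b : Space 3 → ℝ) := b.contDiff
  have hb₂ : ContDiff ℝ ∞ (b₂ : Space 3 → ℝ) := b₂.contDiff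
  have hbΔ : Continuous (Δ (b : Space 3 → ℝ)) := continuous_laplacian (hb.of_le two_le_infty)
  have hbΔs : HasCompactSupport (Δ (b : Space 3 → ℝ)) :=
    hasCompactSupport_laplacian b.hasCompactSupport
  obtain ⟨C, hC⟩ := hbΔs.exists_bound_of_continuous hbΔ
  set K : ℝ := ∫ x, b₂ x * (Δ (b₂ : Space 3 → ℝ)) x with hK
  have hscale : ∀ {c : ContDiffBump (0 : Space 3)} {R : ℝ}, 0 < R →
      HasCompactSupport fun x => c (R⁻¹ • x) := fun {c R} hR =>
    c.hasCompactSupport.comp_smul (inv_ne_zero hR.ne')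
  have hsmooth : ∀ (c : ContDiffBump (0 : Space 3)) (R : ℝ),
      ContDiff ℝ ∞ fun x : Space 3 => c (R⁻¹ • x) := fun c R =>
    c.contDiff.comp (contDiff_const_smul _)
  have hΔscale : ∀ (c : ContDiffBump (0 : Space 3)) (R : ℝ) (x : Space 3),
      (Δ fun x : Space 3 => c (R⁻¹ • x)) x = R⁻¹ ^ 2 * (Δ (c : Space 3 → ℝ)) (R⁻¹ • x) :=
    fun c R x => laplacian_comp_const_smul (c.contDiff.of_le two_le_infty) _ _
  have hC0 : 0 ≤ C := (norm_nonneg _).trans (hC 0)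
  set R₀ : ℝ := ‖x₀‖ + 1 with hR₀
  have hR₀0 : 0 < R₀ := by positivity
  set m : ℝ := ∫ x, Ψ x ^ 2 * b (R₀⁻¹ • x) with hm
  have hmint : ∀ {R : ℝ}, 0 < R → Integrable fun x => Ψ x ^ 2 * b (R⁻¹ • x) := fun {R} hR =>
    ((hΨ.pow 2).mul (hsmooth b R).continuous).integrable_of_hasCompactSupport (hscale hR).mul_left
  have hm0 : 0 < m := by
    refine Continuous.integral_pos_of_hasCompactSupport_nonneg_nonzero (x := x₀)
      ((hΨ.pow 2).mul (hsmooth b R₀).continuous) (hscale hR₀0).mul_left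
      (fun x => mul_nonneg (sq_nonneg _) b.nonneg) ?_
    have h1 : b (R₀⁻¹ • x₀) = 1 := by
      refine b.one_of_mem_closedBall ?_
      rw [mem_closedBall_zero_iff, norm_smul, norm_inv, Real.norm_of_nonneg hR₀0.le,
        inv_mul_le_iff₀ hR₀0]
      change ‖x₀‖ ≤ R₀ * 1
      rw [hR₀]; linarith
    change Ψ x₀ ^ 2 * b (R₀⁻¹ • x₀) ≠ 0
    rw [h1, mul_one]
    positivity
  -- Kinetic energy scales like `R` and the potential energy is at most `-R²m`, so a large `R` wins.
  -- The bound `2R₀ ≤ R` makes `b(·/R) = 1` on the support of `b(·/R₀)`, so that the enclosed mass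
  -- is at least `m`.
  obtain ⟨R, hR1, hR2⟩ : ∃ R : ℝ, 2 * R₀ ≤ R ∧ |K| * C < R * m := by
    refine ⟨max (2 * R₀) (|K| * C / m + 1), le_max_left _ _, ?_⟩
    calc |K| * C = |K| * C / m * m := by field_simp
      _ < (|K| * C / m + 1) * m := by nlinarith
      _ ≤ _ := by gcongr; exact le_max_right _ _
  have hR : 0 < R := by linarith
  have hnormR : ∀ x : Space 3, ‖R⁻¹ • x‖ = R⁻¹ * ‖x‖ := fun x => by
    rw [norm_smul, norm_inv, Real.norm_of_nonneg hR.le]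
  -- The amplitude makes `C b₂²` dominate `-Δb`, as `b₂ = 1` on the support of `b`. Since `V ≤ 0`,
  -- the potential energy is at most `-R² ∫ V Δ(b(·/R))`, which Green's identity turns into `-R² ∫
  -- Ψ² b(·/R)`.
  refine ⟨fun x => Real.sqrt C * b₂ (R⁻¹ • x), contDiff_const.mul (hsmooth b₂ R),
    (hscale hR).mul_left, ?_⟩
  have hΔφ : ∀ x : Space 3, (Δ fun x : Space 3 => Real.sqrt C * b₂ (R⁻¹ • x)) x =
      Real.sqrt C * (R⁻¹ ^ 2 * (Δ (b₂ : Space 3 → ℝ)) (R⁻¹ • x)) := fun x => by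
    rw [← hΔscale]
    exact InnerProductSpace.laplacian_smul (Real.sqrt C)
      ((hsmooth b₂ R).of_le two_le_infty).contDiffAt
  have hkin : ∫ x, b₂ (R⁻¹ • x) * (Δ (b₂ : Space 3 → ℝ)) (R⁻¹ • x) = R ^ 3 * K := by
    refine (Measure.integral_comp_inv_smul_of_nonneg volume
      (fun x => b₂ x * (Δ (b₂ : Space 3 → ℝ)) x) hR.le).trans ?_
    simp [hK]
  have hb₂Δ : Continuous (Δ (b₂ : Space 3 → ℝ)) := continuous_laplacian (hb₂.of_le two_le_infty)
  have hi1 : Integrable fun x => b₂ (R⁻¹ • x) * (Δ (b₂ : Space 3 → ℝ)) (R⁻¹ • x) :=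
    Continuous.integrable_of_hasCompactSupport
      ((hsmooth b₂ R).continuous.mul (hb₂Δ.comp (continuous_const_smul _))) (hscale hR).mul_right
  have hi2 : Integrable fun x => V x * (C * b₂ (R⁻¹ • x) ^ 2) := by
    refine (hV.continuous.mul (continuous_const.mul
      ((hsmooth b₂ R).continuous.pow 2))).integrable_of_hasCompactSupport ?_
    have : HasCompactSupport fun x => b₂ (R⁻¹ • x) * b₂ (R⁻¹ • x) := (hscale hR).mul_left
    have h2 : HasCompactSupport fun x => C * b₂ (R⁻¹ • x) ^ 2 := by
      simp_rw [sq]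
      exact this.mul_left
    exact h2.mul_left
  have hbR : ContDiff ℝ 2 fun x : Space 3 => b (R⁻¹ • x) := (hsmooth b R).of_le two_le_infty
  have hpot : ∫ x, V x * (C * b₂ (R⁻¹ • x) ^ 2) ≤ -(R ^ 2 * m) := by
    have h1 : ∫ x, V x * (C * b₂ (R⁻¹ • x) ^ 2) ≤
        ∫ x, -(R ^ 2) * (V x * (Δ fun x : Space 3 => b (R⁻¹ • x)) x) := by
      refine integral_mono hi2 ?_ fun x => ?_
      · refine Integrable.const_mul ?_ _
        exact (hV.continuous.mul (continuous_laplacian hbR)).integrable_of_hasCompactSupport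
          (hasCompactSupport_laplacian (hscale hR)).mul_left
      · simp only
        have hcancel : -R ^ 2 * (V x * (R⁻¹ ^ 2 * (Δ (b : Space 3 → ℝ)) (R⁻¹ • x))) =
          V x * -(Δ (b : Space 3 → ℝ)) (R⁻¹ • x) := by field_simp
        rw [hΔscale, hcancel]
        refine mul_le_mul_of_nonpos_left ?_ (hVneg x)
        by_cases hx : R⁻¹ • x ∈ Metric.closedBall (0 : Space 3) 2
        · rw [b₂.one_of_mem_closedBall hx]
          have := hC (R⁻¹ • x)
          rw [Real.norm_eq_abs] at this
          linarith [neg_abs_le ((Δ (b : Space 3 → ℝ)) (R⁻¹ • x))]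
        · have h0 : (Δ (b : Space 3 → ℝ)) (R⁻¹ • x) = 0 := by
            have hnot : R⁻¹ • x ∉ tsupport (b : Space 3 → ℝ) := by rwa [b.tsupport_eq]
            rw [notMem_tsupport_iff_eventuallyEq] at hnot
            rw [(InnerProductSpace.laplacian_congr_nhds hnot).self_of_nhds]
            simp [laplacian_eq_sum_iteratedFDeriv]
          rw [h0, neg_zero]
          positivity
    refine h1.trans ?_
    rw [integral_const_mul, integral_mul_laplacian_real hV hbR (hscale hR)]
    simp_rw [hP]
    have h2 : m ≤ ∫ x, Ψ x ^ 2 * b (R⁻¹ • x) := by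
      refine integral_mono (hmint hR₀0) (hmint hR) fun x => ?_
      refine mul_le_mul_of_nonneg_left ?_ (sq_nonneg _)
      by_cases hx : ‖x‖ ≤ 2 * R₀
      · rw [b.one_of_mem_closedBall (x := R⁻¹ • x)]
        · exact b.le_one
        · rw [mem_closedBall_zero_iff, hnormR, inv_mul_le_iff₀ hR]
          change ‖x‖ ≤ R * 1
          linarith
      · rw [b.zero_of_le_dist (x := R₀⁻¹ • x)]
        · exact b.nonneg
        · rw [dist_zero_right, norm_smul, norm_inv, Real.norm_of_nonneg hR₀0.le,
            le_inv_mul_iff₀ hR₀0]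
          change R₀ * 2 ≤ ‖x‖
          linarith
    nlinarith [sq_nonneg R]
  have hsplit : ∫ x, (Real.sqrt C * b₂ (R⁻¹ • x)) *
      (-(1 / 2) * (Δ fun x : Space 3 => Real.sqrt C * b₂ (R⁻¹ • x)) x +
        V x * (Real.sqrt C * b₂ (R⁻¹ • x))) =
      -(1 / 2) * C * R⁻¹ ^ 2 * (R ^ 3 * K) + ∫ x, V x * (C * b₂ (R⁻¹ • x) ^ 2) := by
    rw [← hkin, ← integral_const_mul, ← integral_add (hi1.const_mul _) hi2]
    refine integral_congr_ae (Eventually.of_forall fun x => ?_)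
    simp only
    rw [hΔφ]
    have := Real.mul_self_sqrt hC0
    linear_combination (b₂ (R⁻¹ • x) * (-(1 / 2) * (R⁻¹ ^ 2 * (Δ (b₂ : Space 3 → ℝ)) (R⁻¹ • x)) +
      V x * b₂ (R⁻¹ • x))) * this
  rw [hsplit]
  have h3 : -(1 / 2) * C * R⁻¹ ^ 2 * (R ^ 3 * K) = R * (-(1 / 2) * (K * C)) := by field_simp
  rw [h3]
  have h4 : -(1 / 2) * (K * C) ≤ |K| * C := by
    nlinarith [neg_abs_le K, abs_nonneg K, mul_nonneg (abs_nonneg K) hC0]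
  nlinarith [mul_lt_mul_of_pos_left hR2 hR]

end NegativeEnergy

/-! ### Potentials in weak equations. -/

section WeakForm

variable {α : Type*} [MeasurableSpace α] {μ : Measure α}

/-- A bounded potential may be moved to the right-hand side of a weak equation. -/
lemma integral_potential_iff {W : Lp ℂ 2 μ →L[ℂ] Lp ℂ 2 μ} {w : α → ℝ}
    (hW : ∀ f, W f =ᵐ[μ] fun x => (w x : ℂ) * f x) (f g : Lp ℂ 2 μ) {k φ : α → ℂ}
    (hk : MemLp k 2 μ) (hφ : MemLp φ 2 μ) :
    ∫ x, f x * (-(1 / 2) * k x + (w x : ℂ) * φ x) ∂μ = ∫ x, g x * φ x ∂μ ↔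
      ∫ x, f x * (-(1 / 2) * k x + φ x) ∂μ = ∫ x, (g + f - W f : Lp ℂ 2 μ) x * φ x ∂μ := by
  have h1 : Integrable (fun x => f x * (-(1 / 2) * k x)) μ :=
    (Lp.memLp f).integrable_mul (hk.const_mul _)
  have h2 : Integrable (fun x => f x * φ x) μ := (Lp.memLp f).integrable_mul hφ
  have h3 : Integrable (fun x => (W f) x * φ x) μ := (Lp.memLp _).integrable_mul hφ
  have h4 : Integrable (fun x => g x * φ x) μ := (Lp.memLp g).integrable_mul hφ
  have e1 : ∫ x, f x * (-(1 / 2) * k x + (w x : ℂ) * φ x) ∂μ =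
      ∫ x, f x * (-(1 / 2) * k x) ∂μ + ∫ x, (W f) x * φ x ∂μ := by
    rw [← integral_add h1 h3]
    refine integral_congr_ae ?_
    filter_upwards [hW f] with x hx
    rw [hx]; ring
  have e2 : ∫ x, f x * (-(1 / 2) * k x + φ x) ∂μ =
      ∫ x, f x * (-(1 / 2) * k x) ∂μ + ∫ x, f x * φ x ∂μ := by
    rw [← integral_add h1 h2]
    simp_rw [mul_add]
  have e3 : ∫ x, (g + f - W f : Lp ℂ 2 μ) x * φ x ∂μ =
      ∫ x, g x * φ x ∂μ + ∫ x, f x * φ x ∂μ - ∫ x, (W f) x * φ x ∂μ := by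
    rw [integral_sub_mul _ _ hφ, ← integral_add h4 h2]
    congr 1
    refine integral_congr_ae ?_
    filter_upwards [Lp.coeFn_add g f] with x hx
    rw [hx, Pi.add_apply, add_mul]
  rw [e1, e2, e3]
  constructor <;> intro h <;> linear_combination h

end WeakForm

/-- An equilibrium wave function is a zero mode of its Hamiltonian as soon as Green's identity holds
for test functions. -/
lemma Equilibrium.hamiltonianEq_zero {d : ℕ} {D : Domain d} (bg : Equilibrium D) {ψ : D.L2}
    (hψ : ψ =ᵐ[D.measure] fun x => (bg.Ψ x : ℂ))
    (hgreen : ∀ φ, D.IsTest φ → ∫ x, ((bg.Ψ x : ℂ) * (Δ φ) x -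
      φ x * (Δ fun y => (bg.Ψ y : ℂ)) x) ∂D.measure = 0) : bg.HamiltonianEq ψ 0 := by
  intro φ hφ
  have h1 : ∫ x, ψ x * (-(1 / 2) * (Δ φ) x + ((bg.V x - bg.E : ℝ) : ℂ) * φ x) ∂D.measure =
      ∫ x, -(1 / 2) * ((bg.Ψ x : ℂ) * (Δ φ) x - φ x * (Δ fun y => (bg.Ψ y : ℂ)) x) ∂D.measure := by
    refine integral_congr_ae ?_
    filter_upwards [hψ] with x hx
    have h2 := congrArg (fun r : ℝ => (r : ℂ)) (bg.schrodinger x)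
    push_cast at h2
    rw [hx, laplacian_ofReal bg.contDiff_Ψ]
    push_cast
    linear_combination -φ x * h2
  have h0 : ∫ x, (0 : D.L2) x * φ x ∂D.measure = 0 := by
    rw [← integral_zero (α := Space d) (G := ℂ) (μ := D.measure)]
    refine integral_congr_ae ?_
    filter_upwards [Lp.coeFn_zero ℂ 2 D.measure] with x hx
    rw [hx, Pi.zero_apply, zero_mul]
  rw [h1, h0, integral_const_mul, hgreen φ hφ, mul_zero]

/-! ### Transfer of the abstract spectral theorem to relations `Ham` and `Grav`. -/

section Spectrum

variable {X : Type*} [NormedAddCommGroup X] [InnerProductSpace ℂ X] [CompleteSpace X]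

/-- The operator-theoretic content of the variational principle. -/
lemma exists_isLeast_eigenvalue {Ham Grav : X → X → Prop} {B B₀ G : X →L[ℂ] X} {c m : ℝ}
    (hHam : ∀ f g, Ham f g ↔ InvEq B c f g) (hGrav : ∀ f g, Grav f g ↔ g = G f)
    (hB : B.IsPositive) (hBinj : ∀ x, B x = 0 → x = 0) (hc : 0 < c) (hm : m ≤ 1 / c)
    (hB₀ : ∀ x, (inner ℂ (B₀ x) x).re ≤ m * ‖x‖ ^ 2) (hC : IsCompactOperator (B - B₀))
    (hG : IsSelfAdjoint G) (hGc : IsCompactOperator G)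
    (heig : ∀ (e : ℝ) (f : X), f ≠ 0 → Ham f ((e : ℂ) • f) → 0 ≤ e)
    {ψ : X} (hψ : ψ ≠ 0) (hψ0 : Ham ψ 0) :
    (∀ z : ℂ, (∃ η R, η ≠ 0 ∧ Ham η R ∧ ∃ a b, Ham R a ∧ Grav R b ∧ z • η = a + b) → z.im = 0) ∧
    ∃ w : ℝ, IsLeast {z : ℝ | ∃ η R, η ≠ 0 ∧ Ham η R ∧
        ∃ a b, Ham R a ∧ Grav R b ∧ (z : ℂ) • η = a + b} w ∧
      (∀ η R S T, Ham η R → (∃ a b, Ham R a ∧ Grav R b ∧ S = a + b) → Ham S T →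
        0 < (inner ℂ η R).re → w ≤ (inner ℂ η T).re / (inner ℂ η R).re) ∧
      (∀ η R S, Ham η R → (∃ a b, Ham R a ∧ Grav R b ∧ S = a + b) →
        0 < (inner ℂ η R).re → w ≤ (inner ℂ R S).re / (inner ℂ η R).re) := by
  simp only [hHam, hGrav] at heig hψ0 ⊢
  obtain ⟨h1, w, ⟨η₀, R₀, a₀, h2⟩, h3, h4⟩ :=
    pencil_lowest_eigenvalue hB hBinj hc hm hB₀ hC hG hGc heig hψ hψ0
  have h5 : ∀ η R S, InvEq B c η R → (∃ a b, InvEq B c R a ∧ b = G R ∧ S = a + b) →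
      0 < (inner ℂ η R).re → w ≤ (inner ℂ R S).re / (inner ℂ η R).re := by
    rintro η R S hη ⟨a, b, ha, rfl, rfl⟩ hpos
    exact h4 η R a hη ha hpos
  refine ⟨?_, w, ⟨⟨η₀, R₀, h2.1, h2.2.1, a₀, G R₀, h2.2.2.1, rfl, h2.2.2.2⟩, ?_⟩, ?_, h5⟩
  · rintro z ⟨η, R, hη, hR, a, b, ha, rfl, hz⟩
    exact h1 z η R a hη hR ha hz
  · rintro z ⟨η, R, hη, hR, a, b, ha, rfl, hz⟩
    exact h3 z η R a hη hR ha hz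
  · intro η R S T hη hS hT hpos
    -- Symmetry of `Ĥ` turns `⟨η|ĤS⟩` into `⟨Ĥη|S⟩`.
    rw [← hη.inner_symm hB hT]
    exact h5 η R S hη hS hpos

end Spectrum

lemma exists_bound_of_tendsto_cocompact {E : Type*} [TopologicalSpace E] {f : E → ℝ}
    (hf : Continuous f) (h0 : Tendsto f (cocompact E) (𝓝 0)) : ∃ C, 0 ≤ C ∧ ∀ x, |f x| ≤ C := by
  have h1 := h0.norm
  rw [norm_zero] at h1
  obtain ⟨s, hs, hsc⟩ := mem_cocompact.1 (h1.eventually_lt_const one_pos)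
  obtain ⟨C, hC⟩ := hs.exists_bound_of_continuousOn hf.continuousOn
  refine ⟨max C 1, zero_le_one.trans (le_max_right _ _), fun x => ?_⟩
  by_cases hx : x ∈ s
  · exact (hC x hx).trans (le_max_left _ _)
  · exact (hsc hx : ‖f x‖ < 1).le.trans (le_max_right _ _)

/-! ### Isolated equilibria on `ℝ³`. -/

section WholeSpace

open scoped SchwartzMap

-- With `F = (1 - ∇²/2)φ`, the vector `F - f₀ + T f₀` is `(-∇²/2 + V)φ`, and its pairing with `φ` is
-- the negative energy of the trial function.
set_option maxHeartbeats 1000000 in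
lemma exists_negative_eigenvalue_wholeSpace
    {A T : Lp ℂ 2 (volume : Measure (Space 3)) →L[ℂ] Lp ℂ 2 (volume : Measure (Space 3))}
    (hA : A.IsPositive) (hAinj : ∀ f, A f = 0 → f = 0) (hA1 : (1 - A).IsPositive)
    (hAS : ∀ φ : 𝓢(Space 3, ℂ), A ((φ - (1 / 2 : ℂ) • Δ φ).toLp 2) = φ.toLp 2)
    {V Ψ : Space 3 → ℝ} (hT : ∀ f, T f =ᵐ[volume] fun x => (V x : ℂ) * f x)
    (hTA : IsCompactOperator (T * A)) (hV : ContDiff ℝ 2 V) (hΨ : Continuous Ψ)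
    (hP : ∀ x, (Δ V) x = Ψ x ^ 2) (hV0 : Tendsto V (cocompact _) (𝓝 0)) {x₀ : Space 3}
    (hx₀ : Ψ x₀ ≠ 0) : ∃ e < (0 : ℝ), ∃ f ≠ 0, f = A ((e : ℂ) • f + f - T f) := by
  obtain ⟨φ, hφ, hφs, hneg⟩ := exists_negative_energy hV hΨ hP hV0 hx₀
  have hφs' : HasCompactSupport fun x => (φ x : ℂ) := hφs.comp_left Complex.ofReal_zero
  have hφ' : ContDiff ℝ ∞ fun x => (φ x : ℂ) := Complex.ofRealCLM.contDiff.comp hφ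
  obtain ⟨χ, hχ⟩ : ∃ χ : 𝓢(Space 3, ℂ), ∀ x, χ x = φ x := ⟨hφs'.toSchwartzMap hφ', fun x => rfl⟩
  have hΔχ : ∀ x, (χ - (1 / 2 : ℂ) • Δ χ) x = φ x - (1 / 2) * ((Δ φ) x : ℝ) := fun x => by
    rw [sub_apply, smul_apply, SchwartzMap.laplacian_apply, show ((χ : Space 3 → ℂ)) =
      fun x => (φ x : ℂ) from funext hχ, laplacian_ofReal (hφ.of_le two_le_infty), smul_eq_mul]
  obtain ⟨f₀, F, hf₀, hF, hAF⟩ : ∃ f₀ F : Lp ℂ 2 (volume : Measure (Space 3)),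
      (f₀ =ᵐ[volume] fun x => (φ x : ℂ)) ∧
      (F =ᵐ[volume] fun x => (φ x : ℂ) - (1 / 2) * ((Δ φ) x : ℝ)) ∧ A F = f₀ := by
    refine ⟨χ.toLp 2, (χ - (1 / 2 : ℂ) • Δ χ).toLp 2, ?_, ?_, hAS χ⟩
    · filter_upwards [χ.coeFn_toLp 2 volume] with x hx
      rw [hx, hχ]
    · filter_upwards [(χ - (1 / 2 : ℂ) • Δ χ).coeFn_toLp 2 volume] with x hx
      rw [hx, hΔχ]
  refine exists_negative_eigenvalue hA hAinj hA1 (mulL2_isSelfAdjoint hT) hTA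
    (f₀ := f₀) (g₀ := F - f₀ + T f₀) ?_ ?_
  · rw [sub_add_eq_add_sub, sub_add_cancel, add_sub_cancel_right, hAF]
  · have h1 : inner ℂ f₀ (F - f₀ + T f₀) =
        ∫ x, ((φ x * (-(1 / 2) * (Δ φ) x + V x * φ x) : ℝ) : ℂ) := by
      rw [L2.inner_def]
      refine integral_congr_ae ?_
      filter_upwards [hf₀, hF, hT f₀, Lp.coeFn_add (F - f₀) (T f₀), Lp.coeFn_sub F f₀] with
        x e1 e2 e3 e4 e5
      rw [e4, Pi.add_apply, e5, Pi.sub_apply, e3, e1, e2]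
      simp only [RCLike.inner_apply, Complex.conj_ofReal]
      push_cast; ring
    rw [h1, integral_complex_ofReal, Complex.ofReal_re]
    exact hneg

/-- `ℝ³` has infinite volume, whose real value defaults to `0`; the average therefore vanishes and
`Λ = 0`. -/
lemma Equilibrium.density_wholeSpace (bg : Equilibrium Domain.wholeSpace) (x : Space 3) :
    (Δ bg.V) x = bg.Ψ x ^ 2 := by
  have h : bg.Λ = 0 := by
    rw [bg.mean_density]
    change ⨍ x, |bg.Ψ x| ^ 2 ∂(volume : Measure (Space 3)) = 0
    rw [average_eq, Measure.real, measure_univ_of_isAddLeftInvariant]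
    simp
  rw [bg.poisson, h, sub_zero, sq_abs]

lemma Equilibrium.hamiltonianEq_iff_wholeSpace (bg : Equilibrium Domain.wholeSpace)
    {A T : Lp ℂ 2 (volume : Measure (Space 3)) →L[ℂ] Lp ℂ 2 (volume : Measure (Space 3))}
    (hA : A.IsPositive)
    (hAS : ∀ φ : 𝓢(Space 3, ℂ), A ((φ - (1 / 2 : ℂ) • Δ φ).toLp 2) = φ.toLp 2)
    (hT : ∀ f, T f =ᵐ[volume] fun x => (bg.V x : ℂ) * f x)
    (f g : Lp ℂ 2 (volume : Measure (Space 3))) :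
    bg.HamiltonianEq f g ↔ f = A (g + f - (T f - (bg.E : ℂ) • f)) := by
  have hW : ∀ f, (T - (bg.E : ℂ) • 1 : Lp ℂ 2 (volume : Measure (Space 3)) →L[ℂ]
      Lp ℂ 2 (volume : Measure (Space 3))) f =ᵐ[volume]
      fun x => ((bg.V x - bg.E : ℝ) : ℂ) * f x := fun f => by
    filter_upwards [hT f, Lp.coeFn_sub (T f) ((bg.E : ℂ) • f), Lp.coeFn_smul (bg.E : ℂ) f] with
      x h1 h2 h3
    rw [sub_apply, smul_apply, one_apply_eq_self, h2, Pi.sub_apply, h1, h3, Pi.smul_apply,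
      smul_eq_mul]
    push_cast; ring
  rw [← weak_iff_eq_kineticResolvent hA hAS]
  have key : ∀ φ : Space 3 → ℂ, ContDiff ℝ ∞ φ → HasCompactSupport φ →
      (∫ x, f x * (-(1 / 2) * (Δ φ) x + ((bg.V x - bg.E : ℝ) : ℂ) * φ x) = ∫ x, g x * φ x ↔
      ∫ x, f x * (-(1 / 2) * (Δ φ) x + φ x) =
        ∫ x, (g + f - (T f - (bg.E : ℂ) • f) : Lp ℂ 2 (volume : Measure (Space 3))) x * φ x) :=
    fun φ hφ hs => integral_potential_iff hW f g
      (memLp_of_continuous_hasCompactSupport (continuous_laplacian (hφ.of_le two_le_infty))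
        (hasCompactSupport_laplacian hs))
      (memLp_of_continuous_hasCompactSupport hφ.continuous hs)
  exact ⟨fun h φ hφ hs => (key φ hφ hs).1 (h φ ⟨hφ, hs⟩),
    fun h φ hφ => (key φ hφ.1 hφ.2).2 (h φ hφ.1 hφ.2)⟩

lemma Equilibrium.hamiltonianEq_zero_wholeSpace (bg : Equilibrium Domain.wholeSpace)
    {ψ : Lp ℂ 2 (volume : Measure (Space 3))} (hψ : ψ =ᵐ[volume] fun x => (bg.Ψ x : ℂ)) :
    bg.HamiltonianEq ψ 0 := by
  refine bg.hamiltonianEq_zero hψ fun φ hφ => ?_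
  obtain ⟨hφ, hs⟩ : ContDiff ℝ ∞ φ ∧ HasCompactSupport φ := hφ
  have hφ2 : ContDiff ℝ 2 φ := hφ.of_le two_le_infty
  have hΨ' : ContDiff ℝ 2 fun x => (bg.Ψ x : ℂ) := Complex.ofRealCLM.contDiff.comp bg.contDiff_Ψ
  change ∫ x, ((bg.Ψ x : ℂ) * (Δ φ) x - φ x * (Δ fun y => (bg.Ψ y : ℂ)) x) = 0
  rw [integral_sub, integral_mul_laplacian_wholeSpace hΨ' hφ2 hs, sub_eq_zero]
  · simp_rw [mul_comm]
  · exact (hΨ'.continuous.mul (continuous_laplacian hφ2)).integrable_of_hasCompactSupport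
      (hasCompactSupport_laplacian hs).mul_left
  · exact (hφ.continuous.mul (continuous_laplacian hΨ')).integrable_of_hasCompactSupport
      hs.mul_right

lemma Equilibrium.gravityEq_iff_wholeSpace (bg : Equilibrium Domain.wholeSpace)
    {G : Lp ℂ 2 (volume : Measure (Space 3)) →L[ℂ] Lp ℂ 2 (volume : Measure (Space 3))}
    (hG : ∀ f, G f =ᵐ[volume] fun x => 2 * (bg.Ψ x : ℂ) *
      -∫ y, ((1 / (4 * Real.pi * ‖x - y‖) : ℝ) : ℂ) * ((bg.Ψ y : ℂ) * f y))
    (f g : Lp ℂ 2 (volume : Measure (Space 3))) : bg.GravityEq f g ↔ g = G f := by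
  constructor
  · rintro ⟨u, hu, hgu⟩
    refine Lp.ext (EventuallyEq.trans hgu ?_)
    filter_upwards [hG f] with x h2
    exact (congrArg (fun z => 2 * (bg.Ψ x : ℂ) * z) (hu x)).trans h2.symm
  · rintro rfl
    exact ⟨_, fun x => rfl, hG f⟩

set_option maxHeartbeats 1000000 in
/-- On `ℝ³` the hypothesis that `Ψ` is the ground state forces the eigenenergy to be negative. -/
lemma Equilibrium.exists_operators_wholeSpace (bg : Equilibrium Domain.wholeSpace)
    (hbg : bg.IsGroundState) :
    ∃ (B B₀ G : Lp ℂ 2 (volume : Measure (Space 3)) →L[ℂ] Lp ℂ 2 (volume : Measure (Space 3)))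
      (c m : ℝ) (ψ : Lp ℂ 2 (volume : Measure (Space 3))),
      (∀ f g, bg.HamiltonianEq f g ↔ InvEq B c f g) ∧ (∀ f g, bg.GravityEq f g ↔ g = G f) ∧
      B.IsPositive ∧ (∀ x, B x = 0 → x = 0) ∧ 0 < c ∧ m ≤ 1 / c ∧
      (∀ x, (inner ℂ (B₀ x) x).re ≤ m * ‖x‖ ^ 2) ∧ IsCompactOperator (B - B₀) ∧
      IsSelfAdjoint G ∧ IsCompactOperator G ∧
      (∀ (e : ℝ) (f : Lp ℂ 2 (volume : Measure (Space 3))), f ≠ 0 →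
        bg.HamiltonianEq f ((e : ℂ) • f) → 0 ≤ e) ∧ ψ ≠ 0 ∧
      bg.HamiltonianEq ψ 0 := by
  obtain ⟨hΨ2, hΨ0, hV0⟩ : MemLp bg.Ψ 2 volume ∧ Tendsto bg.Ψ (cocompact _) (𝓝 0) ∧
    Tendsto bg.V (cocompact _) (𝓝 0) := bg.boundary
  have hVc := bg.contDiff_V.continuous
  have hΨc := bg.contDiff_Ψ.continuous
  obtain ⟨CΨ, -, hCΨ⟩ := exists_bound_of_tendsto_cocompact hΨc hΨ0
  obtain ⟨CV, hCV0, hCV⟩ := exists_bound_of_tendsto_cocompact hVc hV0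
  obtain ⟨A, M, hM, hAM, hA, hA1, hAinj, hAS⟩ := exists_kineticResolvent 3
  obtain ⟨T, hT, -⟩ := exists_mulL2 (μ := (volume : Measure (Space 3)))
    (w := fun x => (bg.V x : ℂ)) (Complex.continuous_ofReal.comp hVc).aestronglyMeasurable hCV0
    (fun x => by rw [Complex.norm_real]; exact hCV x)
  have hTA : IsCompactOperator (T * A) := isCompactOperator_mul_kineticResolvent hM hAM hVc hV0 hT
  obtain ⟨G, hG, hGc, hGf⟩ := exists_gravity_wholeSpace hΨc hΨ2 hCΨ
  obtain ⟨c, hc, hcE, B, B₀, hB, hBinj, hBA, hB₀, hC⟩ :=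
    exists_resolvent_of_relativelyCompact hA hAinj hA1 (mulL2_isSelfAdjoint hT) hTA bg.E
  have hHam := bg.hamiltonianEq_iff_wholeSpace hA hAS hT
  obtain ⟨ψ, hψ, hψΨ, e₀, he₀, hmin⟩ : ∃ ψ : Lp ℂ 2 (volume : Measure (Space 3)), ψ ≠ 0 ∧
      (ψ =ᵐ[volume] fun x => (bg.Ψ x : ℂ)) ∧ ∃ e : ℝ, bg.HamiltonianEq ψ ((e : ℂ) • ψ) ∧
      ∀ (e' : ℝ) (f : Lp ℂ 2 (volume : Measure (Space 3))), f ≠ 0 →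
        bg.HamiltonianEq f ((e' : ℂ) • f) → e ≤ e' := hbg
  have hψ0 := bg.hamiltonianEq_zero_wholeSpace hψΨ
  have hH : ∀ f g, bg.HamiltonianEq f g ↔ InvEq B c f g := fun f g =>
    (hHam f g).trans (hBA f g).symm
  -- The Schrödinger equation says `ĤΨ = 0`, so the lowest eigenvalue of `Ĥ` is `0`.
  have he0 : e₀ = 0 := by
    have h1 := InvEq.unique hBinj ((hH _ _).1 he₀) ((hH _ _).1 hψ0)
    exact Complex.ofReal_eq_zero.1 ((smul_eq_zero.1 h1).resolve_right hψ)
  -- A negative eigenvalue `e` of `-∇²/2 + V` is the eigenvalue `e - E ≥ 0` of `Ĥ`. Hence `E ≤ e <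
  -- 0`, and the bound `1/(c - E)` for `B₀` lies below `1/c`.
  have hE : bg.E < 0 := by
    obtain ⟨x₀, hx₀⟩ : ∃ x, bg.Ψ x ≠ 0 := by
      by_contra! hcon
      refine hψ (Lp.ext ?_)
      filter_upwards [hψΨ, Lp.coeFn_zero ℂ 2 (volume : Measure (Space 3))] with x h1 h2
      rw [h1, h2, hcon x]; rfl
    obtain ⟨e, he, f, hf, hfe⟩ := exists_negative_eigenvalue_wholeSpace hA hAinj hA1 hAS hT hTA
      bg.contDiff_V hΨc bg.density_wholeSpace hV0 hx₀
    have h2 : ((e - bg.E : ℝ) : ℂ) • f + f - (T f - (bg.E : ℂ) • f) = (e : ℂ) • f + f - T f := by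
      push_cast; module
    have h1 := hmin (e - bg.E) f hf ((hHam _ _).2 (hfe.trans (congrArg A h2.symm)))
    linarith
  exact ⟨B, B₀, G, c, 1 / (c - bg.E), ψ, hH, bg.gravityEq_iff_wholeSpace hGf, hB, hBinj, hc,
    one_div_le_one_div_of_le hc (by linarith), hB₀, hC, hG, hGc,
    fun e f hf h => he0 ▸ hmin e f hf h, hψ, hψ0⟩

end WholeSpace

/-! ### Completeness of plane waves on the box, transported from the torus. -/

section FourierBasis

open scoped InnerProductSpace

attribute [local instance] instMeasureSpaceUnitAddCircle

variable {d : ℕ}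

/-- The plane wave `e^{i⟨k, x⟩}`. -/
def planeWave (k x : Space d) : ℂ := Complex.exp (Complex.I * (⟪k, x⟫_ℝ : ℂ))

/-- The wave vectors of the periodic box. -/
def waveVector (L : Fin d → ℝ) (n : Fin d → ℤ) : Space d :=
  WithLp.toLp 2 fun i => 2 * Real.pi * n i / L i

lemma planeWave_waveVector (L : Fin d → ℝ) (n : Fin d → ℤ) (x : Space d) :
    planeWave (waveVector L n) x =
      ∏ i, Complex.exp (2 * Real.pi * Complex.I * n i * ((x i / L i : ℝ) : ℂ)) := by
  rw [planeWave, ← Complex.exp_sum, PiLp.inner_apply]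
  congr 1
  push_cast
  rw [Finset.mul_sum]
  refine Finset.sum_congr rfl fun i _ => ?_
  simp only [waveVector, RCLike.inner_apply, conj_trivial]
  push_cast
  ring

/-- The torus parametrizes the fundamental cell. -/
lemma exists_torus_chart {L : Fin d → ℝ} (hL : ∀ i, 0 < L i) :
    ∃ Q : UnitAddTorus (Fin d) → Space d, Measurable Q ∧
      ENNReal.ofReal (∏ i, L i) • Measure.map Q volume = volume.restrict (cell L) ∧
      ∀ n t, planeWave (waveVector L n) (Q t) = UnitAddTorus.mFourier n t := by
  have hdet : (Matrix.diagonal L).det = ∏ i, L i := Matrix.det_diagonal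
  have hprod : 0 < ∏ i, L i := Finset.prod_pos fun i _ => hL i
  have hscale := Real.smul_map_diagonal_volume_pi (D := L) (by rw [hdet]; exact hprod.ne')
  rw [hdet, abs_of_pos hprod] at hscale
  set q : UnitAddTorus (Fin d) → (Fin d → ℝ) := fun t =>
    (UnitAddTorus.measurableEquivPiIoc (fun _ : Fin d => (0 : ℝ)) t).1 with hq
  obtain ⟨D, hD⟩ : ∃ D : (Fin d → ℝ) → (Fin d → ℝ), D = ⇑(Matrix.toLin' (Matrix.diagonal L)) :=
    ⟨_, rfl⟩
  rw [← hD] at hscale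
  have hDx : ∀ x i, D x i = L i * x i := fun x i => by
    simp [hD, Matrix.mulVec_diagonal]
  have hDm : Measurable D := by
    refine measurable_pi_lambda _ fun i => ?_
    simp_rw [hDx]
    exact (measurable_pi_apply i).const_mul _
  have hqm : Measurable q := measurable_subtype_coe.comp (MeasurableEquiv.measurable _)
  have hcube : MeasurableSet {x : Fin d → ℝ | ∀ i, x i ∈ Set.Ioc (0 : ℝ) (0 + 1)} :=
    MeasurableSet.univ_pi' fun i => measurableSet_Ioc
  have hmapq : Measure.map q volume =
      volume.restrict {x : Fin d → ℝ | ∀ i, x i ∈ Set.Ioc (0 : ℝ) (0 + 1)} := by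
    have h1 := Measure.map_map (μ := (volume : Measure (UnitAddTorus (Fin d))))
      measurable_subtype_coe
      (UnitAddTorus.measurableEquivPiIoc (fun _ : Fin d => (0 : ℝ))).measurable
    rw [(UnitAddTorus.measurePreserving_equivPiIoc (fun _ : Fin d => (0 : ℝ))).map_eq] at h1
    exact h1.symm.trans (map_comap_subtype_coe hcube volume)
  have hbox : MeasurableSet {x : Fin d → ℝ | ∀ i, x i ∈ Set.Ioc (0 : ℝ) (L i)} :=
    MeasurableSet.univ_pi' fun i => measurableSet_Ioc
  have hpre : D ⁻¹' {x : Fin d → ℝ | ∀ i, x i ∈ Set.Ioc (0 : ℝ) (L i)} =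
      {x : Fin d → ℝ | ∀ i, x i ∈ Set.Ioc (0 : ℝ) (0 + 1)} := by
    ext x
    refine forall_congr' fun i => ?_
    rw [Set.mem_Ioc, Set.mem_Ioc, hDx, zero_add, mul_pos_iff_of_pos_left (hL i),
      mul_le_iff_le_one_right (hL i)]
  have hmapD : ENNReal.ofReal (∏ i, L i) • Measure.map (D ∘ q) volume =
      volume.restrict {x : Fin d → ℝ | ∀ i, x i ∈ Set.Ioc (0 : ℝ) (L i)} := by
    rw [← Measure.map_map hDm hqm, hmapq, ← hpre, ← Measure.restrict_map hDm hbox,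
      ← Measure.restrict_smul, hscale]
  have htoLp := PiLp.volume_preserving_toLp (Fin d)
  -- The torus chart lands in intervals `(0, Lᵢ]` whereas `cell` uses `[0, Lᵢ)`; the two differ by a
  -- null set.
  have hcellm : (WithLp.ofLp : Space d → Fin d → ℝ) ⁻¹'
      {x : Fin d → ℝ | ∀ i, x i ∈ Set.Ioc (0 : ℝ) (L i)} =ᵐ[volume] cell L := by
    have h1 : cell L = (WithLp.ofLp : Space d → Fin d → ℝ) ⁻¹'
        (Set.pi Set.univ fun i => Set.Ico (0 : ℝ) (L i)) := by
      ext x; simp [cell, Set.mem_pi]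
    have h2 : {x : Fin d → ℝ | ∀ i, x i ∈ Set.Ioc (0 : ℝ) (L i)} =
        Set.pi Set.univ fun i => Set.Ioc (0 : ℝ) (L i) := by
      ext x; simp [Set.mem_pi]
    rw [h1, h2]
    exact (PiLp.volume_preserving_ofLp (Fin d)).quasiMeasurePreserving.preimage_ae_eq
      ((Measure.univ_pi_Ioc_ae_eq_Icc (f := fun _ => (0 : ℝ)) (g := L)).trans
        Measure.univ_pi_Ico_ae_eq_Icc.symm)
  refine ⟨fun t => WithLp.toLp 2 (D (q t)), htoLp.measurable.comp (hDm.comp hqm), ?_, ?_⟩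
  · have h1 : Measure.map (fun t => (WithLp.toLp 2 (D (q t)) : Space d)) volume =
        Measure.map (WithLp.toLp 2) (Measure.map (D ∘ q) volume) :=
      (Measure.map_map htoLp.measurable (hDm.comp hqm)).symm
    rw [h1, ← Measure.map_smul, hmapD, ← Measure.restrict_congr_set hcellm, ← htoLp.map_eq,
      Measure.restrict_map htoLp.measurable]
    · rfl
    · exact (PiLp.volume_preserving_ofLp (Fin d)).measurable hbox
  · intro n t
    rw [planeWave_waveVector]
    change _ = ∏ i, fourier (n i) (t i)
    refine Finset.prod_congr rfl fun i _ => ?_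
    have h1 : (WithLp.toLp 2 (D (q t)) : Space d) i / L i = q t i := by
      change D (q t) i / L i = q t i
      rw [hDx, mul_div_cancel_left₀ _ (hL i).ne']
    have h2 : t i = ((q t i : ℝ) : UnitAddCircle) := by
      rw [hq]
      exact (AddCircle.coe_equivIoc (p := (1 : ℝ)) (a := 0)).symm
    rw [h1, h2, fourier_coe_apply]
    simp

lemma norm_planeWave (k x : Space d) : ‖planeWave k x‖ = 1 := by
  rw [planeWave, mul_comm, Complex.norm_exp_ofReal_mul_I]

lemma contDiff_planeWave (k : Space d) : ContDiff ℝ ∞ (planeWave k) := by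
  exact Complex.contDiff_exp.comp (contDiff_const.mul
    (Complex.ofRealCLM.contDiff.comp (contDiff_const.inner ℝ contDiff_id)))

lemma conj_planeWave (k x : Space d) : (starRingEnd ℂ) (planeWave k x) = planeWave (-k) x := by
  simp [planeWave, ← Complex.exp_conj]

instance isFiniteMeasure_cell (L : Fin d → ℝ) :
    IsFiniteMeasure ((volume : Measure (Space d)).restrict (cell L)) := by
  refine ⟨?_⟩
  rw [Measure.restrict_apply_univ, measure_congr (cell_ae_eq L),
    (PiLp.volume_preserving_ofLp (Fin d)).measure_preimage measurableSet_Icc.nullMeasurableSet]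
  exact isCompact_Icc.measure_lt_top

/-- The plane waves, normalized, form a Hilbert basis on the periodic box. -/
lemma exists_planeWave_basis {L : Fin d → ℝ} (hL : ∀ i, 0 < L i) :
    ∃ (b : HilbertBasis (Fin d → ℤ) ℂ (Lp ℂ 2 ((volume : Measure (Space d)).restrict (cell L))))
      (r : ℝ), 0 < r ∧ ∀ n, b n =ᵐ[volume.restrict (cell L)]
        fun x => (r : ℂ) * planeWave (waveVector L n) x := by
  obtain ⟨Q, hQm, hQ, hQw⟩ := exists_torus_chart hL
  set P : ℝ := ∏ i, L i with hP
  have hP0 : 0 < P := Finset.prod_pos fun i _ => hL i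
  set r : ℝ := (Real.sqrt P)⁻¹ with hr
  have hr0 : 0 < r := by positivity
  have hrP : r ^ 2 * P = 1 := by
    rw [hr, inv_pow, Real.sq_sqrt hP0.le, inv_mul_cancel₀ hP0.ne']
  have hmapQ : Measure.map Q volume = (ENNReal.ofReal P)⁻¹ • volume.restrict (cell L) := by
    rw [← hQ, smul_smul, ENNReal.inv_mul_cancel (by simpa using hP0) ENNReal.ofReal_ne_top,
      one_smul]
  have hInt : ∀ g : Space d → ℂ, AEStronglyMeasurable g (volume.restrict (cell L)) →
      ∫ x in cell L, g x = (P : ℂ) * ∫ t, g (Q t) := fun g hg => by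
    rw [← hQ, integral_smul_measure, integral_map hQm.aemeasurable, ENNReal.toReal_ofReal hP0.le,
      Complex.real_smul]
    rw [hmapQ]
    exact hg.smul_measure _
  have hmem : ∀ n, MemLp (fun x => (r : ℂ) * planeWave (waveVector L n) x) 2
      (volume.restrict (cell L)) := fun n => by
    refine MemLp.of_bound (((contDiff_planeWave _).continuous.const_mul
      (r : ℂ)).aestronglyMeasurable) r (Eventually.of_forall fun x => ?_)
    rw [norm_mul, norm_planeWave, mul_one, Complex.norm_real, Real.norm_of_nonneg hr0.le]
  have hinner : ∀ n (f : Lp ℂ 2 ((volume : Measure (Space d)).restrict (cell L))),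
      inner ℂ ((hmem n).toLp _) f = (P : ℂ) *
        ∫ t, (r : ℂ) * (f (Q t) * (starRingEnd ℂ) (UnitAddTorus.mFourier n t)) := fun n f => by
    rw [L2.inner_def]
    have h1 : ∫ x in cell L, inner ℂ ((hmem n).toLp _ x) (f x) = ∫ x in cell L,
        (r : ℂ) * (f x * (starRingEnd ℂ) (planeWave (waveVector L n) x)) := by
      refine integral_congr_ae ?_
      filter_upwards [(hmem n).coeFn_toLp] with x hx
      rw [hx]
      simp only [RCLike.inner_apply, map_mul, Complex.conj_ofReal]
      ring
    rw [h1, hInt]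
    · simp_rw [hQw]
    · refine AEStronglyMeasurable.const_mul ((Lp.aestronglyMeasurable f).mul ?_) _
      exact (Complex.continuous_conj.comp
        (contDiff_planeWave _).continuous).aestronglyMeasurable
  have hQae : ∀ {p : Space d → Prop}, (∀ᵐ x ∂(volume.restrict (cell L)), p x) →
      ∀ᵐ t ∂(volume : Measure (UnitAddTorus (Fin d))), p (Q t) := fun {p} hp => by
    refine ae_of_ae_map hQm.aemeasurable ?_
    rw [hmapQ]
    exact Measure.ae_smul_measure hp _
  have horth : Orthonormal ℂ fun n => (hmem n).toLp _ := by
    rw [orthonormal_iff_ite]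
    intro m n
    have h2 := orthonormal_iff_ite.1 (UnitAddTorus.orthonormal_mFourier (d := Fin d)) m n
    rw [ContinuousMap.inner_toLp] at h2
    rw [hinner, ← h2, ← integral_const_mul]
    refine integral_congr_ae ?_
    filter_upwards [hQae (hmem n).coeFn_toLp] with t ht
    rw [ht, hQw]
    have h3 : (r : ℂ) ^ 2 * (P : ℂ) = 1 := by exact_mod_cast hrP
    linear_combination (UnitAddTorus.mFourier n t *
      (starRingEnd ℂ) (UnitAddTorus.mFourier m t)) * h3
  -- A function orthogonal to all plane waves pulls back along `Q` to a function on the torus all of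
  -- whose Fourier coefficients vanish.
  have hbot : (Submodule.span ℂ (Set.range fun n => (hmem n).toLp _))ᗮ = ⊥ := by
    rw [Submodule.eq_bot_iff]
    intro f hf
    have hf0 : ∀ n, inner ℂ ((hmem n).toLp _) f = 0 := fun n =>
      hf _ (Submodule.subset_span ⟨n, rfl⟩)
    have hfQ : MemLp (fun t => f (Q t)) 2 (volume : Measure (UnitAddTorus (Fin d))) := by
      have h1 : MemLp f 2 (Measure.map Q volume) := by
        rw [hmapQ]
        exact (Lp.memLp f).smul_measure (by simpa using hP0)
      exact h1.comp_of_map hQm.aemeasurable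
    have h0 : hfQ.toLp _ = 0 := by
      refine hilbertBasis_ext (UnitAddTorus.mFourierBasis (d := Fin d)) fun n => ?_
      rw [inner_zero_right, UnitAddTorus.coe_mFourierBasis, L2.inner_def]
      have h1 := hf0 n
      rw [hinner, integral_const_mul] at h1
      have h2 : ∫ t, f (Q t) * (starRingEnd ℂ) (UnitAddTorus.mFourier n t) = 0 := by
        have hPc : (P : ℂ) ≠ 0 := by exact_mod_cast hP0.ne'
        have hrc : (r : ℂ) ≠ 0 := by exact_mod_cast hr0.ne'
        simpa [hPc, hrc] using h1
      rw [← h2]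
      refine integral_congr_ae ?_
      filter_upwards [hfQ.coeFn_toLp, UnitAddTorus.coeFn_mFourierLp 2 n] with t ht1 ht2
      rw [ht1, ht2]
      rfl
    have h1 : ∀ᵐ t ∂(volume : Measure (UnitAddTorus (Fin d))), f (Q t) = 0 := by
      have h2 := hfQ.coeFn_toLp
      rw [h0] at h2
      filter_upwards [h2, Lp.coeFn_zero ℂ 2 (volume : Measure (UnitAddTorus (Fin d)))] with t h3 h4
      rw [← h3, h4]; rfl
    have hae : ∀ p : Space d → Prop, (∀ᵐ x ∂(ENNReal.ofReal P • Measure.map Q volume), p x) →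
        ∀ᵐ x ∂(volume.restrict (cell L)), p x := fun p hp => by rwa [hQ] at hp
    have h5 : ∀ᵐ x ∂(volume.restrict (cell L)), f x = 0 :=
      hae _ (Measure.ae_smul_measure ((ae_map_iff hQm.aemeasurable
        ((Lp.stronglyMeasurable f).measurable (measurableSet_singleton 0))).2 h1) _)
    refine Lp.ext ?_
    filter_upwards [h5, Lp.coeFn_zero ℂ 2 ((volume : Measure (Space d)).restrict (cell L))] with
      x h6 h7
    rw [h6, h7]; rfl
  refine ⟨HilbertBasis.mkOfOrthogonalEqBot horth hbot, r, hr0, fun n => ?_⟩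
  rw [HilbertBasis.coe_mkOfOrthogonalEqBot]
  exact (hmem n).coeFn_toLp

end FourierBasis

/-! ### Derivatives, periodicity and growth of wave vectors. -/

section PlaneWaves

open scoped InnerProductSpace

variable {d : ℕ}

lemma fderiv_planeWave (k x v : Space d) :
    fderiv ℝ (planeWave k) x v = Complex.I * (⟪k, v⟫_ℝ : ℂ) * planeWave k x := by
  have h := ((Complex.I • (Complex.ofRealCLM.comp (innerSL ℝ k))).hasFDerivAt (x := x)).cexp
  have h1 : HasFDerivAt (planeWave k) (Complex.exp ((Complex.I •
      (Complex.ofRealCLM.comp (innerSL ℝ k))) x) • (Complex.I •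
      (Complex.ofRealCLM.comp (innerSL ℝ k)))) x := h
  rw [h1.fderiv]
  simp [planeWave]
  ring

lemma laplacian_planeWave (k x : Space d) :
    (Δ (planeWave k)) x = -((‖k‖ ^ 2 : ℝ) : ℂ) * planeWave k x := by
  rw [laplacian_eq_sum_fderiv ((contDiff_planeWave k).of_le two_le_infty)]
  have h1 : ∀ i : Fin d, fderiv ℝ (fun y => fderiv ℝ (planeWave k) y (coordVec i)) x (coordVec i) =
      -((k i ^ 2 : ℝ) : ℂ) * planeWave k x := fun i => by
    simp_rw [fderiv_planeWave]
    rw [fderiv_const_mul ((contDiff_planeWave k).differentiable (by simp) x), smul_apply,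
      fderiv_planeWave, smul_eq_mul, real_inner_comm]
    simp only [coordVec, EuclideanSpace.inner_single_left, conj_trivial, one_mul]
    push_cast
    linear_combination ((k i : ℂ) ^ 2 * planeWave k x) * Complex.I_sq
  rw [Finset.sum_congr rfl fun i _ => h1 i, ← Finset.sum_mul, EuclideanSpace.real_norm_sq_eq]
  push_cast
  rw [Finset.sum_neg_distrib]

lemma isPeriodic_planeWave {L : Fin d → ℝ} (hL : ∀ i, 0 < L i) (n : Fin d → ℤ) :
    IsPeriodic L (planeWave (waveVector L n)) := by
  intro i x
  rw [planeWave, planeWave, inner_add_right, real_inner_comm,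
    Complex.exp_eq_exp_iff_exists_int]
  refine ⟨n i, ?_⟩
  simp only [EuclideanSpace.inner_single_right, waveVector, conj_trivial]
  have h1 : L i * (2 * Real.pi * n i / L i) = 2 * Real.pi * n i := by
    have := (hL i).ne'
    field_simp
  have h2 : (L i : ℂ) * (2 * Real.pi * n i / L i) = 2 * Real.pi * n i := by exact_mod_cast h1
  push_cast
  rw [real_inner_comm]
  linear_combination Complex.I * h2

lemma waveVector_neg (L : Fin d → ℝ) (n : Fin d → ℤ) : waveVector L (-n) = -waveVector L n := by
  ext i
  simp [waveVector, neg_div]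

lemma waveVector_eq_zero {L : Fin d → ℝ} (hL : ∀ i, 0 < L i) {n : Fin d → ℤ} :
    waveVector L n = 0 ↔ n = 0 := by
  constructor
  · intro h
    funext i
    have h1 : waveVector L n i = 0 := by rw [h]; rfl
    have h2 : 2 * Real.pi * n i / L i = 0 := h1
    simpa [(hL i).ne', Real.pi_ne_zero] using h2
  · rintro rfl
    ext i
    simp [waveVector]

lemma planeWave_zero (x : Space d) : planeWave 0 x = 1 := by simp [planeWave]

/-- Divergence of the wave numbers is what makes the kinetic resolvent and `∇⁻²` compact on the box.
-/
lemma tendsto_norm_waveVector {L : Fin d → ℝ} (hL : ∀ i, 0 < L i) :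
    Tendsto (fun n => ‖waveVector L n‖) cofinite atTop := by
  -- The summand `1` keeps the constant positive in dimension zero, where the sum is empty.
  have hS : 0 < ∑ i, L i + 1 := by
    have := Finset.sum_nonneg fun i (_ : i ∈ Finset.univ) => (hL i).le
    linarith
  have h1 : Tendsto (fun n : Fin d → ℤ => ‖n‖) cofinite atTop := by
    rw [← cocompact_eq_cofinite]
    exact tendsto_norm_cocompact_atTop
  refine tendsto_atTop_mono (fun n => ?_) (h1.atTop_mul_const (inv_pos.2 hS))
  rw [← div_eq_mul_inv, div_le_iff₀ hS]
  refine (pi_norm_le_iff_of_nonneg (by positivity)).2 fun i => ?_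
  have h2 : |waveVector L n i| ≤ ‖waveVector L n‖ := by
    rw [← Real.norm_eq_abs]
    exact PiLp.norm_apply_le (waveVector L n) i
  have h3 : waveVector L n i = 2 * Real.pi * n i / L i := rfl
  have h4 : |(n i : ℝ)| = |waveVector L n i| * (L i / (2 * Real.pi)) := by
    rw [h3, abs_div, abs_mul, abs_of_pos (hL i), abs_of_pos Real.two_pi_pos]
    have := (hL i).ne'
    field_simp
  have h5 : L i / (2 * Real.pi) ≤ ∑ j, L j + 1 := by
    have h6 := Finset.single_le_sum (fun j _ => (hL j).le) (Finset.mem_univ i)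
    have h7 : L i / (2 * Real.pi) ≤ L i :=
      div_le_self (hL i).le (by linarith [Real.pi_gt_three])
    linarith
  rw [Int.norm_eq_abs, h4]
  exact mul_le_mul h2 h5 (div_pos (hL i) Real.two_pi_pos).le (norm_nonneg _)

end PlaneWaves

/-! ### Weak equations on the box in Fourier coefficients. -/

section Box

variable {d : ℕ} {L : Fin d → ℝ}

/-- The normalized plane waves, as a Hilbert basis of the box. -/
def IsPlaneWaveBasis (L : Fin d → ℝ)
    (b : HilbertBasis (Fin d → ℤ) ℂ (Lp ℂ 2 ((volume : Measure (Space d)).restrict (cell L))))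
    (r : ℝ) : Prop :=
  0 < r ∧ ∀ n, b n =ᵐ[volume.restrict (cell L)] fun x => (r : ℂ) * planeWave (waveVector L n) x

lemma exists_bound_cell {F : Type*} [NormedAddCommGroup F] (L : Fin d → ℝ) {g : Space d → F}
    (hg : Continuous g) : ∃ C, 0 ≤ C ∧ ∀ x ∈ cell L, ‖g x‖ ≤ C := by
  have hK : IsCompact ((WithLp.toLp 2 : (Fin d → ℝ) → Space d) '' Set.Icc 0 L) :=
    isCompact_Icc.image (PiLp.continuous_toLp 2 _)
  obtain ⟨C, hC⟩ := hK.exists_bound_of_continuousOn hg.continuousOn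
  refine ⟨|C|, abs_nonneg C, fun x hx => (hC x ⟨WithLp.ofLp x, ?_, rfl⟩).trans (le_abs_self C)⟩
  exact ⟨fun i => (hx i).1, fun i => (hx i).2.le⟩

lemma measurableSet_cell (L : Fin d → ℝ) : MeasurableSet (cell L) := by
  have : cell L = ⋂ i, (fun x : Space d => x i) ⁻¹' Set.Ico 0 (L i) := by
    ext x; simp [cell]
  rw [this]
  exact MeasurableSet.iInter fun i => measurableSet_Ico.preimage (by fun_prop)

lemma memLp_cell (L : Fin d → ℝ) {g : Space d → ℂ} (hg : Continuous g) :
    MemLp g 2 (volume.restrict (cell L)) := by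
  obtain ⟨C, -, hC⟩ := exists_bound_cell L hg
  refine MemLp.of_bound hg.aestronglyMeasurable C ?_
  filter_upwards [ae_restrict_mem (measurableSet_cell L)] with x hx using hC x hx

/-- The multiplier is cut off to the cell, since continuity alone bounds it only there. -/
lemma exists_mul_cell (L : Fin d → ℝ) {w : Space d → ℝ} (hw : Continuous w) :
    ∃ T : Lp ℂ 2 ((volume : Measure (Space d)).restrict (cell L)) →L[ℂ]
      Lp ℂ 2 ((volume : Measure (Space d)).restrict (cell L)),
      ∀ f, T f =ᵐ[volume.restrict (cell L)] fun x => (w x : ℂ) * f x := by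
  obtain ⟨C, hC0, hC⟩ := exists_bound_cell L hw
  have hm : Measurable ((cell L).indicator w) := hw.measurable.indicator (measurableSet_cell L)
  obtain ⟨T, hT, -⟩ := exists_mulL2 (μ := (volume : Measure (Space d)).restrict (cell L))
    (w := fun x => (((cell L).indicator w x : ℝ) : ℂ))
    (Complex.measurable_ofReal.comp hm).aestronglyMeasurable hC0 (fun x => by
      rw [Complex.norm_real]
      by_cases hx : x ∈ cell L
      · rw [Set.indicator_of_mem hx]
        exact hC x hx
      · rw [Set.indicator_of_notMem hx, norm_zero]
        exact hC0)
  refine ⟨T, fun f => ?_⟩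
  filter_upwards [hT f, ae_restrict_mem (measurableSet_cell L)] with x h1 h2
  rw [h1, Set.indicator_of_mem h2]

lemma exists_inner_eq_integral {α : Type*} [MeasurableSpace α] {μ : Measure α} {φ : α → ℂ}
    (hφ : MemLp φ 2 μ) : ∃ w : Lp ℂ 2 μ, ∀ u, inner ℂ w u = ∫ x, u x * φ x ∂μ := by
  have h : MemLp (fun x => (starRingEnd ℂ) (φ x)) 2 μ := hφ.star
  refine ⟨h.toLp _, fun u => ?_⟩
  rw [L2.inner_def]
  refine integral_congr_ae ?_
  filter_upwards [h.coeFn_toLp] with x hx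
  rw [hx]
  simp

variable {b : HilbertBasis (Fin d → ℤ) ℂ (Lp ℂ 2 ((volume : Measure (Space d)).restrict (cell L)))}
  {r : ℝ}

lemma IsPlaneWaveBasis.inner_eq (hb : IsPlaneWaveBasis L b r) (n : Fin d → ℤ)
    (f : Lp ℂ 2 ((volume : Measure (Space d)).restrict (cell L))) :
    inner ℂ (b n) f = (r : ℂ) * ∫ x in cell L, f x * planeWave (waveVector L (-n)) x := by
  rw [L2.inner_def, ← integral_const_mul]
  refine integral_congr_ae ?_
  filter_upwards [hb.2 n] with x hx
  rw [hx, waveVector_neg, ← conj_planeWave]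
  simp only [RCLike.inner_apply, map_mul, Complex.conj_ofReal]
  ring

/-- The weak Poisson equation on the periodic box in terms of Fourier coefficients. -/
lemma IsPlaneWaveBasis.weak_laplacian_iff (hb : IsPlaneWaveBasis L b r) (hL : ∀ i, 0 < L i)
    (u f : Lp ℂ 2 ((volume : Measure (Space d)).restrict (cell L))) :
    (∀ φ : Space d → ℂ, ContDiff ℝ ∞ φ → IsPeriodic L φ →
      ∫ x in cell L, u x * (Δ φ) x = ∫ x in cell L, f x * φ x) ↔
      ∀ n, -((‖waveVector L n‖ ^ 2 : ℝ) : ℂ) * inner ℂ (b n) u = inner ℂ (b n) f := by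
  constructor
  · intro h n
    have h1 := h _ (contDiff_planeWave (waveVector L (-n))) (isPeriodic_planeWave hL (-n))
    rw [hb.inner_eq, hb.inner_eq, ← h1]
    have h2 : ∫ x in cell L, u x * (Δ (planeWave (waveVector L (-n)))) x =
        ∫ x in cell L, -((‖waveVector L n‖ ^ 2 : ℝ) : ℂ) *
          (u x * planeWave (waveVector L (-n)) x) := by
      refine integral_congr_ae (Eventually.of_forall fun x => ?_)
      simp only
      rw [laplacian_planeWave, waveVector_neg, norm_neg]
      ring
    rw [h2, integral_const_mul]
    ring
  -- Green's identity against plane waves gives the Fourier coefficients of `Δφ`; Parseval's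
  -- identity then sums the coefficientwise equations.
  · intro h φ hφ hφp
    have hφ2 : ContDiff ℝ 2 φ := hφ.of_le two_le_infty
    obtain ⟨w, hw⟩ := exists_inner_eq_integral (memLp_cell L hφ.continuous)
    obtain ⟨w', hw'⟩ := exists_inner_eq_integral (memLp_cell L (continuous_laplacian hφ2))
    have key : ∀ n, inner ℂ w' (b n) = -((‖waveVector L n‖ ^ 2 : ℝ) : ℂ) * inner ℂ w (b n) :=
      fun n => by
        have hpw : ContDiff ℝ 2 (planeWave (waveVector L n)) :=
          (contDiff_planeWave _).of_le two_le_infty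
        have h1 := integral_mul_laplacian_cell hL hpw hφ2 (isPeriodic_planeWave hL n) hφp
        have hi1 : Integrable (fun x => planeWave (waveVector L n) x * (Δ φ) x)
            (volume.restrict (cell L)) :=
          (memLp_cell L hpw.continuous).integrable_mul (memLp_cell L (continuous_laplacian hφ2))
        have hi2 : Integrable (fun x => φ x * (Δ (planeWave (waveVector L n))) x)
            (volume.restrict (cell L)) :=
          (memLp_cell L hφ2.continuous).integrable_mul (memLp_cell L (continuous_laplacian hpw))
        rw [integral_sub hi1 hi2, sub_eq_zero] at h1
        have e1 : inner ℂ w' (b n) =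
            (r : ℂ) * ∫ x in cell L, planeWave (waveVector L n) x * (Δ φ) x := by
          rw [hw', ← integral_const_mul]
          refine integral_congr_ae ?_
          filter_upwards [hb.2 n] with x hx
          rw [hx]; ring
        have e2 : -((‖waveVector L n‖ ^ 2 : ℝ) : ℂ) * inner ℂ w (b n) =
            (r : ℂ) * ∫ x in cell L, φ x * (Δ (planeWave (waveVector L n))) x := by
          rw [hw, ← integral_const_mul, ← integral_const_mul]
          refine integral_congr_ae ?_
          filter_upwards [hb.2 n] with x hx
          rw [hx, laplacian_planeWave]; ring
        rw [e1, e2, h1]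
    rw [← hw, ← hw', ← b.tsum_inner_mul_inner, ← b.tsum_inner_mul_inner]
    refine tsum_congr fun n => ?_
    rw [key, ← h n]
    ring

/-- The kinetic resolvent on the periodic box. -/
lemma IsPlaneWaveBasis.weak_kinetic_iff (hb : IsPlaneWaveBasis L b r) (hL : ∀ i, 0 < L i)
    {A : Lp ℂ 2 ((volume : Measure (Space d)).restrict (cell L)) →L[ℂ]
      Lp ℂ 2 ((volume : Measure (Space d)).restrict (cell L))}
    (hA : ∀ f n, inner ℂ (b n) (A f) =
      (((1 + ‖waveVector L n‖ ^ 2 / 2)⁻¹ : ℝ) : ℂ) * inner ℂ (b n) f)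
    (f h : Lp ℂ 2 ((volume : Measure (Space d)).restrict (cell L))) :
    (∀ φ : Space d → ℂ, ContDiff ℝ ∞ φ → IsPeriodic L φ →
      ∫ x in cell L, f x * (-(1 / 2) * (Δ φ) x + φ x) = ∫ x in cell L, h x * φ x) ↔ f = A h := by
  -- The equation `(1 - ∇²/2) f = h` is rewritten as the Poisson equation `∇²f = 2(f - h)`.
  have h1 : (∀ φ : Space d → ℂ, ContDiff ℝ ∞ φ → IsPeriodic L φ →
      ∫ x in cell L, f x * (-(1 / 2) * (Δ φ) x + φ x) = ∫ x in cell L, h x * φ x) ↔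
      ∀ φ : Space d → ℂ, ContDiff ℝ ∞ φ → IsPeriodic L φ →
      ∫ x in cell L, f x * (Δ φ) x =
        ∫ x in cell L, ((2 : ℂ) • (f - h) : Lp ℂ 2 (volume.restrict (cell L))) x * φ x := by
    refine forall_congr' fun φ => forall_congr' fun hφ => forall_congr' fun hφp => ?_
    have hφL := memLp_cell L hφ.continuous
    have hi1 : Integrable (fun x => f x * (Δ φ) x) (volume.restrict (cell L)) :=
      (Lp.memLp f).integrable_mul (memLp_cell L (continuous_laplacian (hφ.of_le two_le_infty)))
    have hi2 : Integrable (fun x => f x * φ x) (volume.restrict (cell L)) :=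
      (Lp.memLp f).integrable_mul hφL
    have e1 : ∫ x in cell L, f x * (-(1 / 2) * (Δ φ) x + φ x) =
        -(1 / 2) * (∫ x in cell L, f x * (Δ φ) x) + ∫ x in cell L, f x * φ x := by
      rw [← integral_const_mul, ← integral_add (hi1.const_mul _) hi2]
      refine integral_congr_ae (Eventually.of_forall fun x => ?_)
      simp only
      ring
    have e2 : ∫ x in cell L, ((2 : ℂ) • (f - h) : Lp ℂ 2 (volume.restrict (cell L))) x * φ x =
        2 * ((∫ x in cell L, f x * φ x) - ∫ x in cell L, h x * φ x) := by
      rw [← integral_sub_mul f h hφL, ← integral_const_mul]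
      refine integral_congr_ae ?_
      filter_upwards [Lp.coeFn_smul (2 : ℂ) (f - h)] with x hx
      rw [hx, Pi.smul_apply, smul_eq_mul, mul_assoc]
    rw [e1, e2]
    constructor <;> intro h'
    · linear_combination (-2 : ℂ) * h'
    · linear_combination (-1 / 2 : ℂ) * h'
  rw [h1, hb.weak_laplacian_iff hL]
  have hne : ∀ n, ((1 + ‖waveVector L n‖ ^ 2 / 2 : ℝ) : ℂ) ≠ 0 := fun n => by
    exact_mod_cast (by positivity : (1 + ‖waveVector L n‖ ^ 2 / 2 : ℝ) ≠ 0)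
  have h2 : ∀ n, (-((‖waveVector L n‖ ^ 2 : ℝ) : ℂ) * inner ℂ (b n) f =
      inner ℂ (b n) ((2 : ℂ) • (f - h)) ↔ inner ℂ (b n) f = inner ℂ (b n) (A h)) := fun n => by
    rw [hA, inner_smul_right, inner_sub_right, Complex.ofReal_inv, eq_inv_mul_iff_mul_eq₀ (hne n)]
    push_cast
    constructor <;> intro h'
    · linear_combination (-1 / 2 : ℂ) * h'
    · linear_combination (-2 : ℂ) * h'
  constructor
  · exact fun h' => hilbertBasis_ext b fun n => (h2 n).1 (h' n)
  · exact fun hfA n => (h2 n).2 (by rw [← hfA])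

/-- The inverse Laplacian on the periodic box in terms of Fourier coefficients. -/
lemma IsPlaneWaveBasis.isInvLaplacian_iff (hb : IsPlaneWaveBasis L b r) (hL : ∀ i, 0 < L i)
    {N : Lp ℂ 2 ((volume : Measure (Space d)).restrict (cell L)) →L[ℂ]
      Lp ℂ 2 ((volume : Measure (Space d)).restrict (cell L))}
    (hN : ∀ f n, inner ℂ (b n) (N f) = ((-(‖waveVector L n‖ ^ 2)⁻¹ : ℝ) : ℂ) * inner ℂ (b n) f)
    {F u : Lp ℂ 2 ((volume : Measure (Space d)).restrict (cell L))} {F' u' : Space d → ℂ}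
    (hF : F =ᵐ[volume.restrict (cell L)] F') (hu : u =ᵐ[volume.restrict (cell L)] u') :
    (∫ x in cell L, u' x = 0 ∧ ∀ φ, ContDiff ℝ ∞ φ → IsPeriodic L φ →
      ∫ x in cell L, u' x * (Δ φ) x = ∫ x in cell L, (F' x - ⨍ y in cell L, F' y) * φ x) ↔
      u = N F := by
  obtain ⟨m, hm⟩ : ∃ m, m = ⨍ y in cell L, F' y := ⟨_, rfl⟩
  rw [← hm]
  have hcm : MemLp (fun _ : Space d => m) 2 (volume.restrict (cell L)) := memLp_const m
  obtain ⟨c, hc⟩ : ∃ c : Lp ℂ 2 ((volume : Measure (Space d)).restrict (cell L)),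
      c =ᵐ[volume.restrict (cell L)] fun _ => m := ⟨hcm.toLp _, hcm.coeFn_toLp⟩
  have hrc : (r : ℂ) ≠ 0 := by exact_mod_cast hb.1.ne'
  have hcb : c = (m / r) • b 0 := by
    refine Lp.ext ?_
    filter_upwards [hc, Lp.coeFn_smul (m / r : ℂ) (b 0), hb.2 0] with x h1 h2 h3
    rw [h1, h2, Pi.smul_apply, h3, (waveVector_eq_zero hL).2 rfl, planeWave_zero, smul_eq_mul,
      mul_one, div_mul_cancel₀ _ hrc]
  have hFc : (F - c : Lp ℂ 2 ((volume : Measure (Space d)).restrict (cell L)))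
      =ᵐ[volume.restrict (cell L)] fun x => F' x - m := by
    filter_upwards [Lp.coeFn_sub F c, hF, hc] with x h1 h2 h3
    rw [h1, Pi.sub_apply, h2, h3]
  have hcoef0 : inner ℂ (b 0) (F - c) = 0 := by
    rw [hb.inner_eq, neg_zero, (waveVector_eq_zero hL).2 rfl]
    simp_rw [planeWave_zero, mul_one]
    rw [integral_congr_ae hFc, hm, integral_sub_average, mul_zero]
  have hcoef : ∀ n, n ≠ 0 → inner ℂ (b n) (F - c) = inner ℂ (b n) F := fun n hn => by
    rw [inner_sub_right, hcb, inner_smul_right, b.orthonormal.2 hn, mul_zero, sub_zero]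
  have hmean : ∫ x in cell L, u' x = 0 ↔ inner ℂ (b 0) u = 0 := by
    rw [hb.inner_eq, neg_zero, (waveVector_eq_zero hL).2 rfl]
    simp_rw [planeWave_zero, mul_one]
    rw [integral_congr_ae hu, mul_eq_zero, or_iff_right hrc]
  have hweak : (∀ φ, ContDiff ℝ ∞ φ → IsPeriodic L φ →
      ∫ x in cell L, u' x * (Δ φ) x = ∫ x in cell L, (F' x - m) * φ x) ↔
      ∀ n, -((‖waveVector L n‖ ^ 2 : ℝ) : ℂ) * inner ℂ (b n) u = inner ℂ (b n) (F - c) := by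
    rw [← hb.weak_laplacian_iff hL]
    refine forall_congr' fun φ => forall_congr' fun _ => forall_congr' fun _ => ?_
    have e1 : ∫ x in cell L, u x * (Δ φ) x = ∫ x in cell L, u' x * (Δ φ) x :=
      integral_congr_ae (hu.mul (ae_eq_refl (Δ φ)))
    have e2 : ∫ x in cell L, (F - c : Lp ℂ 2 (volume.restrict (cell L))) x * φ x =
        ∫ x in cell L, (F' x - m) * φ x := integral_congr_ae (hFc.mul (ae_eq_refl φ))
    rw [e1, e2]
  rw [hmean, hweak]
  constructor
  · rintro ⟨h1, h2⟩
    refine hilbertBasis_ext b fun n => ?_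
    rw [hN]
    -- At `n = 0` the diagonal entry of `N` is `-0⁻¹ = 0`; this default value is exactly the
    -- convention that `∇⁻²` annihilates constants.
    by_cases hn : n = 0
    · subst hn
      rw [h1, (waveVector_eq_zero hL).2 rfl]
      simp
    · have hk : ((‖waveVector L n‖ ^ 2 : ℝ) : ℂ) ≠ 0 := by
        have : waveVector L n ≠ 0 := fun h => hn ((waveVector_eq_zero hL).1 h)
        exact_mod_cast (by positivity : ‖waveVector L n‖ ^ 2 ≠ 0)
      rw [← hcoef n hn, ← h2 n, Complex.ofReal_neg, Complex.ofReal_inv, neg_mul, neg_mul,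
        mul_neg, neg_neg, inv_mul_cancel_left₀ hk]
  · rintro rfl
    have h0 : inner ℂ (b 0) (N F) = 0 := by
      rw [hN, (waveVector_eq_zero hL).2 rfl]
      simp
    refine ⟨h0, fun n => ?_⟩
    by_cases hn : n = 0
    · subst hn
      rw [h0, hcoef0, mul_zero]
    · have hk : ((‖waveVector L n‖ ^ 2 : ℝ) : ℂ) ≠ 0 := by
        have : waveVector L n ≠ 0 := fun h => hn ((waveVector_eq_zero hL).1 h)
        exact_mod_cast (by positivity : ‖waveVector L n‖ ^ 2 ≠ 0)
      rw [hcoef n hn, hN, Complex.ofReal_neg, Complex.ofReal_inv, neg_mul, neg_mul,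
        mul_neg, neg_neg, mul_inv_cancel_left₀ hk]

end Box

/-! ### Equilibria on the periodic box. -/

section PeriodicBox

variable {d : ℕ} {L : Fin d → ℝ} {hL : ∀ i, 0 < L i}

lemma Equilibrium.hamiltonianEq_iff_box (bg : Equilibrium (Domain.periodicBox L hL))
    {A W : Lp ℂ 2 ((volume : Measure (Space d)).restrict (cell L)) →L[ℂ]
      Lp ℂ 2 ((volume : Measure (Space d)).restrict (cell L))}
    (hA : ∀ f h, (∀ φ : Space d → ℂ, ContDiff ℝ ∞ φ → IsPeriodic L φ →
      ∫ x in cell L, f x * (-(1 / 2) * (Δ φ) x + φ x) = ∫ x in cell L, h x * φ x) ↔ f = A h)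
    (hW : ∀ f, W f =ᵐ[volume.restrict (cell L)] fun x => ((bg.V x - bg.E : ℝ) : ℂ) * f x)
    (f g : Lp ℂ 2 ((volume : Measure (Space d)).restrict (cell L))) :
    bg.HamiltonianEq f g ↔ f = A (g + f - W f) := by
  rw [← hA]
  have key : ∀ φ : Space d → ℂ, ContDiff ℝ ∞ φ →
      (∫ x in cell L, f x * (-(1 / 2) * (Δ φ) x + ((bg.V x - bg.E : ℝ) : ℂ) * φ x) =
        ∫ x in cell L, g x * φ x ↔
      ∫ x in cell L, f x * (-(1 / 2) * (Δ φ) x + φ x) =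
        ∫ x in cell L, (g + f - W f : Lp ℂ 2 (volume.restrict (cell L))) x * φ x) :=
    fun φ hφ => integral_potential_iff hW f g
      (memLp_cell L (continuous_laplacian (hφ.of_le two_le_infty)))
      (memLp_cell L hφ.continuous)
  exact ⟨fun h φ hφ hp => (key φ hφ).1 (h φ ⟨hφ, hp⟩),
    fun h φ hφ => (key φ hφ.1).2 (h φ hφ.1 hφ.2)⟩

lemma Equilibrium.hamiltonianEq_zero_box (bg : Equilibrium (Domain.periodicBox L hL))
    {ψ : Lp ℂ 2 ((volume : Measure (Space d)).restrict (cell L))}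
    (hψ : ψ =ᵐ[volume.restrict (cell L)] fun x => (bg.Ψ x : ℂ)) : bg.HamiltonianEq ψ 0 := by
  refine bg.hamiltonianEq_zero hψ fun φ hφ => ?_
  have hΨp : IsPeriodic L bg.Ψ := bg.boundary.1
  exact integral_mul_laplacian_cell hL (Complex.ofRealCLM.contDiff.comp bg.contDiff_Ψ)
    (hφ.1.of_le two_le_infty) (fun i x => congrArg _ (hΨp i x)) hφ.2

lemma Equilibrium.gravityEq_iff_box (bg : Equilibrium (Domain.periodicBox L hL))
    {M N : Lp ℂ 2 ((volume : Measure (Space d)).restrict (cell L)) →L[ℂ]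
      Lp ℂ 2 ((volume : Measure (Space d)).restrict (cell L))}
    (hM : ∀ f, M f =ᵐ[volume.restrict (cell L)] fun x => (bg.Ψ x : ℂ) * f x)
    (hN : ∀ (F u : Lp ℂ 2 ((volume : Measure (Space d)).restrict (cell L))) (F' u' : Space d → ℂ),
      F =ᵐ[volume.restrict (cell L)] F' → u =ᵐ[volume.restrict (cell L)] u' →
      ((∫ x in cell L, u' x = 0 ∧ ∀ φ, ContDiff ℝ ∞ φ → IsPeriodic L φ →
        ∫ x in cell L, u' x * (Δ φ) x = ∫ x in cell L, (F' x - ⨍ y in cell L, F' y) * φ x) ↔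
        u = N F))
    (f g : Lp ℂ 2 ((volume : Measure (Space d)).restrict (cell L))) :
    bg.GravityEq f g ↔ g = (((2 : ℝ) : ℂ) • (M * N * M)) f := by
  have hG : ∀ u : Lp ℂ 2 ((volume : Measure (Space d)).restrict (cell L)), u = N (M f) →
      (((2 : ℝ) : ℂ) • (M * N * M)) f =ᵐ[volume.restrict (cell L)]
        fun x => 2 * (bg.Ψ x : ℂ) * u x := by
    rintro u rfl
    filter_upwards [Lp.coeFn_smul ((2 : ℝ) : ℂ) (M (N (M f))), hM (N (M f))] with x h1 h2
    change (((2 : ℝ) : ℂ) • M (N (M f)) : Lp ℂ 2 (volume.restrict (cell L))) x = _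
    rw [h1, Pi.smul_apply, h2, smul_eq_mul]
    push_cast; ring
  constructor
  · rintro ⟨u, ⟨hu, hu0, huw⟩, hg⟩
    have hu' : MemLp u 2 (volume.restrict (cell L)) := hu
    have h1 : hu'.toLp u = N (M f) :=
      (hN _ _ _ _ (hM f) hu'.coeFn_toLp).1 ⟨hu0, fun φ hφ hp => huw φ ⟨hφ, hp⟩⟩
    refine Lp.ext (EventuallyEq.trans hg ?_)
    filter_upwards [hG _ h1, hu'.coeFn_toLp] with x h2 h3
    rw [h2, h3]
  · rintro rfl
    have h1 := (hN (M f) (N (M f)) _ _ (hM f) (ae_eq_refl _)).2 rfl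
    exact ⟨N (M f), ⟨Lp.memLp _, h1.1, fun φ hφ => h1.2 φ hφ.1 hφ.2⟩, hG _ rfl⟩

set_option maxHeartbeats 1000000 in
/-- The operators on the periodic box, where the resolvent of the Hamiltonian is compact. -/
lemma Equilibrium.exists_operators_box (bg : Equilibrium (Domain.periodicBox L hL))
    (hbg : bg.IsGroundState) :
    ∃ (B B₀ G : Lp ℂ 2 ((volume : Measure (Space d)).restrict (cell L)) →L[ℂ]
        Lp ℂ 2 ((volume : Measure (Space d)).restrict (cell L)))
      (c m : ℝ) (ψ : Lp ℂ 2 ((volume : Measure (Space d)).restrict (cell L))),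
      (∀ f g, bg.HamiltonianEq f g ↔ InvEq B c f g) ∧ (∀ f g, bg.GravityEq f g ↔ g = G f) ∧
      B.IsPositive ∧ (∀ x, B x = 0 → x = 0) ∧ 0 < c ∧ m ≤ 1 / c ∧
      (∀ x, (inner ℂ (B₀ x) x).re ≤ m * ‖x‖ ^ 2) ∧ IsCompactOperator (B - B₀) ∧
      IsSelfAdjoint G ∧ IsCompactOperator G ∧
      (∀ (e : ℝ) (f : Lp ℂ 2 ((volume : Measure (Space d)).restrict (cell L))), f ≠ 0 →
        bg.HamiltonianEq f ((e : ℂ) • f) → 0 ≤ e) ∧ ψ ≠ 0 ∧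
      bg.HamiltonianEq ψ 0 := by
  obtain ⟨b, r, hb⟩ : ∃ b r, IsPlaneWaveBasis L b r := exists_planeWave_basis hL
  have hk2 : Tendsto (fun n => ‖waveVector L n‖ ^ 2) cofinite atTop :=
    (tendsto_pow_atTop two_ne_zero).comp (tendsto_norm_waveVector hL)
  have hapos : ∀ n, 0 < (1 + ‖waveVector L n‖ ^ 2 / 2)⁻¹ := fun n => by positivity
  have ha1 : ∀ n, |(1 + ‖waveVector L n‖ ^ 2 / 2)⁻¹| ≤ 1 := fun n => by
    rw [abs_of_pos (hapos n)]
    exact inv_le_one_of_one_le₀ (by linarith [sq_nonneg ‖waveVector L n‖])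
  have ha0 : Tendsto (fun n => (1 + ‖waveVector L n‖ ^ 2 / 2)⁻¹) cofinite (𝓝 0) :=
    tendsto_inv_atTop_zero.comp
      (tendsto_atTop_add_const_left _ _ (hk2.atTop_div_const two_pos))
  have hn0 : Tendsto (fun n => -(‖waveVector L n‖ ^ 2)⁻¹) cofinite (𝓝 0) := by
    have := (tendsto_inv_atTop_zero.comp hk2).neg
    rwa [neg_zero] at this
  obtain ⟨Cn, hCn0, hCn⟩ : ∃ C, 0 ≤ C ∧ ∀ n, |-(‖waveVector L n‖ ^ 2)⁻¹| ≤ C := by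
    obtain ⟨C, hC⟩ := hn0.norm.bddAbove_range_of_cofinite
    exact ⟨C, (norm_nonneg _).trans (hC ⟨0, rfl⟩), fun n => hC ⟨n, rfl⟩⟩
  obtain ⟨A, hA, -⟩ := exists_diagonal b zero_le_one ha1
  obtain ⟨N, hN, -⟩ := exists_diagonal b hCn0 hCn
  have hApos := diagonal_isPositive b hA fun n => (hapos n).le
  have hAinj : ∀ x, A x = 0 → x = 0 := fun x hx => by
    refine hilbertBasis_ext b fun n => ?_
    have h1 := hA x n
    rw [hx, inner_zero_right] at h1
    rw [inner_zero_right]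
    exact (mul_eq_zero.1 h1.symm).resolve_left (by exact_mod_cast (hapos n).ne')
  obtain ⟨W, hW⟩ := exists_mul_cell L (w := fun x => bg.V x - bg.E)
    (bg.contDiff_V.continuous.sub continuous_const)
  obtain ⟨M, hM⟩ := exists_mul_cell L bg.contDiff_Ψ.continuous
  obtain ⟨B, hB, hBinj, hBA, hBeq⟩ := exists_resolvent hApos hAinj (mulL2_isSelfAdjoint hW) le_rfl
  have hBc : IsCompactOperator B := by
    rw [hBeq]
    exact (diagonal_isCompactOperator b hA ha0).comp_clm _
  have hc : 0 < 1 + ‖W‖ := by positivity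
  have hMs : IsSelfAdjoint M := mulL2_isSelfAdjoint hM
  have hNs : IsSelfAdjoint N := diagonal_isSelfAdjoint b hN
  have hHam := bg.hamiltonianEq_iff_box (hb.weak_kinetic_iff hL hA) hW
  have hH : ∀ f g, bg.HamiltonianEq f g ↔ InvEq B (1 + ‖W‖) f g := fun f g =>
    (hHam f g).trans (hBA f g).symm
  obtain ⟨ψ, hψ, hψΨ, e₀, he₀, hmin⟩ :
      ∃ ψ : Lp ℂ 2 ((volume : Measure (Space d)).restrict (cell L)), ψ ≠ 0 ∧
      (ψ =ᵐ[volume.restrict (cell L)] fun x => (bg.Ψ x : ℂ)) ∧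
      ∃ e : ℝ, bg.HamiltonianEq ψ ((e : ℂ) • ψ) ∧
      ∀ (e' : ℝ) (f : Lp ℂ 2 ((volume : Measure (Space d)).restrict (cell L))), f ≠ 0 →
        bg.HamiltonianEq f ((e' : ℂ) • f) → e ≤ e' := hbg
  have hψ0 := bg.hamiltonianEq_zero_box hψΨ
  have he0 : e₀ = 0 := by
    have h1 := InvEq.unique hBinj ((hH _ _).1 he₀) ((hH _ _).1 hψ0)
    exact Complex.ofReal_eq_zero.1 ((smul_eq_zero.1 h1).resolve_right hψ)
  -- The resolvent `B` is itself compact, so the comparison operator `B₀` and its bound `m` can both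
  -- be zero.
  refine ⟨B, 0, ((2 : ℝ) : ℂ) • (M * N * M), 1 + ‖W‖, 0, ψ, hH,
    bg.gravityEq_iff_box hM fun F u F' u' hF hu => hb.isInvLaplacian_iff hL hN hF hu, hB, hBinj,
    hc, by positivity, fun x => by simp, by rwa [sub_zero], ?_, ?_,
    fun e f hf h => he0 ▸ hmin e f hf h, hψ, hψ0⟩
  · rw [isSelfAdjoint_iff, star_smul, star_mul, star_mul, hMs.star_eq, hNs.star_eq, mul_assoc]
    simp
  · exact (((diagonal_isCompactOperator b hN hn0).clm_comp M).comp_clm M).smul ((2 : ℝ) : ℂ)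

end PeriodicBox

end SchrodingerPoisson


/-- Each domain supplies the same bounded data, namely a resolvent `B` of `Ĥ`, a comparison operator
`B₀`, a compact self-adjoint `G` and a zero mode. The rest is independent of the domain. -/
theorem mainTheorem3 {d : ℕ} (D : SchrodingerPoisson.Domain d)
    (bg : SchrodingerPoisson.Equilibrium D) (hbg : bg.IsGroundState) :
    (∀ ω2 : ℂ, bg.IsEigenvalue ω2 → ω2.im = 0) ∧
    ∃ ω2low : ℝ, IsLeast {ω2 : ℝ | bg.IsEigenvalue (ω2 : ℂ)} ω2low ∧
      -- `R = Ĥη`, `S = Θ̂Ĥη`, `T = ĤΘ̂Ĥη`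
      (∀ η R S T : D.L2, bg.HamiltonianEq η R → bg.ThetaEq R S → bg.HamiltonianEq S T →
        0 < (inner ℂ η R).re → ω2low ≤ (inner ℂ η T).re / (inner ℂ η R).re) ∧
      -- the same with `⟨η|ĤΘ̂Ĥ|η⟩` read as `⟨Ĥη|Θ̂Ĥη⟩`, for which `Ĥη` in the domain of `Θ̂` suffices
      (∀ η R S : D.L2, bg.HamiltonianEq η R → bg.ThetaEq R S →
        0 < (inner ℂ η R).re → ω2low ≤ (inner ℂ R S).re / (inner ℂ η R).re) := by
  obtain ⟨B, B₀, G, c, m, ψ, hH, hGr, hB, hBinj, hc, hm, hB₀, hC, hG, hGc, heig, hψ, hψ0⟩ :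
      ∃ (B B₀ G : D.L2 →L[ℂ] D.L2) (c m : ℝ) (ψ : D.L2),
      (∀ f g, bg.HamiltonianEq f g ↔ SchrodingerPoisson.InvEq B c f g) ∧
      (∀ f g, bg.GravityEq f g ↔ g = G f) ∧
      B.IsPositive ∧ (∀ x, B x = 0 → x = 0) ∧ 0 < c ∧ m ≤ 1 / c ∧
      (∀ x, (inner ℂ (B₀ x) x).re ≤ m * ‖x‖ ^ 2) ∧ IsCompactOperator (B - B₀) ∧
      IsSelfAdjoint G ∧ IsCompactOperator G ∧
      (∀ (e : ℝ) (f : D.L2), f ≠ 0 → bg.HamiltonianEq f ((e : ℂ) • f) → 0 ≤ e) ∧ ψ ≠ 0 ∧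
      bg.HamiltonianEq ψ 0 := by
    cases D with
    | wholeSpace => exact bg.exists_operators_wholeSpace hbg
    | periodicBox L hL => exact bg.exists_operators_box hbg
  exact SchrodingerPoisson.exists_isLeast_eigenvalue hH hGr hB hBinj hc hm hB₀ hC hG hGc heig hψ hψ0

end
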